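/- **Definitions.** A *vertical plane* $(\mathcal P,\pi)$ is an oriented topological space $\mathcal P$ homeomorphic to $\mathbb R^2$ with a locally trivial topological fibration $\pi:\mathcal P\to\mathbb R$, whose fibres are called vertical lines; the *canonical* one is $(\mathbb R^2,x)$, where $x$ is the first coordinate. A *transversal graph* in $(\mathcal P,\pi)$ is a closed subset $G\subset\mathcal P$ partitioned into finitely many points (*vertices*) and finitely many subsets homeomorphic to an open segment (*open edges*), such that: the closure $\overline E$ of each open edge $E$ (an *edge*) is homeomorphic to a closed, possibly unbounded, interval of $\mathbb R$, and $\overline E\setminus E$ consists of $0$, $1$ or $2$ vertices; $\pi$ restricted to each edge is a homeomorphism onto its image; and $\pi|_G$ is proper. The *valency* of a vertex is the number of edges containing it. The graph is *generic* if all its vertices have valency $1$ or $3$ and distinct vertices lie on distinct vertical lines. A point $p$ of a curve $\mathcal C\subset\mathcal P$ is a *topological critical point* if it has no neighbourhood in $\mathcal C$ on which $\pi$ is a homeomorphism onto its image. A *domain of finite type* is a closed subset $\mathcal D\subset\mathcal P$ that is a topological surface with non-empty boundary $\mathcal C$, such that $\pi|_{\mathcal D}$ is proper and the set $\Sigma_{\rm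 top}(\mathcal C)$ of topological critical points of $\mathcal C$ is finite. Its *collapse* $\rho:\mathcal P\to\tilde{\mathcal P}$ is the quotient of $\mathcal P$ that contracts each connected component of each fibre of $\pi|_{\mathcal D}$ to a point; $\tilde{\mathcal P}$ carries the projection $\tilde\pi$ induced by $\pi$ and the orientation induced by $\rho|_{\mathcal P\setminus\mathcal D}$. The *Poincaré–Reeb graph* of $\mathcal D$ is $\tilde{\mathcal D}=\rho(\mathcal D)\subset\tilde{\mathcal P}$, with vertex set $\rho(\Sigma_{\rm top}(\mathcal C))$. Subsets $X\subset\mathcal P$, $X'\subset\mathcal P'$ of vertical planes are *vertically equivalent* if there are orientation preserving homeomorphisms $\Phi:\mathcal P\to\mathcal P'$ and $\psi:\mathbb R\to\mathbb R$ with $\Phi(X)=X'$ and $\pi'\circ\Phi=\psi\circ\pi$. **Proposition.** Let $G$ be a compact connected (in particular non-empty) generic transversal graph in a vertical plane $(\mathcal P,\pi)$, such that each vertex of valency $3$ has at least one edge on its left and at least one edge on its right (where left and right refer to the values of $\pi$). Then there is a $C^\infty$ function $f:\mathbb R^2\to\mathbb R$ such that the curve $\mathcal C=(f=0)$ contains no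 critical point of $f$ and is the boundary of a domain of finite type $\mathcal D$ in $(\mathbb R^2,x)$ whose Poincaré–Reeb graph is vertically equivalent to $G$, by an equivalence that sends the vertices of $G$ onto those of the Poincaré–Reeb graph. -/

import Mathlib

open Set Filter Topology
open scoped Manifold

/-! ### Orientations of topological planes -/

/-- The loop `γ : [0, 2π] → ℝ²` avoids the origin and has winding number `+1` around it:
it has a continuous polar angle that increases by `2π` in total. -/
def WindsOnce (γ : ℝ → ℝ × ℝ) : Prop :=
  ∃ ρ θ : ℝ → ℝ, Continuous θ ∧ (∀ t, 0 < ρ t) ∧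
    (∀ t, γ t = (ρ t * Real.cos (θ t), ρ t * Real.sin (θ t))) ∧
    θ (2 * Real.pi) = θ 0 + 2 * Real.pi

/-- A map of the plane preserves the orientation at `p` (it has local degree `+1` there):
the images of small counterclockwise circles around `p` wind once, counterclockwise,
around the image of `p`. -/
def OrientationPreservingAt (f : ℝ × ℝ → ℝ × ℝ) (p : ℝ × ℝ) : Prop :=
  ∀ᶠ r in 𝓝[>] (0 : ℝ),
    WindsOnce (fun t => f (p + r • ((Real.cos t, Real.sin t) : ℝ × ℝ)) - f p)

/-- The orientation of the plane `P` represented by the global chart `c₀`: the set of all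
global charts (homeomorphisms onto `ℝ²`) that differ from `c₀` by an orientation preserving
homeomorphism of `ℝ²`. -/
def orientationClass {P : Type*} [TopologicalSpace P] (c₀ : P ≃ₜ ℝ × ℝ) : Set (P ≃ₜ ℝ × ℝ) :=
  {c | ∀ q : ℝ × ℝ, OrientationPreservingAt (fun z => c (c₀.symm z)) q}

/-- A homeomorphism between planes with orientations `o` and `o'` (given as their sets of positive
charts) preserves the orientations: it does so when read in positive charts. -/
def IsOrientationPreserving {P P' : Type*} [TopologicalSpace P] [TopologicalSpace P']
    (o : Set (P ≃ₜ ℝ × ℝ)) (o' : Set (P' ≃ₜ ℝ × ℝ)) (Φ : P ≃ₜ P') : Prop :=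
  ∃ c ∈ o, ∃ c' ∈ o', ∀ q : ℝ × ℝ,
    OrientationPreservingAt (fun z => c' (Φ (c.symm z))) q

/-! ### Vertical planes -/

/-- `(P, π)` is a vertical plane with orientation `o`: `P` is homeomorphic to `ℝ²` and oriented,
and `π : P → ℝ` is a locally trivial topological fibration. (As `P` is homeomorphic to `ℝ²`, the
fibres are lines.) -/
structure IsVerticalPlane {P : Type*} [TopologicalSpace P] (π : P → ℝ)
    (o : Set (P ≃ₜ ℝ × ℝ)) : Prop where
  orientation : ∃ c₀ : P ≃ₜ ℝ × ℝ, o = orientationClass c₀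
  locallyTrivial : ∀ b : ℝ, ∃ e : Bundle.Trivialization ℝ π, b ∈ e.baseSet

/-- The orientation of the canonical vertical plane `(ℝ², x)`. -/
def canonicalOrientation : Set ((ℝ × ℝ) ≃ₜ ℝ × ℝ) :=
  orientationClass (Homeomorph.refl (ℝ × ℝ))

/-- The pair `(Φ, ψ)` is an equivalence of vertical planes: `Φ` and `ψ` are orientation preserving
homeomorphisms, and `π' ∘ Φ = ψ ∘ π`. Subsets `X`, `X'` are vertically equivalent if there is such
a pair with `Φ(X) = X'`. -/
structure IsVerticalEquivalence {P P' : Type*} [TopologicalSpace P] [TopologicalSpace P']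
    (π : P → ℝ) (o : Set (P ≃ₜ ℝ × ℝ)) (π' : P' → ℝ) (o' : Set (P' ≃ₜ ℝ × ℝ))
    (Φ : P ≃ₜ P') (ψ : ℝ ≃ₜ ℝ) : Prop where
  orientation : IsOrientationPreserving o o' Φ
  strictMono : StrictMono ψ
  comm : ∀ p, π' (Φ p) = ψ (π p)

/-! ### Transversal graphs -/

/-- A transversal graph in `(P, π)`. -/
structure TransversalGraph {P : Type*} [TopologicalSpace P] (π : P → ℝ) where
  carrier : Set P
  vertices : Set P
  openEdges : Set (Set P)
  isClosed_carrier : IsClosed carrier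
  finite_vertices : vertices.Finite
  finite_openEdges : openEdges.Finite
  carrier_eq : carrier = vertices ∪ ⋃₀ openEdges
  disjoint_vertices : ∀ E ∈ openEdges, Disjoint vertices E
  disjoint_openEdges : ∀ E ∈ openEdges, ∀ E' ∈ openEdges, E ≠ E' → Disjoint E E'
  /-- open edges are homeomorphic to an open segment -/
  openEdge_homeo : ∀ E ∈ openEdges, Nonempty (E ≃ₜ Ioo (0 : ℝ) 1)
  /-- edges are homeomorphic to a closed, possibly unbounded, interval of `ℝ` -/
  edge_homeo : ∀ E ∈ openEdges, ∃ I : Set ℝ, IsClosed I ∧ I.OrdConnected ∧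
    Nonempty (closure E ≃ₜ I)
  edge_ends : ∀ E ∈ openEdges, closure E \ E ⊆ vertices ∧ (closure E \ E).ncard ≤ 2
  transversal : ∀ E ∈ openEdges, IsEmbedding ((closure E).domRestrict π)
  proper : IsProperMap (carrier.domRestrict π)

namespace TransversalGraph

variable {P : Type*} [TopologicalSpace P] {π : P → ℝ}

/-- The number of edges at `v` (an edge never has both its ends at the same vertex). -/
noncomputable def valency (G : TransversalGraph π) (v : P) : ℕ :=
  {E | E ∈ G.openEdges ∧ v ∈ closure E}.ncard

/-- Vertices have valency `1` or `3`, and distinct vertices lie on distinct vertical lines. -/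
structure IsGeneric (G : TransversalGraph π) : Prop where
  valency_eq : ∀ v ∈ G.vertices, G.valency v = 1 ∨ G.valency v = 3
  injOn : InjOn π G.vertices

/-- Each vertex of valency `3` is of one of the two usual kinds: it has an edge on its left and
an edge on its right (so two on one side and one on the other). -/
def IsTwoSided (G : TransversalGraph π) : Prop :=
  ∀ v ∈ G.vertices, G.valency v = 3 →
    (∃ E ∈ G.openEdges, v ∈ closure E ∧ ∃ p ∈ E, π p < π v) ∧
    (∃ E ∈ G.openEdges, v ∈ closure E ∧ ∃ p ∈ E, π v < π p)

end TransversalGraph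

/-! ### Domains of finite type -/

/-- The subset `D` is a topological surface with boundary, and `C` is its boundary. -/
def IsSurfaceWithBoundary {P : Type*} [TopologicalSpace P] (D C : Set P) : Prop :=
  ∃ _ : ChartedSpace (EuclideanHalfSpace 2) D,
    ((↑) : D → P) '' (ModelWithCorners.boundary (I := 𝓡∂ 2) D) = C

/-- The topological critical points of `π` on the curve `C`: those without a neighbourhood in `C`
on which `π` is a homeomorphism onto its image. -/
def topCriticalSet {P : Type*} [TopologicalSpace P] (π : P → ℝ) (C : Set P) : Set P :=
  {p ∈ C | ¬ ∃ U : Set P, IsOpen U ∧ p ∈ U ∧ IsEmbedding ((U ∩ C).domRestrict π)}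

/-- `D` is a domain of finite type in `(P, π)`, with boundary `C`. -/
structure IsDomainOfFiniteType {P : Type*} [TopologicalSpace P] (π : P → ℝ)
    (D C : Set P) : Prop where
  isClosed : IsClosed D
  surface : IsSurfaceWithBoundary D C
  nonempty_boundary : C.Nonempty
  proper : IsProperMap (D.domRestrict π)
  finite_critical : (topCriticalSet π C).Finite

/-! ### The collapse and the Poincaré–Reeb graph -/

/-- The vertical equivalence relation of points relative to `D`. -/
def verticalSetoid {P : Type*} [TopologicalSpace P] (π : P → ℝ) (D : Set P) : Setoid P where
  r p q := π p = π q ∧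
    ((p ∈ D ∧ q ∈ connectedComponentIn (π ⁻¹' {π p} ∩ D) p) ∨ (p = q ∧ p ∉ D))
  iseqv := by
    refine ⟨fun p => ⟨rfl, ?_⟩, ?_, ?_⟩
    · by_cases hp : p ∈ D
      · exact Or.inl ⟨hp, mem_connectedComponentIn ⟨rfl, hp⟩⟩
      · exact Or.inr ⟨rfl, hp⟩
    · rintro p q ⟨h, ⟨hp, hq⟩ | ⟨rfl, hp⟩⟩
      · have hqD := connectedComponentIn_subset _ _ hq
        refine ⟨h.symm, Or.inl ⟨hqD.2, ?_⟩⟩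
        rw [← h, ← connectedComponentIn_eq hq]
        exact mem_connectedComponentIn ⟨rfl, hp⟩
      · exact ⟨rfl, Or.inr ⟨rfl, hp⟩⟩
    · rintro p q s ⟨h, ⟨hp, hq⟩ | ⟨rfl, hp⟩⟩ ⟨h', hs⟩
      · have hqD := connectedComponentIn_subset _ _ hq
        rcases hs with ⟨-, hs⟩ | ⟨rfl, hq'⟩
        · refine ⟨h.trans h', Or.inl ⟨hp, ?_⟩⟩
          rwa [← h, ← connectedComponentIn_eq hq] at hs
        · exact absurd hqD.2 hq'
      · exact ⟨h', hs⟩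

/-- The `D`-collapse of `P`, with the quotient topology. -/
abbrev Collapse {P : Type*} [TopologicalSpace P] (π : P → ℝ) (D : Set P) : Type _ :=
  Quotient (verticalSetoid π D)

/-- The collapsing map. -/
def collapseMap {P : Type*} [TopologicalSpace P] (π : P → ℝ) (D : Set P) : P → Collapse π D :=
  Quotient.mk (verticalSetoid π D)

/-- The projection of the `D`-collapse, induced by `π`. -/
def collapseProj {P : Type*} [TopologicalSpace P] (π : P → ℝ) (D : Set P) : Collapse π D → ℝ :=
  Quotient.lift π (fun _ _ h => h.1)

/-- The orientation of the `D`-collapse induced from the orientation `o` of `P` by the collapsing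
map outside `D`: the charts of the collapse through which that map is orientation preserving at
all points outside `D`. -/
def collapseOrientation {P : Type*} [TopologicalSpace P] (π : P → ℝ) (o : Set (P ≃ₜ ℝ × ℝ))
    (D : Set P) : Set (Collapse π D ≃ₜ ℝ × ℝ) :=
  {c' | ∀ p, p ∉ D → ∀ c ∈ o,
    OrientationPreservingAt (fun z => c' (collapseMap π D (c.symm z))) (c p)}

/-- The Poincaré–Reeb graph of `D`, as a subset of the `D`-collapse. -/
def poincareReebSet {P : Type*} [TopologicalSpace P] (π : P → ℝ) (D : Set P) :
    Set (Collapse π D) :=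
  collapseMap π D '' D

/-- The vertices of the Poincaré–Reeb graph of a domain `D` with boundary `C`. -/
def poincareReebVertices {P : Type*} [TopologicalSpace P] (π : P → ℝ) (D C : Set P) :
    Set (Collapse π D) :=
  collapseMap π D '' topCriticalSet π C

/-!
A locally trivial fibration over the line is trivial, so the vertical plane may be taken to be `ℝ²`
with the first coordinate as projection (`IsVerticalPlane.exists_homeomorph`). The trivialization
can be chosen positive: a homeomorphism of the plane has a turning number, which is `1` or `-1`,
and composition with the reflection in the horizontal axis changes its sign
(`orientationPreservingAt_or_reflection`). In these coordinates the graph is a finite system of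
arcs, each the graph of a continuous function `y e` over a compact interval, and over each vertex
abscissa there is exactly one vertex, either an end of one arc or a fork with a stem on one side
and two branches on the other (`TransversalGraph.exists_graphDiagram`).

Over the abscissas far from the vertices, the domain is a union of horizontal strips, one for each
arc `e`, over which `y` runs through a constant interval `[A e, B e]`. The intervals are ordered
like the arcs, and those of the two branches of a fork have the outer ends of the interval of the
stem, so that the latter only has to lose a gap. Such intervals are found by sweeping from left to
right (`GraphDiagram.exists_levels`). The domain is `{f ≤ 0}`, where `f` is the product of the
polynomials `(y - A e) * (y - B e)` over the arcs present at the given abscissa. Across a vertex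
this product gains or loses a factor `(y - l) * (y - u)`, where `[l, u]` is the interval of the end
arc or the gap between those of the branches. A smooth switch makes this transition: it deforms the
factor into the constant `1` through quadratic polynomials whose two roots merge exactly over the
vertex. The only vertical tangents of `f = 0` are therefore at these tips, one for each vertex
(`eq_tip_of_fderiv_eq_zero`). The derivative of `f` in the horizontal direction is not zero there,
so that `f` has no critical point on `f = 0`, and the tips are the topological critical points of
that curve (`topCriticalSet_defFun`).

A tip at an end lies in a degenerate interval of the fibre, and a tip at a fork lies in the
interval of the stem at the moment when it splits. To see that the collapse of this domain is the
given graph, one looks for a continuous function `g` of the plane which is monotone on each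
vertical line, at bounded distance from the identity there, constant on a vertical segment exactly
if the segment lies in the domain, and equal to `y e` on the part of the domain where `y` is in the
interval of the arc `e`. These conditions are convex, so it is enough to find `g` over a
neighbourhood of each abscissa and to use a partition of unity (`exists_collapse`). The map `(x, y)
↦ (x, g (x, y))` is then a quotient map with the same fibres as the collapse, and so it gives a
chart of the latter (`exists_collapse_homeomorph`). The chart is positive because an increment of
this map never points in the direction opposite to the increment of the argument, if the base point
is not in the domain (`OrientationPreservingAt.fiberwise`). In this chart, the Poincaré–Reeb graph
is the union of the arcs, and its vertices are the vertices of the diagram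
(`GraphDiagram.exists_realization`).
-/

/-! ### Winding numbers and orientations -/

/-- The identification of `ℝ²` with the complex plane. -/
def planeToComplex (p : ℝ × ℝ) : ℂ := ⟨p.1, p.2⟩

theorem continuous_planeToComplex : Continuous planeToComplex :=
  Complex.equivRealProdCLM.symm.continuous

/-- The reflection of the plane in the horizontal axis. -/
def verticalReflection : (ℝ × ℝ) ≃ₜ ℝ × ℝ :=
  (Homeomorph.refl ℝ).prodCongr (Homeomorph.neg ℝ)

theorem planeToComplex_polar (ρ θ : ℝ) :
    planeToComplex (ρ * Real.cos θ, ρ * Real.sin θ) = ρ * Complex.exp (θ * Complex.I) := by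
  apply Complex.ext <;> simp [planeToComplex, Complex.exp_ofReal_mul_I_re,
    Complex.exp_ofReal_mul_I_im]

theorem planeToComplex_injective : Function.Injective planeToComplex := fun _ _ h =>
  Prod.ext (congrArg Complex.re h) (congrArg Complex.im h)

theorem windsOnce_iff {γ : ℝ → ℝ × ℝ} : WindsOnce γ ↔ ∃ ρ θ : ℝ → ℝ, Continuous θ ∧
    (∀ t, 0 < ρ t) ∧ (∀ t, planeToComplex (γ t) = ρ t * Complex.exp (θ t * Complex.I)) ∧
    θ (2 * Real.pi) = θ 0 + 2 * Real.pi := by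
  constructor
  · rintro ⟨ρ, θ, hθ, hρ, h, hp⟩
    exact ⟨ρ, θ, hθ, hρ, fun t => by rw [h, planeToComplex_polar], hp⟩
  · rintro ⟨ρ, θ, hθ, hρ, h, hp⟩
    exact ⟨ρ, θ, hθ, hρ, fun t => planeToComplex_injective (by rw [h, planeToComplex_polar]), hp⟩

/-- A loop that never points in the direction opposite to that of a loop winding once
winds once too: the angle between the two is a continuous function in `(-π, π)`. -/
theorem WindsOnce.of_div_mem_slitPlane {γ δ : ℝ → ℝ × ℝ} (h : WindsOnce γ) (hγ : Continuous γ)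
    (hδ : Continuous δ) (hγp : γ (2 * Real.pi) = γ 0) (hδp : δ (2 * Real.pi) = δ 0)
    (hd : ∀ t, planeToComplex (δ t) / planeToComplex (γ t) ∈ Complex.slitPlane) :
    WindsOnce δ := by
  obtain ⟨ρ, θ, hθ, hρ, hγθ, hp⟩ := windsOnce_iff.1 h
  have hγ0 : ∀ t, planeToComplex (γ t) ≠ 0 := fun t => by
    rw [hγθ]
    exact mul_ne_zero (Complex.ofReal_ne_zero.2 (hρ t).ne') (Complex.exp_ne_zero _)
  refine windsOnce_iff.2 ⟨fun t => ρ t * ‖planeToComplex (δ t) / planeToComplex (γ t)‖,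
    fun t => θ t + Complex.arg (planeToComplex (δ t) / planeToComplex (γ t)), ?_, ?_, ?_, ?_⟩
  · refine hθ.add (continuous_iff_continuousAt.2 fun t => ?_)
    exact ContinuousAt.comp
      (f := fun t => planeToComplex (δ t) / planeToComplex (γ t)) (Complex.continuousAt_arg (hd t))
      ((continuous_planeToComplex.comp hδ).div (continuous_planeToComplex.comp hγ)
        hγ0).continuousAt
  · exact fun t => mul_pos (hρ t) (norm_pos_iff.2 (Complex.slitPlane_ne_zero (hd t)))
  · intro t
    have h1 := Complex.norm_mul_exp_arg_mul_I (planeToComplex (δ t) / planeToComplex (γ t))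
    rw [Complex.ofReal_mul, Complex.ofReal_add, add_mul, Complex.exp_add,
      mul_mul_mul_comm, ← hγθ, h1, mul_div_cancel₀ _ (hγ0 t)]
  · simp only [hγp, hδp, hp]
    ring

theorem eq_of_continuous_of_forall_int {X : Type*} [TopologicalSpace X] [PreconnectedSpace X]
    {f : X → ℝ} (hf : Continuous f) (h : ∀ x, ∃ n : ℤ, f x = n) (x y : X) : f x = f y := by
  choose n hn using h
  have hnc : Continuous n := by
    rw [Int.isClosedEmbedding_coe_real.isEmbedding.continuous_iff]
    exact hf.congr hn
  rw [hn, hn, PreconnectedSpace.constant ‹_› hnc]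

theorem eq_of_continuous_of_exp_eq {X : Type*} [TopologicalSpace X] [PreconnectedSpace X]
    {f g : X → ℂ} (hf : Continuous f) (hg : Continuous g)
    (h : ∀ x, Complex.exp (f x) = Complex.exp (g x)) :
    ∃ n : ℤ, ∀ x, f x = g x + n * (2 * Real.pi * Complex.I) := by
  have h' : ∀ x, ∃ n : ℤ, f x = g x + n * (2 * Real.pi * Complex.I) := fun x =>
    Complex.exp_eq_exp_iff_exists_int.1 (h x)
  choose n hn using h'
  have hc : Continuous fun x => ((f x - g x) / (2 * Real.pi * Complex.I)).re :=
    Complex.continuous_re.comp ((hf.sub hg).div_const _)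
  have hi : ∀ x, ((f x - g x) / (2 * Real.pi * Complex.I)).re = n x := fun x => by
    rw [hn x, add_sub_cancel_left, mul_div_cancel_right₀ _ Complex.two_pi_I_ne_zero]
    simp
  have := eq_of_continuous_of_forall_int hc (fun x => ⟨n x, hi x⟩)
  rcases isEmpty_or_nonempty X with hX | ⟨⟨x₀⟩⟩
  · exact ⟨0, fun x => (hX.false x).elim⟩
  · refine ⟨n x₀, fun x => ?_⟩
    have h1 := this x x₀
    rw [hi, hi] at h1
    rw [hn x, Int.cast_inj.1 h1]

/-- The homeomorphism `h` of the plane has turning number `k`: the increments of `h` at every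
point `q`, in logarithmic polar coordinates around `q` and `h q`, are given by a continuous
function, which increases by `2πik` when the argument of the increment makes a full turn. -/
def HasTurningNumber (h : (ℝ × ℝ) ≃ₜ ℝ × ℝ) (k : ℤ) : Prop :=
  ∃ L : (ℝ × ℝ) × ℂ → ℂ, Continuous L ∧
    (∀ q w, Complex.exp (L (q, w)) =
      planeToComplex (h (q + ((Complex.exp w).re, (Complex.exp w).im)) - h q)) ∧
    ∀ q w, L (q, w + 2 * Real.pi * Complex.I) = L (q, w) + k * (2 * Real.pi * Complex.I)

theorem exists_hasTurningNumber (h : (ℝ × ℝ) ≃ₜ ℝ × ℝ) : ∃ k, HasTurningNumber h k := by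
  have hg : Continuous fun x : (ℝ × ℝ) × ℂ =>
      planeToComplex (h (x.1 + ((Complex.exp x.2).re, (Complex.exp x.2).im)) - h x.1) := by
    apply continuous_planeToComplex.comp
    fun_prop
  obtain ⟨L, hL, hL'⟩ := Complex.exists_continuousOn_eqOn_exp_comp (X := (ℝ × ℝ) × ℂ)
    (U := univ) (by
      have : ContractibleSpace (univ : Set ((ℝ × ℝ) × ℂ)) :=
        convex_univ.contractibleSpace univ_nonempty
      exact SimplyConnectedSpace.ofContractible _) isOpen_univ hg.continuousOn (by
      rintro ⟨⟨q, w⟩, -, hx⟩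
      have h0 : planeToComplex 0 = 0 := rfl
      have h1 := planeToComplex_injective (hx.trans h0.symm)
      have h2 := h.injective (sub_eq_zero.1 h1)
      simp only [add_eq_left, Prod.mk_eq_zero] at h2
      exact Complex.exp_ne_zero w (Complex.ext h2.1 h2.2))
  rw [continuousOn_univ] at hL
  have hL1 : ∀ q w, Complex.exp (L (q, w)) =
      planeToComplex (h (q + ((Complex.exp w).re, (Complex.exp w).im)) - h q) :=
    fun q w => hL' (mem_univ (q, w))
  obtain ⟨k, hk⟩ := eq_of_continuous_of_exp_eq
    (f := fun x : (ℝ × ℝ) × ℂ => L (x.1, x.2 + 2 * Real.pi * Complex.I)) (g := L)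
    (by fun_prop) hL (fun x => by
      obtain ⟨q, w⟩ := x
      simp only [hL1, Complex.exp_periodic w])
  exact ⟨k, L, hL, hL1, fun q w => hk (q, w)⟩

theorem add_zmul_of_forall_add {F : ℂ → ℂ} {c d : ℂ} (h : ∀ w, F (w + c) = F w + d) (n : ℤ)
    (w : ℂ) : F (w + n * c) = F w + n * d := by
  induction n with
  | zero => simp
  | succ n ih =>
    push_cast at ih ⊢
    rw [add_mul, one_mul, ← add_assoc, h, ih]
    ring
  | pred n ih =>
    push_cast at ih ⊢
    have := h (w + (-n - 1) * c)
    rw [show w + (-n - 1) * c + c = w + -n * c by ring, ih] at this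
    linear_combination -this

theorem HasTurningNumber.mul_eq_one {h : (ℝ × ℝ) ≃ₜ ℝ × ℝ} {k k' : ℤ} (hk : HasTurningNumber h k)
    (hk' : HasTurningNumber h.symm k') : k * k' = 1 := by
  obtain ⟨L, hLc, hL, hLk⟩ := hk
  obtain ⟨M, hMc, hM, hMk⟩ := hk'
  -- in logarithmic coordinates, the composition of the two maps differs from the identity
  -- by a constant
  obtain ⟨n, hn⟩ := eq_of_continuous_of_exp_eq (X := ℂ) (f := fun w => M (h 0, L (0, w)))
    (g := fun w => w) (by fun_prop) continuous_id (fun w => by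
      have h1 : ∀ p : ℝ × ℝ, ((planeToComplex p).re, (planeToComplex p).im) = p := fun _ => rfl
      rw [hM, hL, h1, add_sub_cancel, h.symm_apply_apply, h.symm_apply_apply, zero_add, sub_zero]
      rfl)
  have h1 := hn (2 * Real.pi * Complex.I)
  have h2 := hLk 0 0
  have h3 := hn 0
  have h4 := add_zmul_of_forall_add (F := fun w => M (h 0, w)) (fun w => hMk (h 0) w) k (L (0, 0))
  rw [zero_add] at h2
  simp only [h2] at h1
  rw [h4, h3] at h1
  have h5 : ((k * k' : ℤ) : ℂ) * (2 * Real.pi * Complex.I) = (1 : ℤ) * (2 * Real.pi * Complex.I) := by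
    push_cast
    linear_combination h1
  exact_mod_cast mul_right_cancel₀ Complex.two_pi_I_ne_zero h5

theorem HasTurningNumber.reflection {h : (ℝ × ℝ) ≃ₜ ℝ × ℝ} {k : ℤ} (hk : HasTurningNumber h k) :
    HasTurningNumber (h.trans verticalReflection) (-k) := by
  obtain ⟨L, hLc, hL, hLk⟩ := hk
  refine ⟨fun x => starRingEnd ℂ (L x), Complex.continuous_conj.comp hLc, fun q w => ?_,
    fun q w => ?_⟩
  · rw [Complex.exp_conj, hL]
    apply Complex.ext <;> simp [planeToComplex, verticalReflection]
    ring
  · simp only [hLk]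
    simp [map_add, map_mul]
    exact Or.inl (map_ofNat _ 2)

theorem planeToComplex_circle {r : ℝ} (hr : 0 < r) (t : ℝ) :
    (r • ((Real.cos t, Real.sin t) : ℝ × ℝ)) =
      ((Complex.exp (Real.log r + t * Complex.I)).re,
        (Complex.exp (Real.log r + t * Complex.I)).im) := by
  rw [Complex.exp_add, ← Complex.ofReal_exp, Real.exp_log hr]
  simp [Complex.exp_ofReal_mul_I_re, Complex.exp_ofReal_mul_I_im]

theorem HasTurningNumber.orientationPreservingAt {h : (ℝ × ℝ) ≃ₜ ℝ × ℝ}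
    (hk : HasTurningNumber h 1) (q : ℝ × ℝ) : OrientationPreservingAt h q := by
  obtain ⟨L, hLc, hL, hLk⟩ := hk
  filter_upwards [self_mem_nhdsWithin] with r hr
  refine windsOnce_iff.2 ⟨fun t => Real.exp (L (q, Real.log r + t * Complex.I)).re,
    fun t => (L (q, Real.log r + t * Complex.I)).im, ?_, fun t => Real.exp_pos _, fun t => ?_, ?_⟩
  · exact Complex.continuous_im.comp (hLc.comp (by fun_prop))
  · rw [planeToComplex_circle hr, ← hL, Complex.ofReal_exp, ← Complex.exp_add, Complex.re_add_im]
  · have := hLk q (Real.log r)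
    push_cast
    rw [this]
    simp

theorem HasTurningNumber.eq_one {h : (ℝ × ℝ) ≃ₜ ℝ × ℝ} {k : ℤ} (hk : HasTurningNumber h k)
    {q : ℝ × ℝ} (hq : OrientationPreservingAt h q) : k = 1 := by
  obtain ⟨L, hLc, hL, hLk⟩ := hk
  obtain ⟨r, hw, hr⟩ := (hq.and self_mem_nhdsWithin).exists
  obtain ⟨ρ, θ, hθ, hρ, hγ, hp⟩ := windsOnce_iff.1 hw
  have hr' : 0 < r := hr
  have key : ∀ t : ℝ, ∃ n : ℤ,
      ((L (q, Real.log r + t * Complex.I)).im - θ t) / (2 * Real.pi) = n := fun t => by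
    have h1 := hγ t
    rw [planeToComplex_circle hr', ← hL, ← Real.exp_log (hρ t), Complex.ofReal_exp,
      ← Complex.exp_add] at h1
    obtain ⟨n, hn⟩ := Complex.exp_eq_exp_iff_exists_int.1 h1
    refine ⟨n, ?_⟩
    have h2 := congrArg Complex.im hn
    simp only [Complex.add_im, Complex.mul_im, Complex.ofReal_re, Complex.ofReal_im,
      Complex.I_re, Complex.I_im, Complex.mul_re, Complex.intCast_re, Complex.intCast_im,
      Complex.re_ofNat, Complex.im_ofNat] at h2
    field_simp
    linarith
  have hc : Continuous fun t : ℝ =>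
      ((L (q, Real.log r + t * Complex.I)).im - θ t) / (2 * Real.pi) :=
    ((Complex.continuous_im.comp (hLc.comp (by fun_prop))).sub hθ).div_const _
  have h1 := eq_of_continuous_of_forall_int hc key (2 * Real.pi) 0
  have h2 := congrArg Complex.im (hLk q (Real.log r))
  have hpi := Real.pi_pos
  rw [div_left_inj' (by positivity), hp] at h1
  push_cast at h1
  rw [zero_mul, add_zero] at h1
  simp only [Complex.add_im, Complex.mul_im, Complex.ofReal_re, Complex.ofReal_im,
      Complex.I_re, Complex.I_im, Complex.mul_re, Complex.intCast_re, Complex.intCast_im,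
      Complex.re_ofNat, Complex.im_ofNat] at h2
  have h3 : (k : ℝ) * (2 * Real.pi) = 1 * (2 * Real.pi) := by linarith
  exact_mod_cast mul_right_cancel₀ (by positivity) h3

/-- A homeomorphism of the plane preserves the orientation after composition with a reflection
if it does not do so itself: its turning number is an invertible integer. -/
theorem orientationPreservingAt_or_reflection (h : (ℝ × ℝ) ≃ₜ ℝ × ℝ) :
    (∀ q, OrientationPreservingAt h q) ∨
      ∀ q, OrientationPreservingAt (h.trans verticalReflection) q := by
  obtain ⟨k, hk⟩ := exists_hasTurningNumber h
  obtain ⟨k', hk'⟩ := exists_hasTurningNumber h.symm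
  rcases Int.isUnit_iff.1 (IsUnit.of_mul_eq_one _ (hk.mul_eq_one hk')) with rfl | rfl
  · exact Or.inl hk.orientationPreservingAt
  · exact Or.inr hk.reflection.orientationPreservingAt

theorem orientationPreservingAt_symm {h : (ℝ × ℝ) ≃ₜ ℝ × ℝ} {q : ℝ × ℝ}
    (hq : OrientationPreservingAt h q) (p : ℝ × ℝ) : OrientationPreservingAt h.symm p := by
  obtain ⟨k, hk⟩ := exists_hasTurningNumber h
  obtain ⟨k', hk'⟩ := exists_hasTurningNumber h.symm
  have h1 := hk.mul_eq_one hk'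
  rw [hk.eq_one hq, one_mul] at h1
  subst h1
  exact hk'.orientationPreservingAt p

theorem orientationPreservingAt_id (q : ℝ × ℝ) : OrientationPreservingAt (fun z => z) q := by
  filter_upwards [self_mem_nhdsWithin] with r hr
  exact ⟨fun _ => r, id, continuous_id, fun _ => hr, fun t => by simp, by simp⟩

/-- Let the continuous map `R` of the plane preserve first coordinates and act on the vertical line
through `c q` so that the order relative to `c q` is strictly preserved. Then `R ∘ c` preserves the
orientation at `q` as soon as `c` does: the increments of `c` at `q` and those of `R ∘ c` never
point in opposite directions. -/
theorem OrientationPreservingAt.fiberwise {c : (ℝ × ℝ) ≃ₜ ℝ × ℝ} {q : ℝ × ℝ}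
    (hc : OrientationPreservingAt c q) {g : ℝ × ℝ → ℝ} (hg : Continuous g)
    (hlt : ∀ y, y < (c q).2 → g ((c q).1, y) < g (c q))
    (hgt : ∀ y, (c q).2 < y → g (c q) < g ((c q).1, y)) :
    OrientationPreservingAt (fun z => ((c z).1, g (c z))) q := by
  filter_upwards [hc, self_mem_nhdsWithin] with r hr hr0
  have hper : ((Real.cos (2 * Real.pi), Real.sin (2 * Real.pi)) : ℝ × ℝ) =
      (Real.cos 0, Real.sin 0) := by simp
  refine hr.of_div_mem_slitPlane (by fun_prop) (by fun_prop) (by simp only [hper])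
    (by simp only [hper]) fun t => ?_
  set z := c (q + r • (Real.cos t, Real.sin t)) with hz
  have hne : z ≠ c q := by
    rw [hz]
    intro h
    have h1 := c.injective h
    simp only [add_eq_left, Prod.smul_mk, Prod.mk_eq_zero, smul_eq_mul, mul_eq_zero,
      (show r ≠ 0 from ne_of_gt hr0), false_or] at h1
    have := Real.sin_sq_add_cos_sq t
    rw [h1.1, h1.2] at this
    norm_num at this
  -- off the vertical line of `c q`, the imaginary part of the quotient of the increments vanishes
  -- only if the increments are equal; on that line the quotient is positive
  have hv : planeToComplex (z - c q) ≠ 0 := fun h =>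
    hne (sub_eq_zero.1 (planeToComplex_injective (h.trans (show (0 : ℂ) = planeToComplex 0 from rfl))))
  have hpos : 0 < Complex.normSq (planeToComplex (z - c q)) := Complex.normSq_pos.2 hv
  rw [Complex.mem_slitPlane_iff, Complex.div_re, Complex.div_im]
  simp only [planeToComplex, Prod.fst_sub, Prod.snd_sub] at hpos ⊢
  rw [← add_div, ← sub_div]
  by_cases hx : z.1 = (c q).1
  · left
    rw [hx, sub_self, zero_mul, zero_add]
    refine div_pos ?_ (by simpa [hx] using hpos)
    have hzx : z = ((c q).1, z.2) := Prod.ext hx rfl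
    rcases lt_trichotomy z.2 (c q).2 with h | h | h
    · have := hlt _ h
      rw [← hzx] at this
      exact mul_pos_of_neg_of_neg (by linarith) (by linarith)
    · exact absurd (Prod.ext hx h) hne
    · have := hgt _ h
      rw [← hzx] at this
      exact mul_pos (by linarith) (by linarith)
  · have hx' : z.1 - (c q).1 ≠ 0 := sub_ne_zero.2 hx
    by_cases hy : g z - g (c q) = z.2 - (c q).2
    · left
      rw [hy]
      exact div_pos (by positivity) hpos
    · right
      refine div_ne_zero ?_ hpos.ne'
      rw [mul_comm (z.1 - (c q).1), ← sub_mul]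
      exact mul_ne_zero (sub_ne_zero.2 hy) hx'

/-! ### Global trivialization of a vertical plane -/

/-- Local trivializations can be patched over a compact interval. This is the argument of
`FiberBundle.exists_trivialization_Icc_subset`, for a projection without the structure of a bundle. -/
theorem exists_trivialization_Icc_subset_of_locally {P F : Type*} [TopologicalSpace P]
    [TopologicalSpace F] {π : P → ℝ} (h : ∀ b : ℝ, ∃ e : Bundle.Trivialization F π, b ∈ e.baseSet)
    (a b : ℝ) : ∃ e : Bundle.Trivialization F π, Icc a b ⊆ e.baseSet := by
  rcases lt_or_ge b a with hba | hab
  · obtain ⟨e, -⟩ := h a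
    exact ⟨e, by simp [hba]⟩
  have key : ∀ x ∈ Icc a b, ∃ e : Bundle.Trivialization F π, Icc a x ⊆ e.baseSet := by
    have hclosed : IsClosed ({x | ∃ e : Bundle.Trivialization F π, Icc a x ⊆ e.baseSet} ∩ Icc a b) := by
      refine isClosed_of_closure_subset fun c hc => ?_
      have hcI : c ∈ Icc a b := (closure_minimal inter_subset_right isClosed_Icc) hc
      obtain ⟨e, he⟩ := h c
      obtain ⟨δ, hδ, hball⟩ := Metric.isOpen_iff.1 e.open_baseSet c he
      obtain ⟨d, ⟨⟨e', he'⟩, hd⟩, hdc⟩ := Metric.mem_closure_iff.1 hc δ hδ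
      rw [Real.dist_eq] at hdc
      have hde : d ∈ e.baseSet := hball (by rwa [Metric.mem_ball, dist_comm, Real.dist_eq])
      refine ⟨⟨e'.piecewiseLe e d (he' ⟨hd.1, le_rfl⟩) hde, subset_ite.2 ⟨?_, ?_⟩⟩, hcI⟩
      · exact fun x hx => he' ⟨hx.1.1, hx.2⟩
      · intro x hx
        have hx2 : d < x := not_le.1 hx.2
        refine hball ?_
        rw [Metric.mem_ball, Real.dist_eq, abs_lt]
        have := (abs_lt.1 hdc).2
        constructor <;> linarith [hx.1.2]
    have := hclosed.Icc_subset_of_forall_exists_gt (by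
      obtain ⟨e, he⟩ := h a
      exact ⟨e, by simpa using he⟩) (by
      rintro x ⟨⟨e, he⟩, hx⟩ y hxy
      obtain ⟨δ, hδ, hball⟩ := Metric.isOpen_iff.1 e.open_baseSet x (he ⟨hx.1, le_rfl⟩)
      refine ⟨min y (x + δ / 2), ⟨e, fun z hz => ?_⟩, ?_, min_le_left _ _⟩
      · rcases le_or_gt z x with hzx | hzx
        · exact he ⟨hz.1, hzx⟩
        · refine hball ?_
          rw [Metric.mem_ball, Real.dist_eq, abs_lt]
          have := hz.2.trans (min_le_right _ _)
          constructor <;> linarith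
      · exact lt_min hxy (by linarith))
    exact this
  exact key b ⟨hab, le_rfl⟩

theorem exists_int_recursion {Γ : Type*} [Group Γ] (τ : ℤ → Γ) :
    ∃ φ : ℤ → Γ, ∀ n, φ (n + 1) = φ n * τ n := by
  let f : ℕ → Γ := fun n => Nat.rec 1 (fun k x => x * τ k) n
  let g : ℕ → Γ := fun n => Nat.rec 1 (fun k x => x * (τ (-(k + 1 : ℤ)))⁻¹) n
  have hf : ∀ n, f (n + 1) = f n * τ n := fun n => rfl
  have hg : ∀ n, g (n + 1) = g n * (τ (-(n + 1 : ℤ)))⁻¹ := fun n => rfl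
  refine ⟨fun n => if 0 ≤ n then f n.toNat else g (-n).toNat, fun n => ?_⟩
  beta_reduce
  rcases lt_trichotomy n (-1) with hn | rfl | hn
  · rw [if_neg (by omega), if_neg (by omega)]
    obtain ⟨m, hm⟩ : ∃ m : ℕ, n = -(m + 1 : ℤ) := ⟨(-n - 1).toNat, by omega⟩
    rw [show (-n).toNat = m + 1 by omega, show (-(n + 1)).toNat = m by omega, hg, ← hm]
    group
  · have h1 : g 1 = (τ (-1))⁻¹ := by
      have := hg 0
      have h0 : g 0 = 1 := rfl
      simpa [h0] using this
    have h0 : f 0 = 1 := rfl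
    simp [h0, h1]
  · rw [if_pos (by omega), if_pos (by omega), show (n + 1).toNat = n.toNat + 1 by omega, hf,
      Int.toNat_of_nonneg (by omega)]

theorem continuous_of_forall_int_continuousOn {X Y : Type*} [TopologicalSpace X]
    [TopologicalSpace Y] {π : X → ℝ} (hπ : Continuous π) {f : X → Y}
    (h : ∀ n : ℤ, ContinuousOn f (π ⁻¹' Icc n (n + 1))) : Continuous f := by
  have hlf : LocallyFinite fun n : ℤ => Icc (n : ℝ) (n + 1) := by
    intro x
    refine ⟨Ioo (x - 1) (x + 1), Ioo_mem_nhds (by linarith) (by linarith),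
      (finite_Icc (⌊x⌋ - 3) (⌊x⌋ + 3)).subset ?_⟩
    rintro n ⟨z, hz, hz'⟩
    have h1 := Int.floor_le x
    have h2 := Int.lt_floor_add_one x
    constructor
    · have : (⌊x⌋ : ℝ) - 3 ≤ n := by linarith [hz.2, hz'.1]
      exact_mod_cast this
    · have : (n : ℝ) ≤ ⌊x⌋ + 3 := by linarith [hz.1, hz'.2]
      exact_mod_cast this
  refine (hlf.preimage_continuous hπ).continuous ?_ (fun n => isClosed_Icc.preimage hπ) h
  refine eq_univ_of_forall fun p => mem_iUnion.2 ⟨⌊π p⌋, Int.floor_le _, (Int.lt_floor_add_one _).le⟩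

/-- A locally trivial fibration over the line is trivial: trivializations over the
intervals `[n, n + 1]` become compatible after a recursive change of the coordinate of
the fibre. -/
theorem exists_homeomorph_of_locallyTrivial {P F : Type*} [TopologicalSpace P]
    [TopologicalSpace F] {π : P → ℝ} (h : ∀ b : ℝ, ∃ e : Bundle.Trivialization F π, b ∈ e.baseSet) :
    ∃ T : P ≃ₜ ℝ × F, ∀ p, (T p).1 = π p := by
  have hπ : Continuous π := continuous_iff_continuousAt.2 fun p => by
    obtain ⟨e, he⟩ := h (π p)
    exact e.continuousAt_proj (e.mem_source.2 he)
  choose e he using fun n : ℤ => exists_trivialization_Icc_subset_of_locally h n (n + 1)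
  have h0 : ∀ n : ℤ, (n : ℝ) ∈ (e n).baseSet := fun n => he n ⟨le_rfl, by linarith⟩
  have h1 : ∀ n : ℤ, ((n : ℝ) + 1) ∈ (e n).baseSet := fun n => he n ⟨by linarith, le_rfl⟩
  have h2 : ∀ n : ℤ, ((n : ℝ) + 1) ∈ (e (n + 1)).baseSet := fun n => by
    have := h0 (n + 1)
    push_cast at this
    exact this
  obtain ⟨φ, hφ⟩ := exists_int_recursion
    (fun n : ℤ => ((e (n + 1)).coordChangeHomeomorph (e n) (h2 n) (h1 n) : F ≃ₜ F))
  -- the coordinate of the fibre on the strip over `[n, n + 1]`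
  let c : ℤ → P → F := fun n p => φ n (e n p).2
  let d : ℤ → ℝ × F → P := fun n z => (e n).invFun (z.1, (φ n).symm z.2)
  have hcc : ∀ n : ℤ, ∀ p, π p = n + 1 → c n p = c (n + 1) p := fun n p hp => by
    simp only [c, hφ]
    change _ = φ n ((e (n + 1)).coordChange (e n) (n + 1) (e (n + 1) p).2)
    rw [← hp, (e (n + 1)).coordChange_apply_snd (e n) (by rw [hp]; exact h2 n)]
  have hcd : ∀ n : ℤ, ∀ z : ℝ × F, z.1 ∈ Icc (n : ℝ) (n + 1) →
      π (d n z) = z.1 ∧ c n (d n z) = z.2 := fun n z hz => by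
    have hm : (z.1, (φ n).symm z.2) ∈ (e n).target := (e n).mem_target.2 (he n hz)
    refine ⟨(e n).proj_symm_apply hm, ?_⟩
    change φ n (e n ((e n).toOpenPartialHomeomorph.symm (z.1, (φ n).symm z.2))).2 = z.2
    rw [(e n).apply_symm_apply hm]
    simp
  have hdc : ∀ n : ℤ, ∀ p, π p ∈ Icc (n : ℝ) (n + 1) → d n (π p, c n p) = p := fun n p hp => by
    simp only [c, d, Homeomorph.symm_apply_apply]
    have hs : p ∈ (e n).source := (e n).mem_source.2 (he n hp)
    rw [← (e n).coe_fst hs]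
    exact (e n).left_inv hs
  have hfl : ∀ x : ℝ, x ∈ Icc (⌊x⌋ : ℝ) (⌊x⌋ + 1) := fun x =>
    ⟨Int.floor_le x, (Int.lt_floor_add_one x).le⟩
  have hcf : ∀ n : ℤ, ∀ p, π p ∈ Icc (n : ℝ) (n + 1) → c ⌊π p⌋ p = c n p := fun n p hp => by
    rcases hp.2.eq_or_lt with heq | hlt
    · have : ⌊π p⌋ = n + 1 := by
        rw [heq]
        exact_mod_cast Int.floor_intCast (n + 1)
      rw [this, hcc n p heq]
    · rw [Int.floor_eq_iff.2 ⟨hp.1, hlt⟩]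
  have hdf : ∀ n : ℤ, ∀ z : ℝ × F, z.1 ∈ Icc (n : ℝ) (n + 1) → d ⌊z.1⌋ z = d n z := fun n z hz => by
    obtain ⟨h3, h4⟩ := hcd n z hz
    have h5 := hcf n (d n z) (by rwa [h3])
    have h6 := hdc ⌊π (d n z)⌋ (d n z) (hfl _)
    rw [h5, h4, h3] at h6
    exact h6
  refine ⟨⟨⟨fun p => (π p, c ⌊π p⌋ p), fun z => d ⌊z.1⌋ z, fun p => hdc _ p (hfl _), fun z => ?_⟩,
    ?_, ?_⟩, fun p => rfl⟩
  · obtain ⟨h3, h4⟩ := hcd ⌊z.1⌋ z (hfl _)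
    exact Prod.ext h3 (by simp only [h3, h4])
  · refine hπ.prodMk (continuous_of_forall_int_continuousOn hπ fun n => ?_)
    refine ContinuousOn.congr ?_ fun p hp => hcf n p hp
    refine (φ n).continuous.comp_continuousOn (continuous_snd.comp_continuousOn ?_)
    have hs : ContinuousOn (e n) (e n).source := (e n).continuousOn_toFun
    exact hs.mono fun p hp => (e n).mem_source.2 (he n hp)
  · refine continuous_of_forall_int_continuousOn continuous_fst fun n => ?_
    refine ContinuousOn.congr ?_ fun z hz => hdf n z hz
    refine ContinuousOn.comp (t := (e n).target) (e n).continuousOn_invFun (by fun_prop) ?_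
    exact fun z hz => (e n).mem_target.2 (he n hz)

/-- A vertical plane is isomorphic to the canonical one. -/
theorem IsVerticalPlane.exists_homeomorph {P : Type*} [TopologicalSpace P] {π : P → ℝ}
    {o : Set (P ≃ₜ ℝ × ℝ)} (hP : IsVerticalPlane π o) :
    ∃ T : P ≃ₜ ℝ × ℝ, (∀ p, (T p).1 = π p) ∧
      ∃ c ∈ o, ∀ q, OrientationPreservingAt (fun z => T (c.symm z)) q := by
  obtain ⟨c, rfl⟩ := hP.orientation
  have hc : c ∈ orientationClass c := fun q => by
    simpa using orientationPreservingAt_id q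
  obtain ⟨T, hT⟩ := exists_homeomorph_of_locallyTrivial hP.locallyTrivial
  rcases orientationPreservingAt_or_reflection (c.symm.trans T) with h | h
  · exact ⟨T, hT, c, hc, h⟩
  · exact ⟨T.trans verticalReflection, hT, c, hc, h⟩

/-! ### Regular sublevel sets -/

/-- If the differential of `f` and the linear form `l` have no common kernel, then `(-f, l)` is a local
chart of the plane. -/
theorem ContDiff.exists_straightening {f : ℝ × ℝ → ℝ} (hf : ContDiff ℝ (⊤ : ℕ∞) f) (p : ℝ × ℝ)
    (l : ℝ × ℝ →L[ℝ] ℝ) (h : ∀ v, fderiv ℝ f p v = 0 → l v = 0 → v = 0) :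
    ∃ Ψ : OpenPartialHomeomorph (ℝ × ℝ) (ℝ × ℝ), p ∈ Ψ.source ∧ ∀ q, Ψ q = (-f q, l q) := by
  have hs : HasStrictFDerivAt f (fderiv ℝ f p) p :=
    hf.contDiffAt.hasStrictFDerivAt (by simp)
  have hs2 : HasStrictFDerivAt (fun q => (-f q, l q)) ((-fderiv ℝ f p).prod l) p :=
    hs.neg.prodMk l.hasStrictFDerivAt
  let e : (ℝ × ℝ) ≃L[ℝ] ℝ × ℝ := (LinearEquiv.ofInjectiveEndo
    (((-fderiv ℝ f p).prod l : ℝ × ℝ →L[ℝ] ℝ × ℝ) : ℝ × ℝ →ₗ[ℝ] ℝ × ℝ) (by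
      rw [injective_iff_map_eq_zero]
      intro v hv
      have h1 := congrArg Prod.fst hv
      have h2 := congrArg Prod.snd hv
      exact h v (neg_eq_zero.1 h1) h2)).toContinuousLinearEquiv
  have he : (e : ℝ × ℝ →L[ℝ] ℝ × ℝ) = (-fderiv ℝ f p).prod l := by
    ext <;> rfl
  rw [← he] at hs2
  exact ⟨hs2.toOpenPartialHomeomorph _, hs2.mem_toOpenPartialHomeomorph_source, fun q => rfl⟩

theorem fderiv_apply_pair (f : ℝ × ℝ → ℝ) (p v : ℝ × ℝ) :
    fderiv ℝ f p v = v.1 * fderiv ℝ f p (1, 0) + v.2 * fderiv ℝ f p (0, 1) := by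
  conv_lhs => rw [show v = v.1 • ((1, 0) : ℝ × ℝ) + v.2 • ((0, 1) : ℝ × ℝ) by
    ext <;> simp]
  rw [map_add, map_smul, map_smul, smul_eq_mul, smul_eq_mul]

/-- Where the vertical derivative does not vanish, the projection embeds the zero set. -/
theorem ContDiff.exists_isEmbedding_zeroSet {f : ℝ × ℝ → ℝ} (hf : ContDiff ℝ (⊤ : ℕ∞) f)
    {p : ℝ × ℝ} (hp : fderiv ℝ f p (0, 1) ≠ 0) :
    ∃ U : Set (ℝ × ℝ), IsOpen U ∧ p ∈ U ∧
      IsEmbedding ((U ∩ {p | f p = 0}).domRestrict (Prod.fst : ℝ × ℝ → ℝ)) := by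
  obtain ⟨Ψ, hpΨ, hΨ⟩ := hf.exists_straightening p (ContinuousLinearMap.fst ℝ ℝ ℝ) (by
    intro v h1 h2
    have h2 : v.1 = 0 := h2
    rw [fderiv_apply_pair, h2, zero_mul, zero_add] at h1
    exact Prod.ext h2 ((mul_eq_zero.1 h1).resolve_right hp))
  refine ⟨Ψ.source, Ψ.open_source, hpΨ, ?_⟩
  have h1 : IsEmbedding ((Ψ.source ∩ {p | f p = 0}).domRestrict Ψ) := by
    have := Ψ.toHomeomorphSourceTarget.isEmbedding
    have h2 := (IsEmbedding.subtypeVal.comp this).comp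
      (IsEmbedding.inclusion (inter_subset_left : Ψ.source ∩ {p | f p = 0} ⊆ Ψ.source))
    exact h2
  refine IsEmbedding.of_comp (g := fun x : ℝ => ((0 : ℝ), x)) (by fun_prop) (by fun_prop) ?_
  convert! h1 using 1
  ext q
  · simp [hΨ, show f q = 0 from q.2.2]
  · simp [hΨ]

/-- A partial homeomorphism of the plane that maps `D` to the right half plane restricts to a chart
of `D` with values in the half plane. -/
noncomputable def halfSpaceChart (D : Set (ℝ × ℝ)) (p₀ : D)
    (Ψ : OpenPartialHomeomorph (ℝ × ℝ) (ℝ × ℝ)) (h : ∀ q ∈ Ψ.source, q ∈ D ↔ 0 ≤ (Ψ q).1) :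
    OpenPartialHomeomorph D (EuclideanHalfSpace 2) := by
  classical
  exact
  { toFun := fun p => ⟨WithLp.toLp 2 ![max (Ψ p).1 0, (Ψ p).2], by simp⟩
    invFun := fun u => if hu : Ψ.symm (u.1 0, u.1 1) ∈ D then ⟨_, hu⟩ else p₀
    source := {p | (p : ℝ × ℝ) ∈ Ψ.source}
    target := {u | (u.1 0, u.1 1) ∈ Ψ.target}
    map_source' := fun p hp => by
      have h1 : 0 ≤ (Ψ p).1 := (h p hp).1 p.2
      simpa [h1] using Ψ.map_source hp
    map_target' := fun u hu => by
      have h1 : Ψ.symm (u.1 0, u.1 1) ∈ Ψ.source := Ψ.map_target hu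
      have h2 : Ψ.symm (u.1 0, u.1 1) ∈ D := (h _ h1).2 (by
        rw [Ψ.right_inv hu]
        exact u.2)
      rw [mem_ofPred_eq, dif_pos h2]
      exact h1
    left_inv' := fun p hp => by
      have h1 : 0 ≤ (Ψ p).1 := (h p hp).1 p.2
      have h2 : Ψ.symm (max (Ψ p).1 0, (Ψ p).2) = p := by
        rw [max_eq_left h1]
        exact Ψ.left_inv hp
      have h3 : Ψ.symm (max (Ψ p).1 0, (Ψ p).2) ∈ D := by
        rw [h2]
        exact p.2
      refine Subtype.ext ?_
      simp [h2]
    right_inv' := fun u hu => by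
      have h1 : Ψ.symm (u.1 0, u.1 1) ∈ Ψ.source := Ψ.map_target hu
      have h2 : Ψ.symm (u.1 0, u.1 1) ∈ D := (h _ h1).2 (by
        rw [Ψ.right_inv hu]
        exact u.2)
      apply EuclideanHalfSpace.ext
      simp only [dif_pos h2]
      rw [Ψ.right_inv hu]
      ext i
      fin_cases i
      · exact max_eq_left u.2
      · rfl
    open_source := Ψ.open_source.preimage continuous_subtype_val
    open_target := Ψ.open_target.preimage
      (f := fun u : EuclideanHalfSpace 2 => (u.1 0, u.1 1)) (by
        have h1 : Continuous fun u : EuclideanHalfSpace 2 => u.1 := continuous_subtype_val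
        fun_prop)
    continuousOn_toFun := by
      have h1 : ContinuousOn (fun p : D => Ψ p) {p | (p : ℝ × ℝ) ∈ Ψ.source} :=
        Ψ.continuousOn.comp continuous_subtype_val.continuousOn fun p hp => hp
      refine IsInducing.subtypeVal.continuousOn_iff.2 ?_
      refine (PiLp.continuous_toLp 2 _).comp_continuousOn (continuousOn_pi.2 fun i => ?_)
      fin_cases i
      · exact h1.fst.sup continuousOn_const
      · exact h1.snd
    continuousOn_invFun := by
      have h0 : Continuous fun u : EuclideanHalfSpace 2 => u.1 := continuous_subtype_val
      have h1 : ContinuousOn (fun u : EuclideanHalfSpace 2 => Ψ.symm (u.1 0, u.1 1))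
          {u | (u.1 0, u.1 1) ∈ Ψ.target} :=
        Ψ.continuousOn_invFun.comp (by fun_prop) fun p hp => hp
      refine IsInducing.subtypeVal.continuousOn_iff.2 (h1.congr fun u hu => ?_)
      have h1 : Ψ.symm (u.1 0, u.1 1) ∈ Ψ.source := Ψ.map_target hu
      have h2 : Ψ.symm (u.1 0, u.1 1) ∈ D := (h _ h1).2 (by
        rw [Ψ.right_inv hu]
        exact u.2)
      simp [h2] }

theorem halfSpaceChart_apply_zero {D : Set (ℝ × ℝ)} {p₀ : D}
    {Ψ : OpenPartialHomeomorph (ℝ × ℝ) (ℝ × ℝ)} {h : ∀ q ∈ Ψ.source, q ∈ D ↔ 0 ≤ (Ψ q).1} (p : D) :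
    (halfSpaceChart D p₀ Ψ h p).1 0 = max (Ψ p).1 0 := rfl

/-- A regular sublevel set of a smooth function is a surface, whose boundary is the level set. -/
theorem ContDiff.isSurfaceWithBoundary {f : ℝ × ℝ → ℝ} (hf : ContDiff ℝ (⊤ : ℕ∞) f)
    (hreg : ∀ p, f p = 0 → fderiv ℝ f p ≠ 0) :
    IsSurfaceWithBoundary {p | f p ≤ 0} {p | f p = 0} := by
  have key : ∀ p : {p | f p ≤ 0}, ∃ Ψ : OpenPartialHomeomorph (ℝ × ℝ) (ℝ × ℝ),
      (p : ℝ × ℝ) ∈ Ψ.source ∧ (∀ q ∈ Ψ.source, q ∈ {p | f p ≤ 0} ↔ 0 ≤ (Ψ q).1) ∧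
      (f p = 0 ↔ (Ψ p).1 ≤ 0) := by
    rintro ⟨p, hp⟩
    rcases (show f p ≤ 0 from hp).eq_or_lt with h0 | h0
    · obtain ⟨Ψ, hpΨ, hΨ⟩ : ∃ (Ψ : OpenPartialHomeomorph (ℝ × ℝ) (ℝ × ℝ)), p ∈ Ψ.source ∧
          ∀ q, (Ψ q).1 = -f q := by
        by_cases hy : fderiv ℝ f p (0, 1) = 0
        · have hx : fderiv ℝ f p (1, 0) ≠ 0 := fun hx =>
            hreg p h0 (ContinuousLinearMap.ext fun v => by rw [fderiv_apply_pair, hx, hy]; simp)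
          obtain ⟨Ψ, h1, h2⟩ := hf.exists_straightening p (ContinuousLinearMap.snd ℝ ℝ ℝ) (by
            intro v h1 h2
            have h2 : v.2 = 0 := h2
            rw [fderiv_apply_pair, h2, zero_mul, add_zero] at h1
            exact Prod.ext ((mul_eq_zero.1 h1).resolve_right hx) h2)
          exact ⟨Ψ, h1, fun q => by rw [h2]⟩
        · obtain ⟨Ψ, h1, h2⟩ := hf.exists_straightening p (ContinuousLinearMap.fst ℝ ℝ ℝ) (by
            intro v h1 h2
            have h2 : v.1 = 0 := h2
            rw [fderiv_apply_pair, h2, zero_mul, zero_add] at h1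
            exact Prod.ext h2 ((mul_eq_zero.1 h1).resolve_right hy))
          exact ⟨Ψ, h1, fun q => by rw [h2]⟩
      refine ⟨Ψ, hpΨ, fun q hq => ?_, ?_⟩
      · rw [hΨ, mem_ofPred_eq, neg_nonneg]
      · simp [hΨ, h0]
    · -- near an interior point a translation to the right half plane is a chart
      let e := (Homeomorph.addRight ((1 - p.1, 0) : ℝ × ℝ)).toOpenPartialHomeomorph
      have ho : IsOpen {q : ℝ × ℝ | f q < 0 ∧ p.1 - 1 < q.1} :=
        (isOpen_lt hf.continuous continuous_const).inter (isOpen_lt continuous_const continuous_fst)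
      have hval : ∀ q, (e.restrOpen _ ho q).1 = q.1 + (1 - p.1) := fun q => rfl
      refine ⟨e.restrOpen _ ho, ?_, fun q hq => ?_, ?_⟩
      · simp [e, h0]
      · have hq' : f q < 0 ∧ p.1 - 1 < q.1 := by simpa [e] using hq
        rw [hval]
        exact iff_of_true hq'.1.le (by linarith [hq'.2])
      · rw [hval]
        exact iff_of_false h0.ne (by norm_num)
  choose Ψ hp hD h0 using key
  let cs : ChartedSpace (EuclideanHalfSpace 2) {p | f p ≤ 0} :=
    { atlas := range fun p => halfSpaceChart {p | f p ≤ 0} p (Ψ p) (hD p)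
      chartAt := fun p => halfSpaceChart {p | f p ≤ 0} p (Ψ p) (hD p)
      mem_chart_source := fun p => hp p
      chart_mem_atlas := fun p => mem_range_self p }
  refine ⟨cs, ?_⟩
  have hb : ∀ p : {p | f p ≤ 0}, (𝓡∂ 2).IsBoundaryPoint p ↔ f p = 0 := by
    intro p
    rw [ModelWithCorners.isBoundaryPoint_iff, frontier_range_modelWithCornersEuclideanHalfSpace]
    change 0 = (halfSpaceChart {p | f p ≤ 0} p (Ψ p) (hD p) p).1 0 ↔ _
    rw [halfSpaceChart_apply_zero, h0 p]
    constructor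
    · exact fun h => (le_max_left _ _).trans h.symm.le
    · exact fun h => (max_eq_right h).symm
  ext p
  constructor
  · rintro ⟨q, hq, rfl⟩
    exact (hb q).1 hq
  · intro h
    exact ⟨⟨p, le_of_eq h⟩, (hb _).2 h, rfl⟩

/-! ### Plane diagrams of transversal graphs -/

/-- A family of arcs in the plane, each of them the graph of a continuous function
`y e` over `[s e, t e]`; the interiors of distinct arcs are disjoint. The values of `y e` outside
`[s e, t e]` have no meaning. -/
structure ArcSystem (ι : Type*) where
  s : ι → ℝ
  t : ι → ℝ
  y : ι → ℝ → ℝ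
  s_lt_t : ∀ e, s e < t e
  continuous_y : ∀ e, Continuous (y e)
  y_ne : ∀ e e', e ≠ e' → ∀ x, s e < x → x < t e → s e' < x → x < t e' → y e x ≠ y e' x

namespace ArcSystem

variable {ι : Type*} (G : ArcSystem ι)

/-- The arc `e` starts at the abscissa `v` in the direction `σ`: to the right if `σ = 1`, to the left
if `σ = -1`. -/
def Emanates (v σ : ℝ) (e : ι) : Prop := (σ = 1 ∧ G.s e = v) ∨ (σ = -1 ∧ G.t e = v)

/-- The arc `e` is below the arc `e'` over some point interior to both of them. -/
def Below (e e' : ι) : Prop :=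
  ∃ x, G.s e < x ∧ x < G.t e ∧ G.s e' < x ∧ x < G.t e' ∧ G.y e x < G.y e' x

/-- The only arc with an end of abscissa `v` is `e`, and it emanates in the direction `σ`. -/
def IsEnd (v σ : ℝ) (e : ι) : Prop :=
  (∀ e', G.Emanates v σ e' ↔ e' = e) ∧ ∀ e', ¬ G.Emanates v (-σ) e'

/-- The arcs with an end of abscissa `v` are the stem `e₀`, in the direction `-σ`, and the branches
`e₁` and `e₂` in the direction `σ`, with `e₁` below `e₂`. -/
def IsFork (v σ : ℝ) (e₀ e₁ e₂ : ι) : Prop :=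
  (∀ e', G.Emanates v (-σ) e' ↔ e' = e₀) ∧ (∀ e', G.Emanates v σ e' ↔ e' = e₁ ∨ e' = e₂) ∧
    G.Below e₁ e₂

variable {G}

theorem Below.ne {e e' : ι} (h : G.Below e e') : e ≠ e' := by
  rintro rfl
  obtain ⟨x, -, -, -, -, hx⟩ := h
  exact lt_irrefl _ hx

theorem Below.lt {e e' : ι} (h : G.Below e e') {x : ℝ} (h1 : G.s e < x) (h2 : x < G.t e)
    (h3 : G.s e' < x) (h4 : x < G.t e') : G.y e x < G.y e' x := by
  have hne := h.ne
  obtain ⟨z, k1, k2, k3, k4, hz⟩ := h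
  by_contra hx
  obtain ⟨w, hw, hw0⟩ := (isPreconnected_Ioo (a := max (G.s e) (G.s e'))
    (b := min (G.t e) (G.t e'))).intermediate_value (a := z) (b := x)
    ⟨max_lt k1 k3, lt_min k2 k4⟩ ⟨max_lt h1 h3, lt_min h2 h4⟩
    (f := fun x => G.y e x - G.y e' x)
    ((G.continuous_y e).sub (G.continuous_y e')).continuousOn
    (show (0 : ℝ) ∈ Icc _ _ from ⟨by linarith, by linarith⟩)
  exact G.y_ne e e' hne w ((le_max_left _ _).trans_lt hw.1) (hw.2.trans_le (min_le_left _ _))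
    ((le_max_right _ _).trans_lt hw.1) (hw.2.trans_le (min_le_right _ _)) (sub_eq_zero.1 hw0)

theorem below_or_below {e e' : ι} (hne : e ≠ e') {x : ℝ} (h1 : G.s e < x) (h2 : x < G.t e)
    (h3 : G.s e' < x) (h4 : x < G.t e') : G.Below e e' ∨ G.Below e' e := by
  rcases lt_or_gt_of_ne (G.y_ne e e' hne x h1 h2 h3 h4) with h | h
  · exact Or.inl ⟨x, h1, h2, h3, h4, h⟩
  · exact Or.inr ⟨x, h3, h4, h1, h2, h⟩

theorem below_of_frequently {e e' : ι} {v : ℝ} (hlt : G.y e v < G.y e' v)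
    (h : ∃ᶠ x in 𝓝 v, G.s e < x ∧ x < G.t e ∧ G.s e' < x ∧ x < G.t e') : G.Below e e' := by
  obtain ⟨x, ⟨h1, h2, h3, h4⟩, h5⟩ := (h.and_eventually
    ((G.continuous_y e).continuousAt.eventually_lt (G.continuous_y e').continuousAt hlt)).exists
  exact ⟨x, h1, h2, h3, h4, h5⟩

theorem Emanates.eventually {e : ι} {v σ : ℝ} (h : G.Emanates v σ e) :
    ∀ᶠ r in 𝓝[>] (0 : ℝ), G.s e < v + σ * r ∧ v + σ * r < G.t e := by
  have hst := G.s_lt_t e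
  rcases h with ⟨rfl, rfl⟩ | ⟨rfl, rfl⟩
  · filter_upwards [Ioo_mem_nhdsGT (sub_pos.2 hst)] with r hr
    constructor <;> linarith [hr.1, hr.2]
  · filter_upwards [Ioo_mem_nhdsGT (sub_pos.2 hst)] with r hr
    constructor <;> linarith [hr.1, hr.2]

theorem Emanates.sign {e : ι} {v σ : ℝ} (h : G.Emanates v σ e) : σ = 1 ∨ σ = -1 :=
  h.imp And.left And.left

theorem Emanates.frequently {e e' : ι} {v σ : ℝ} (h : G.Emanates v σ e)
    (h' : G.s e' < v ∧ v < G.t e') :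
    ∃ᶠ x in 𝓝 v, G.s e < x ∧ x < G.t e ∧ G.s e' < x ∧ x < G.t e' := by
  have ht : Tendsto (fun r : ℝ => v + σ * r) (𝓝[>] 0) (𝓝 v) := by
    have : Continuous fun r : ℝ => v + σ * r := by fun_prop
    simpa using (this.tendsto 0).mono_left nhdsWithin_le_nhds
  refine ht.frequently (Eventually.frequently ?_)
  filter_upwards [h.eventually, ht.eventually (Ioo_mem_nhds h'.1 h'.2)] with r hr hr'
  exact ⟨hr.1, hr.2, hr'.1, hr'.2⟩

end ArcSystem

/-- A finite system of arcs whose ends are the points `(v, Y v)`, `v ∈ X`, and whose local structure at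
these points is that of a generic transversal graph with two-sided vertices of valency three. -/
structure GraphDiagram (ι : Type*) extends ArcSystem ι where
  X : Finset ℝ
  Y : ℝ → ℝ
  s_mem : ∀ e, s e ∈ X
  t_mem : ∀ e, t e ∈ X
  y_s : ∀ e, y e (s e) = Y (s e)
  y_t : ∀ e, y e (t e) = Y (t e)
  y_ne_Y : ∀ e, ∀ v ∈ X, s e < v → v < t e → y e v ≠ Y v
  nonempty : X.Nonempty
  vertex : ∀ v ∈ X, ∃ σ : ℝ, (σ = 1 ∨ σ = -1) ∧
    ((∃ e, toArcSystem.IsEnd v σ e) ∨ ∃ e₀ e₁ e₂, toArcSystem.IsFork v σ e₀ e₁ e₂)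

namespace GraphDiagram

open ArcSystem

variable {ι : Type*} {G : GraphDiagram ι}

theorem y_eq_of_emanates {e : ι} {v σ : ℝ} (h : G.Emanates v σ e) : G.y e v = G.Y v := by
  rcases h with ⟨-, rfl⟩ | ⟨-, rfl⟩
  · exact G.y_s e
  · exact G.y_t e

theorem below_of_emanates {e e' : ι} {v σ : ℝ} (h : G.Emanates v σ e)
    (h' : G.s e' < v ∧ v < G.t e') (hlt : G.y e' v < G.Y v) : G.Below e' e :=
  below_of_frequently (by rwa [y_eq_of_emanates h])
    ((h.frequently h').mono fun _ hx => ⟨hx.2.2.1, hx.2.2.2, hx.1, hx.2.1⟩)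

theorem below_of_emanates' {e e' : ι} {v σ : ℝ} (h : G.Emanates v σ e)
    (h' : G.s e' < v ∧ v < G.t e') (hlt : G.Y v < G.y e' v) : G.Below e e' :=
  below_of_frequently (by rwa [y_eq_of_emanates h]) (h.frequently h')

/-- If an arc that passes over `v` is below an arc that starts at `v`, it passes below the vertex. -/
theorem y_lt_Y_of_below {e e' : ι} {v σ : ℝ} (hv : v ∈ G.X) (h : G.Emanates v σ e)
    (h' : G.s e' < v ∧ v < G.t e') (hb : G.Below e' e) : G.y e' v < G.Y v := by
  rcases lt_or_gt_of_ne (G.y_ne_Y e' v hv h'.1 h'.2) with h1 | h1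
  · exact h1
  · obtain ⟨x, k1, k2, k3, k4, k5⟩ := below_of_emanates' h h' h1
    exact absurd (hb.lt k3 k4 k1 k2) k5.not_gt

theorem Y_lt_y_of_below {e e' : ι} {v σ : ℝ} (hv : v ∈ G.X) (h : G.Emanates v σ e)
    (h' : G.s e' < v ∧ v < G.t e') (hb : G.Below e e') : G.Y v < G.y e' v := by
  rcases lt_or_gt_of_ne (G.y_ne_Y e' v hv h'.1 h'.2) with h1 | h1
  · obtain ⟨x, k1, k2, k3, k4, k5⟩ := below_of_emanates h h' h1
    exact absurd (hb.lt k3 k4 k1 k2) k5.not_gt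
  · exact h1

/-! ### Levels of the edges -/

/-- A choice of an interval `[A e, B e]` for each arc `e` among those that start to the left of `τ`,
which respects the vertical order of the arcs and is such that the intervals of the
branches of a fork share an end with the interval of the stem. -/
structure IsLevelling (G : GraphDiagram ι) (τ : ℝ) (A B : ι → ℝ) : Prop where
  lt : ∀ e, A e < B e
  lt_of_below : ∀ e e', G.s e < τ → G.s e' < τ → G.Below e e' → B e < A e'
  fork : ∀ v σ e₀ e₁ e₂, v < τ → G.IsFork v σ e₀ e₁ e₂ → A e₁ = A e₀ ∧ B e₂ = B e₀

/-- To extend a choice of intervals past the vertex of abscissa `v`, it suffices to place the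
intervals of the new arcs correctly with respect to those of the arcs that pass over `v`. -/
theorem IsLevelling.extend {v τ : ℝ} {A B A' B' : ι → ℝ} (h : G.IsLevelling v A B)
    (hv : v ∈ G.X) (hτ : ∀ w ∈ G.X, w < τ → w ≤ v)
    (hA : ∀ e, G.s e ≠ v → A' e = A e) (hB : ∀ e, G.s e ≠ v → B' e = B e)
    (hlt : ∀ e, G.s e = v → A' e < B' e)
    (hlo : ∀ e e', G.s e = v → G.s e' < v → v < G.t e' → G.y e' v < G.Y v → B e' < A' e)
    (hhi : ∀ e e', G.s e = v → G.s e' < v → v < G.t e' → G.Y v < G.y e' v → B' e < A e')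
    (hnew : ∀ e e', G.s e = v → G.s e' = v → G.Below e e' → B' e < A' e')
    (hfork : ∀ σ e₀ e₁ e₂, G.IsFork v σ e₀ e₁ e₂ → A' e₁ = A' e₀ ∧ B' e₂ = B' e₀) :
    G.IsLevelling τ A' B' := by
  have hs : ∀ e, G.s e < τ → G.s e ≠ v → G.s e < v := fun e he hne =>
    lt_of_le_of_ne (hτ _ (G.s_mem e) he) hne
  refine ⟨fun e => ?_, fun e e' he he' hb => ?_, fun w σ e₀ e₁ e₂ hw hf => ?_⟩
  · by_cases he : G.s e = v
    · exact hlt e he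
    · rw [hA e he, hB e he]
      exact h.lt e
  · by_cases h1 : G.s e = v <;> by_cases h2 : G.s e' = v
    · exact hnew e e' h1 h2 hb
    · rw [hA e' h2]
      have h3 := hs e' he' h2
      have h4 : v < G.t e' := by
        obtain ⟨x, k1, -, -, k4, -⟩ := hb
        rw [h1] at k1
        exact k1.trans k4
      exact hhi e e' h1 h3 h4 (Y_lt_y_of_below hv (Or.inl ⟨rfl, h1⟩) ⟨h3, h4⟩ hb)
    · rw [hB e h1]
      have h3 := hs e he h1
      have h4 : v < G.t e := by
        obtain ⟨x, -, k2, k3, -, -⟩ := hb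
        rw [h2] at k3
        exact k3.trans k2
      exact hlo e' e h2 h3 h4 (y_lt_Y_of_below hv (Or.inl ⟨rfl, h2⟩) ⟨h3, h4⟩ hb)
    · rw [hB e h1, hA e' h2]
      exact h.lt_of_below e e' (hs e he h1) (hs e' he' h2) hb
  · -- the arcs of a fork strictly to the left of `v` all start strictly to the left of `v`
    have hem : ∀ e σ, G.Emanates w σ e → G.s e ≤ w := fun e σ he => by
      rcases he with ⟨-, rfl⟩ | ⟨-, rfl⟩
      · exact le_rfl
      · exact (G.s_lt_t e).le
    have hwX : w ∈ G.X := by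
      have := (hf.1 e₀).2 rfl
      rcases this with ⟨-, rfl⟩ | ⟨-, rfl⟩
      · exact G.s_mem e₀
      · exact G.t_mem e₀
    rcases (hτ w hwX hw).eq_or_lt with rfl | hwv
    · exact hfork σ e₀ e₁ e₂ hf
    · have k0 := ((hem e₀ _ ((hf.1 e₀).2 rfl)).trans_lt hwv).ne
      have k1 := ((hem e₁ _ ((hf.2.1 e₁).2 (Or.inl rfl))).trans_lt hwv).ne
      have k2 := ((hem e₂ _ ((hf.2.1 e₂).2 (Or.inr rfl))).trans_lt hwv).ne
      rw [hA _ k0, hA _ k1, hB _ k0, hB _ k2]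
      exact h.fork w σ e₀ e₁ e₂ hwv hf

end GraphDiagram

namespace ArcSystem

variable {ι : Type*} {G : ArcSystem ι}

theorem Below.asymm {e e' : ι} (h : G.Below e e') : ¬ G.Below e' e := fun h' => by
  have h2 := h'
  obtain ⟨x, k1, k2, k3, k4, k5⟩ := h'
  exact lt_asymm (h.lt k3 k4 k1 k2) k5

theorem emanates_one {v : ℝ} {e : ι} : G.Emanates v 1 e ↔ G.s e = v := by
  simp only [Emanates, true_and, or_iff_left_iff_imp, and_imp]
  intro h
  norm_num at h

theorem emanates_neg_one {v : ℝ} {e : ι} : G.Emanates v (-1) e ↔ G.t e = v := by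
  simp only [Emanates, true_and, or_iff_right_iff_imp, and_imp]
  intro h
  norm_num at h

theorem IsFork.sign {v σ : ℝ} {e₀ e₁ e₂ : ι} (h : G.IsFork v σ e₀ e₁ e₂) : σ = 1 ∨ σ = -1 :=
  ((h.2.1 e₁).2 (Or.inl rfl)).sign

theorem IsEnd.sign {v σ : ℝ} {e : ι} (h : G.IsEnd v σ e) : σ = 1 ∨ σ = -1 :=
  ((h.1 e).2 rfl).sign

theorem eq_or_eq_neg_of_sign {σ σ' : ℝ} (h : σ = 1 ∨ σ = -1) (h' : σ' = 1 ∨ σ' = -1) :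
    σ' = σ ∨ σ' = -σ := by
  rcases h with rfl | rfl <;> rcases h' with rfl | rfl <;> simp

theorem IsEnd.not_isFork {v σ σ' : ℝ} {e e₀ e₁ e₂ : ι} (h : G.IsEnd v σ e) :
    ¬ G.IsFork v σ' e₀ e₁ e₂ := fun h' => by
  rcases eq_or_eq_neg_of_sign h.sign h'.sign with rfl | rfl
  · exact h.2 e₀ ((h'.1 e₀).2 rfl)
  · exact h.2 e₁ ((h'.2.1 e₁).2 (Or.inl rfl))

theorem IsFork.unique {v σ σ' : ℝ} {e₀ e₁ e₂ f₀ f₁ f₂ : ι} (h : G.IsFork v σ e₀ e₁ e₂)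
    (h' : G.IsFork v σ' f₀ f₁ f₂) : σ' = σ ∧ f₀ = e₀ ∧ f₁ = e₁ ∧ f₂ = e₂ := by
  rcases eq_or_eq_neg_of_sign h.sign h'.sign with rfl | rfl
  · refine ⟨rfl, (h.1 f₀).1 ((h'.1 f₀).2 rfl), ?_⟩
    have h1 := (h.2.1 f₁).1 ((h'.2.1 f₁).2 (Or.inl rfl))
    have h2 := (h.2.1 f₂).1 ((h'.2.1 f₂).2 (Or.inr rfl))
    have h3 := h'.2.2
    rcases h1 with rfl | rfl <;> rcases h2 with rfl | rfl
    · exact absurd rfl h3.ne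
    · exact ⟨rfl, rfl⟩
    · exact absurd h3 h.2.2.asymm
    · exact absurd rfl h3.ne
  · have h1 := (h.1 f₁).1 ((h'.2.1 f₁).2 (Or.inl rfl))
    have h2 := (h.1 f₂).1 ((h'.2.1 f₂).2 (Or.inr rfl))
    exact absurd (h1.trans h2.symm) h'.2.2.ne

end ArcSystem

namespace GraphDiagram

open ArcSystem

variable {ι : Type*} {G : GraphDiagram ι}

theorem IsLevelling.exists_extend [Finite ι] {v τ : ℝ} {A B : ι → ℝ} (h : G.IsLevelling v A B)
    (hv : v ∈ G.X) (hτ : ∀ w ∈ G.X, w < τ → w ≤ v) : ∃ A' B', G.IsLevelling τ A' B' := by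
  classical
  obtain ⟨σ, hσ, hvert⟩ := G.vertex v hv
  rcases hvert with ⟨e, he⟩ | ⟨e₀, e₁, e₂, hf⟩
  · rcases hσ with rfl | rfl
    · -- a new arc is born: its interval is placed in a gap
      have hse : ∀ e', G.s e' = v ↔ e' = e := fun e' => emanates_one.symm.trans (he.1 e')
      have hem : G.Emanates v 1 e := (he.1 e).2 rfl
      let lo : Set ℝ := {b | ∃ e', G.s e' < v ∧ v < G.t e' ∧ G.y e' v < G.Y v ∧ b = B e'}
      let hi : Set ℝ := {a | ∃ e', G.s e' < v ∧ v < G.t e' ∧ G.Y v < G.y e' v ∧ a = A e'}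
      have hlof : lo.Finite := (finite_range B).subset (by
        rintro _ ⟨e', -, -, -, rfl⟩
        exact mem_range_self e')
      have hhif : hi.Finite := (finite_range A).subset (by
        rintro _ ⟨e', -, -, -, rfl⟩
        exact mem_range_self e')
      have hlohi : ∀ b ∈ lo, ∀ a ∈ hi, b < a := by
        rintro _ ⟨e', k1, k2, k3, rfl⟩ _ ⟨e'', l1, l2, l3, rfl⟩
        exact h.lt_of_below e' e'' k1 l1 ⟨v, k1, k2, l1, l2, k3.trans l3⟩
      obtain ⟨a, ha1, ha2⟩ := Order.exists_between_finsets hlof.toFinset hhif.toFinset (by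
        simpa only [Finite.mem_toFinset] using hlohi)
      obtain ⟨b, hb1, hb2⟩ := Order.exists_between_finsets {a} hhif.toFinset (by simpa using ha2)
      simp only [Finset.mem_singleton, forall_eq, Finite.mem_toFinset] at ha1 ha2 hb1 hb2
      refine ⟨Function.update A e a, Function.update B e b, h.extend hv hτ ?_ ?_ ?_ ?_ ?_ ?_ ?_⟩
      · intro e' h1
        rw [Function.update_of_ne (mt (hse e').2 h1)]
      · intro e' h1
        rw [Function.update_of_ne (mt (hse e').2 h1)]
      · intro e' h1
        obtain rfl := (hse e').1 h1
        simpa using hb1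
      · intro e' e'' h1 h2 h3 h4
        obtain rfl := (hse e').1 h1
        rw [Function.update_self]
        exact ha1 _ ⟨e'', h2, h3, h4, rfl⟩
      · intro e' e'' h1 h2 h3 h4
        obtain rfl := (hse e').1 h1
        rw [Function.update_self]
        exact hb2 _ ⟨e'', h2, h3, h4, rfl⟩
      · intro e' e'' h1 h2 h3
        exact absurd (((hse e').1 h1).trans ((hse e'').1 h2).symm) h3.ne
      · exact fun _ _ _ _ hf => absurd hf he.not_isFork
    · have hse : ∀ e', G.s e' ≠ v := fun e' h1 => he.2 e' (Or.inl ⟨by simp, h1⟩)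
      exact ⟨A, B, h.extend hv hτ (fun _ _ => rfl) (fun _ _ => rfl)
        (fun e' h1 => absurd h1 (hse e')) (fun e' _ h1 => absurd h1 (hse e'))
        (fun e' _ h1 => absurd h1 (hse e')) (fun e' _ h1 => absurd h1 (hse e'))
        (fun _ _ _ _ hf => absurd hf he.not_isFork)⟩
  · have hne := hf.2.2.ne
    have hem0 : G.Emanates v (-σ) e₀ := (hf.1 e₀).2 rfl
    have hem1 : G.Emanates v σ e₁ := (hf.2.1 e₁).2 (Or.inl rfl)
    have hem2 : G.Emanates v σ e₂ := (hf.2.1 e₂).2 (Or.inr rfl)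
    rcases hσ with rfl | rfl
    · -- the stem splits: the intervals of the branches are inside that of the stem
      have hse : ∀ e', G.s e' = v ↔ e' = e₁ ∨ e' = e₂ := fun e' =>
        emanates_one.symm.trans (hf.2.1 e')
      have h0 : G.s e₀ < v := by
        rw [← emanates_neg_one.1 hem0]
        exact G.s_lt_t e₀
      have h01 : e₀ ≠ e₁ := fun h1 => h0.ne ((hse e₀).2 (Or.inl h1))
      have h02 : e₀ ≠ e₂ := fun h1 => h0.ne ((hse e₀).2 (Or.inr h1))
      have hAB := h.lt e₀
      refine ⟨Function.update (Function.update A e₁ (A e₀)) e₂ ((A e₀ + 2 * B e₀) / 3),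
        Function.update (Function.update B e₁ ((2 * A e₀ + B e₀) / 3)) e₂ (B e₀),
        h.extend hv hτ ?_ ?_ ?_ ?_ ?_ ?_ ?_⟩
      · intro e' h1
        rw [Function.update_of_ne fun h2 => h1 ((hse e').2 (Or.inr h2)),
          Function.update_of_ne fun h2 => h1 ((hse e').2 (Or.inl h2))]
      · intro e' h1
        rw [Function.update_of_ne fun h2 => h1 ((hse e').2 (Or.inr h2)),
          Function.update_of_ne fun h2 => h1 ((hse e').2 (Or.inl h2))]
      · intro e' h1
        rcases (hse e').1 h1 with rfl | rfl
        · rw [Function.update_of_ne hne, Function.update_of_ne hne, Function.update_self,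
            Function.update_self]
          linarith
        · rw [Function.update_self, Function.update_self]
          linarith
      · intro e' e'' h1 h2 h3 h4
        have h5 := h.lt_of_below e'' e₀ h2 h0 (below_of_emanates hem0 ⟨h2, h3⟩ h4)
        rcases (hse e').1 h1 with rfl | rfl
        · rw [Function.update_of_ne hne, Function.update_self]
          exact h5
        · rw [Function.update_self]
          linarith
      · intro e' e'' h1 h2 h3 h4
        have h5 := h.lt_of_below e₀ e'' h0 h2 (below_of_emanates' hem0 ⟨h2, h3⟩ h4)
        rcases (hse e').1 h1 with rfl | rfl
        · rw [Function.update_of_ne hne, Function.update_self]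
          linarith
        · rw [Function.update_self]
          exact h5
      · intro e' e'' h1 h2 h3
        rcases (hse e').1 h1 with rfl | rfl <;> rcases (hse e'').1 h2 with rfl | rfl
        · exact absurd rfl h3.ne
        · rw [Function.update_of_ne hne, Function.update_self, Function.update_self]
          linarith
        · exact absurd h3 hf.2.2.asymm
        · exact absurd rfl h3.ne
      · intro σ' f₀ f₁ f₂ hf'
        obtain ⟨-, rfl, rfl, rfl⟩ := hf.unique hf'
        rw [Function.update_of_ne hne, Function.update_of_ne h02, Function.update_of_ne h01,
          Function.update_of_ne h02, Function.update_of_ne h01, Function.update_self,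
          Function.update_self]
        exact ⟨rfl, rfl⟩
    · -- two arcs merge: the interval of the stem is the hull of those of the branches
      rw [neg_neg] at hem0
      have hse : ∀ e', G.s e' = v ↔ e' = e₀ := fun e' => by
        have := hf.1 e'
        rw [neg_neg] at this
        exact emanates_one.symm.trans this
      have h1' : G.s e₁ < v := by
        rw [← emanates_neg_one.1 hem1]
        exact G.s_lt_t e₁
      have h2' : G.s e₂ < v := by
        rw [← emanates_neg_one.1 hem2]
        exact G.s_lt_t e₂
      have h10 : e₁ ≠ e₀ := fun h1 => h1'.ne ((hse e₁).2 h1)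
      have h20 : e₂ ≠ e₀ := fun h1 => h2'.ne ((hse e₂).2 h1)
      refine ⟨Function.update A e₀ (A e₁), Function.update B e₀ (B e₂),
        h.extend hv hτ ?_ ?_ ?_ ?_ ?_ ?_ ?_⟩
      · intro e' h1
        rw [Function.update_of_ne (mt (hse e').2 h1)]
      · intro e' h1
        rw [Function.update_of_ne (mt (hse e').2 h1)]
      · intro e' h1
        obtain rfl := (hse e').1 h1
        rw [Function.update_self, Function.update_self]
        linarith [h.lt e₁, h.lt e₂, h.lt_of_below e₁ e₂ h1' h2' hf.2.2]
      · intro e' e'' h1 h2 h3 h4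
        obtain rfl := (hse e').1 h1
        rw [Function.update_self]
        exact h.lt_of_below e'' e₁ h2 h1' (below_of_emanates hem1 ⟨h2, h3⟩ h4)
      · intro e' e'' h1 h2 h3 h4
        obtain rfl := (hse e').1 h1
        rw [Function.update_self]
        exact h.lt_of_below e₂ e'' h2' h2 (below_of_emanates' hem2 ⟨h2, h3⟩ h4)
      · intro e' e'' h1 h2 h3
        exact absurd (((hse e').1 h1).trans ((hse e'').1 h2).symm) h3.ne
      · intro σ' f₀ f₁ f₂ hf'
        obtain ⟨-, rfl, rfl, rfl⟩ := hf.unique hf'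
        rw [Function.update_self, Function.update_self, Function.update_of_ne h10,
          Function.update_of_ne h20]
        exact ⟨rfl, rfl⟩

theorem exists_isLevelling_of_card [Finite ι] (G : GraphDiagram ι) (n : ℕ) :
    ∀ τ, (G.X.filter (· < τ)).card = n → ∃ A B, G.IsLevelling τ A B := by
  induction n with
  | zero =>
    intro τ hτ
    have hno : ∀ v ∈ G.X, ¬ v < τ := fun v hv hlt => by
      have : v ∈ G.X.filter (· < τ) := Finset.mem_filter.2 ⟨hv, hlt⟩
      rw [Finset.card_eq_zero.1 hτ] at this
      exact absurd this (Finset.notMem_empty v)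
    refine ⟨fun _ => 0, fun _ => 1, fun _ => zero_lt_one, fun e _ he => ?_, ?_⟩
    · exact absurd he (hno _ (G.s_mem e))
    · intro v σ e₀ e₁ e₂ hv hf
      refine absurd hv (hno v ?_)
      rcases (hf.1 e₀).2 rfl with ⟨-, rfl⟩ | ⟨-, rfl⟩
      · exact G.s_mem e₀
      · exact G.t_mem e₀
  | succ n ih =>
    intro τ hτ
    have hne : (G.X.filter (· < τ)).Nonempty := Finset.card_pos.1 (by omega)
    obtain ⟨v, hv, hmax⟩ := (G.X.filter (· < τ)).exists_maximal hne
    have hmax' : ∀ w ∈ G.X, w < τ → w ≤ v := fun w hw hwτ => by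
      by_contra hvw
      exact hvw (hmax (Finset.mem_filter.2 ⟨hw, hwτ⟩) (not_le.1 hvw).le)
    have hv' := Finset.mem_filter.1 hv
    have herase : G.X.filter (· < v) = (G.X.filter (· < τ)).erase v := by
      ext w
      simp only [Finset.mem_filter, Finset.mem_erase]
      constructor
      · exact fun h => ⟨h.2.ne, h.1, h.2.trans hv'.2⟩
      · exact fun h => ⟨h.2.1, lt_of_le_of_ne (hmax' w h.2.1 h.2.2) h.1⟩
    obtain ⟨A, B, h⟩ := ih v (by rw [herase, Finset.card_erase_of_mem hv, hτ]; rfl)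
    exact h.exists_extend hv'.1 hmax'

/-- There are intervals for all arcs of a finite diagram, constant along the arcs, which respect the
vertical order and match at the forks: sweeping the diagram from left to right, one only has
to choose the intervals of the arcs that start at the current vertex. -/
theorem exists_levels [Finite ι] (G : GraphDiagram ι) : ∃ A B : ι → ℝ, (∀ e, A e < B e) ∧
    (∀ e e', G.Below e e' → B e < A e') ∧
    ∀ v σ e₀ e₁ e₂, G.IsFork v σ e₀ e₁ e₂ → A e₁ = A e₀ ∧ B e₂ = B e₀ := by
  obtain ⟨τ, hτ⟩ := G.X.bddAbove
  obtain ⟨A, B, h⟩ := G.exists_isLevelling_of_card _ (τ + 1) rfl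
  have hlt : ∀ v ∈ G.X, v < τ + 1 := fun v hv => (hτ hv).trans_lt (lt_add_one τ)
  refine ⟨A, B, h.lt, fun e e' => h.lt_of_below e e' (hlt _ (G.s_mem e)) (hlt _ (G.s_mem e')),
    fun v σ e₀ e₁ e₂ hf => h.fork v σ e₀ e₁ e₂ (hlt v ?_) hf⟩
  rcases (hf.1 e₀).2 rfl with ⟨-, rfl⟩ | ⟨-, rfl⟩
  · exact G.s_mem e₀
  · exact G.t_mem e₀

end GraphDiagram

/-! ### Smooth switches -/

theorem hasDerivAt_expNegInvGlue {x : ℝ} (hx : 0 < x) :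
    ∃ a, 0 < a ∧ HasDerivAt expNegInvGlue a x := by
  have h1 : HasDerivAt (fun x : ℝ => Real.exp (-x⁻¹)) (Real.exp (-x⁻¹) * (-(-(x ^ 2)⁻¹))) x :=
    (hasDerivAt_inv hx.ne').neg.exp
  refine ⟨_, ?_, h1.congr_of_eventuallyEq ?_⟩
  · rw [neg_neg]
    positivity
  · filter_upwards [Ioi_mem_nhds hx] with z hz
    simp [expNegInvGlue, not_le.2 (show 0 < z from hz)]

theorem hasDerivAt_smoothTransition {x : ℝ} (hx0 : 0 < x) (hx1 : x < 1) :
    ∃ a, 0 < a ∧ HasDerivAt Real.smoothTransition a x := by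
  obtain ⟨a, ha, h1⟩ := hasDerivAt_expNegInvGlue hx0
  obtain ⟨b, hb, h2⟩ := hasDerivAt_expNegInvGlue (sub_pos.2 hx1)
  have h3 : HasDerivAt (fun z => expNegInvGlue (1 - z)) (b * (0 - 1)) x :=
    HasDerivAt.comp x h2 ((hasDerivAt_const x (1 : ℝ)).sub (hasDerivAt_id x))
  have hp := expNegInvGlue.pos_of_pos hx0
  have hq := expNegInvGlue.pos_of_pos (sub_pos.2 hx1)
  refine ⟨_, ?_, h1.fun_div (h1.fun_add h3) (by positivity)⟩
  refine div_pos ?_ (by positivity)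
  have := mul_pos ha hq
  have := mul_pos hb hp
  nlinarith

theorem strictMonoOn_smoothTransition : StrictMonoOn Real.smoothTransition (Icc 0 1) := by
  refine strictMonoOn_of_deriv_pos (convex_Icc 0 1) Real.smoothTransition.continuous.continuousOn
    fun x hx => ?_
  rw [interior_Icc] at hx
  obtain ⟨a, ha, h⟩ := hasDerivAt_smoothTransition hx.1 hx.2
  rwa [h.deriv]

/-- A smooth function that grows from `0` to `1` in `[-ε, ε]` and takes a given value at `0`,
where its derivative does not vanish. -/
theorem exists_smooth_switch {ε a : ℝ} (hε : 0 < ε) (ha0 : 0 < a) (ha1 : a < 1) :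
    ∃ φ : ℝ → ℝ, ContDiff ℝ (⊤ : ℕ∞) φ ∧ (∀ x, 0 ≤ φ x ∧ φ x ≤ 1) ∧ (∀ x ≤ -ε, φ x = 0) ∧
      (∀ x ≥ ε, φ x = 1) ∧ φ 0 = a ∧ (∀ x < 0, φ x < a) ∧ (∀ x > 0, a < φ x) ∧
      deriv φ 0 ≠ 0 := by
  obtain ⟨u, hu, hua⟩ := intermediate_value_Icc zero_le_one
    Real.smoothTransition.continuous.continuousOn
    (show a ∈ Icc (Real.smoothTransition 0) (Real.smoothTransition 1) by
      rw [Real.smoothTransition.zero, Real.smoothTransition.one]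
      exact ⟨ha0.le, ha1.le⟩)
  have hu0 : 0 < u := lt_of_le_of_ne hu.1 (by
    rintro rfl
    rw [Real.smoothTransition.zero] at hua
    exact ha0.ne hua)
  have hu1 : u < 1 := lt_of_le_of_ne hu.2 (by
    rintro rfl
    rw [Real.smoothTransition.one] at hua
    exact ha1.ne' hua)
  refine ⟨fun x => Real.smoothTransition (u + x / ε), ?_, ?_, ?_, ?_, ?_, ?_, ?_, ?_⟩
  · exact Real.smoothTransition.contDiff.comp (by fun_prop)
  · exact fun x => ⟨Real.smoothTransition.nonneg _, Real.smoothTransition.le_one _⟩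
  · intro x hx
    have : x / ε ≤ -1 := by rwa [div_le_iff₀ hε, neg_one_mul]
    exact Real.smoothTransition.zero_of_nonpos (by linarith)
  · intro x hx
    have : 1 ≤ x / ε := by rwa [le_div_iff₀ hε, one_mul]
    exact Real.smoothTransition.one_of_one_le (by linarith)
  · simp [hua]
  · intro x hx
    have hx' : x / ε < 0 := div_neg_of_neg_of_pos hx hε
    beta_reduce
    rcases le_or_gt (u + x / ε) 0 with h | h
    · rw [Real.smoothTransition.zero_of_nonpos h]
      exact ha0
    · conv_rhs => rw [← hua]
      exact strictMonoOn_smoothTransition ⟨h.le, by linarith⟩ hu (by linarith)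
  · intro x hx
    have hx' : 0 < x / ε := div_pos hx hε
    beta_reduce
    rcases le_or_gt 1 (u + x / ε) with h | h
    · rw [Real.smoothTransition.one_of_one_le h]
      exact ha1
    · conv_lhs => rw [← hua]
      exact strictMonoOn_smoothTransition hu ⟨by linarith, h.le⟩ (by linarith)
  · obtain ⟨b, hb, h⟩ := hasDerivAt_smoothTransition hu0 hu1
    have h1 : HasDerivAt (fun x : ℝ => u + x / ε) (1 / ε) 0 :=
      ((hasDerivAt_id (0 : ℝ)).div_const ε).const_add u
    have h2 : HasDerivAt (fun x => Real.smoothTransition (u + x / ε)) (b * (1 / ε)) 0 :=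
      HasDerivAt.comp (h₂ := Real.smoothTransition) 0 (by simpa using h) h1
    rw [h2.deriv]
    positivity

/-! ### Products of quadratic polynomials with disjoint root intervals -/

section IntervalPolynomial

variable {ι : Type*} (A B : ι → ℝ)

/-- The product of the polynomials `(y - A e) (y - B e)`, for `e ∈ S`. -/
def intervalPoly (S : Finset ι) (y : ℝ) : ℝ := ∏ e ∈ S, (y - A e) * (y - B e)

theorem contDiff_intervalPoly (S : Finset ι) : ContDiff ℝ (⊤ : ℕ∞) (intervalPoly A B S) := by
  unfold intervalPoly
  fun_prop

variable {A B}

theorem quadratic_pos {a b y : ℝ} (hab : a < b) (h : y ∉ Icc a b) : 0 < (y - a) * (y - b) := by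
  rcases lt_or_ge y a with h1 | h1
  · exact mul_pos_of_neg_of_neg (by linarith) (by linarith)
  · have h2 : b < y := not_le.1 fun h2 => h ⟨h1, h2⟩
    exact mul_pos (by linarith) (by linarith)

theorem quadratic_nonpos {a b y : ℝ} (h : y ∈ Icc a b) : (y - a) * (y - b) ≤ 0 :=
  mul_nonpos_of_nonneg_of_nonpos (sub_nonneg.2 h.1) (sub_nonpos.2 h.2)

variable {S : Finset ι}

theorem intervalPoly_pos (hlt : ∀ e, A e < B e) {y : ℝ}
    (h : ∀ e ∈ S, y ∉ Icc (A e) (B e)) : 0 < intervalPoly A B S y :=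
  Finset.prod_pos fun e he => quadratic_pos (hlt e) (h e he)

theorem intervalPoly_eq_mul (hlt : ∀ e, A e < B e)
    (hS : ∀ e ∈ S, ∀ e' ∈ S, e ≠ e' → B e < A e' ∨ B e' < A e)
    {e : ι} (he : e ∈ S) {y : ℝ} (hy : y ∈ Icc (A e) (B e)) [DecidableEq ι] :
    (∀ z, intervalPoly A B S z = (z - A e) * (z - B e) * intervalPoly A B (S.erase e) z) ∧
      0 < intervalPoly A B (S.erase e) y := by
  refine ⟨fun z => (Finset.mul_prod_erase S _ he).symm, intervalPoly_pos hlt fun e' he' hy' => ?_⟩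
  have h1 := Finset.mem_erase.1 he'
  rcases hS e he e' h1.2 h1.1.symm with h | h
  · linarith [hy.2, hy'.1]
  · linarith [hy.1, hy'.2]

theorem intervalPoly_nonpos_iff (hlt : ∀ e, A e < B e)
    (hS : ∀ e ∈ S, ∀ e' ∈ S, e ≠ e' → B e < A e' ∨ B e' < A e)
    {y : ℝ} :
    intervalPoly A B S y ≤ 0 ↔ ∃ e ∈ S, y ∈ Icc (A e) (B e) := by
  classical
  constructor
  · intro h
    by_contra! hc
    exact (intervalPoly_pos hlt hc).not_ge h
  · rintro ⟨e, he, hy⟩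
    obtain ⟨h1, h2⟩ := intervalPoly_eq_mul hlt hS he hy
    rw [h1]
    exact mul_nonpos_of_nonpos_of_nonneg (quadratic_nonpos hy) h2.le

theorem intervalPoly_neg (hlt : ∀ e, A e < B e)
    (hS : ∀ e ∈ S, ∀ e' ∈ S, e ≠ e' → B e < A e' ∨ B e' < A e)
    {y : ℝ} {e : ι} (he : e ∈ S) (hy : y ∈ Ioo (A e) (B e)) :
    intervalPoly A B S y < 0 := by
  classical
  obtain ⟨h1, h2⟩ := intervalPoly_eq_mul hlt hS he (Ioo_subset_Icc_self hy)
  rw [h1]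
  exact mul_neg_of_neg_of_pos
    (mul_neg_of_pos_of_neg (sub_pos.2 hy.1) (sub_neg.2 hy.2)) h2

theorem deriv_intervalPoly_ne_zero (hlt : ∀ e, A e < B e)
    (hS : ∀ e ∈ S, ∀ e' ∈ S, e ≠ e' → B e < A e' ∨ B e' < A e)
    {y : ℝ} (h : intervalPoly A B S y = 0) :
    deriv (intervalPoly A B S) y ≠ 0 := by
  classical
  obtain ⟨e, he, hy⟩ := (intervalPoly_nonpos_iff hlt hS).1 h.le
  obtain ⟨h1, h2⟩ := intervalPoly_eq_mul hlt hS he hy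
  have h3 : (y - A e) * (y - B e) = 0 := by
    rw [h1] at h
    exact (mul_eq_zero.1 h).resolve_right h2.ne'
  have h4 : HasDerivAt (fun z => (z - A e) * (z - B e)) (1 * (y - B e) + (y - A e) * 1) y :=
    ((hasDerivAt_id y).sub_const _).mul ((hasDerivAt_id y).sub_const _)
  have h5 := ((contDiff_intervalPoly A B (S.erase e)).differentiable (by simp) y).hasDerivAt
  rw [show intervalPoly A B S = fun z => (z - A e) * (z - B e) * intervalPoly A B (S.erase e) z from
    funext h1, (h4.fun_mul h5).deriv, h3, zero_mul, add_zero]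
  refine mul_ne_zero ?_ h2.ne'
  have := hlt e
  rcases mul_eq_zero.1 h3 with h6 | h6
  · rw [h6]
    intro h7
    linarith
  · rw [h6]
    intro h7
    linarith

end IntervalPolynomial

namespace GraphDiagram

open ArcSystem

variable {ι : Type*}

/-! ### The defining function of the domain -/

/-- Intervals `[A e, B e]` for the arcs of a diagram, which respect the vertical order of the arcs
and match at the forks. -/
structure Levels (G : GraphDiagram ι) where
  A : ι → ℝ
  B : ι → ℝ
  lt : ∀ e, A e < B e
  lt_of_below : ∀ e e', G.Below e e' → B e < A e'
  fork : ∀ v σ e₀ e₁ e₂, G.IsFork v σ e₀ e₁ e₂ → A e₁ = A e₀ ∧ B e₂ = B e₀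

open Classical in
/-- The arcs that pass over the abscissa `x`. -/
noncomputable def arcsOver [Fintype ι] (G : GraphDiagram ι) (x : ℝ) : Finset ι :=
  Finset.univ.filter fun e => G.s e < x ∧ x < G.t e

open Classical in
/-- The arcs present just beside the abscissa `v`, on the side `σ`. -/
noncomputable def side [Fintype ι] (G : GraphDiagram ι) (v σ : ℝ) : Finset ι :=
  Finset.univ.filter fun e => (G.s e < v ∧ v < G.t e) ∨ G.Emanates v σ e

variable [Fintype ι] {G : GraphDiagram ι}

theorem mem_arcsOver {x : ℝ} {e : ι} : e ∈ G.arcsOver x ↔ G.s e < x ∧ x < G.t e := by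
  simp [arcsOver]

theorem mem_side {v σ : ℝ} {e : ι} :
    e ∈ G.side v σ ↔ (G.s e < v ∧ v < G.t e) ∨ G.Emanates v σ e := by
  simp [side]

theorem Levels.disjoint_arcsOver (L : G.Levels) {x : ℝ} :
    ∀ e ∈ G.arcsOver x, ∀ e' ∈ G.arcsOver x, e ≠ e' → L.B e < L.A e' ∨ L.B e' < L.A e := by
  intro e he e' he' hne
  rw [mem_arcsOver] at he he'
  exact (below_or_below hne he.1 he.2 he'.1 he'.2).imp (L.lt_of_below e e') (L.lt_of_below e' e)

/-- The abscissas of the vertices are at least `4ε` apart. -/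
def Separated (G : GraphDiagram ι) (ε : ℝ) : Prop :=
  ∀ v ∈ G.X, ∀ w ∈ G.X, v ≠ w → 4 * ε ≤ |v - w|

theorem Separated.arcsOver_eq_side {ε : ℝ} (hsep : G.Separated ε) {v σ x : ℝ} (hv : v ∈ G.X)
    (hσ : σ = 1 ∨ σ = -1) (h0 : 0 < σ * (x - v)) (h1 : σ * (x - v) < 2 * ε) :
    G.arcsOver x = G.side v σ := by
  ext e
  rw [mem_arcsOver, mem_side]
  have hst := G.s_lt_t e
  have hs : G.s e = v ∨ 4 * ε ≤ |G.s e - v| :=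
    or_iff_not_imp_left.2 fun h => hsep _ (G.s_mem e) v hv h
  have ht : G.t e = v ∨ 4 * ε ≤ |G.t e - v| :=
    or_iff_not_imp_left.2 fun h => hsep _ (G.t_mem e) v hv h
  rw [le_abs] at hs ht
  rcases hσ with rfl | rfl
  · rw [emanates_one]
    constructor
    · rintro ⟨h2, h3⟩
      rcases hs with h4 | h4 | h4
      · exact Or.inr h4
      · linarith
      · left
        constructor <;> linarith
    · rintro (⟨h2, h3⟩ | h2)
      · rcases ht with h4 | h4 | h4
        · linarith
        · constructor <;> linarith
        · linarith
      · rcases ht with h4 | h4 | h4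
        · linarith
        · constructor <;> linarith
        · linarith
  · rw [emanates_neg_one]
    constructor
    · rintro ⟨h2, h3⟩
      rcases ht with h4 | h4 | h4
      · exact Or.inr h4
      · left
        constructor <;> linarith
      · linarith
    · rintro (⟨h2, h3⟩ | h2)
      · rcases hs with h4 | h4 | h4
        · linarith
        · linarith
        · constructor <;> linarith
      · rcases hs with h4 | h4 | h4
        · linarith
        · linarith
        · constructor <;> linarith

theorem Levels.disjoint_side (L : G.Levels) {ε : ℝ} (hε : 0 < ε) (hsep : G.Separated ε) {v σ : ℝ}
    (hv : v ∈ G.X) (hσ : σ = 1 ∨ σ = -1) :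
    ∀ e ∈ G.side v σ, ∀ e' ∈ G.side v σ, e ≠ e' → L.B e < L.A e' ∨ L.B e' < L.A e := by
  have h1 : σ * (v + σ * ε - v) = ε := by rcases hσ with rfl | rfl <;> ring
  rw [← hsep.arcsOver_eq_side (x := v + σ * ε) hv hσ (by rw [h1]; exact hε) (by rw [h1]; linarith)]
  exact L.disjoint_arcsOver

/-- The data needed to define the domain near the vertex of abscissa `v`. The pair of roots `l`, `u`
is born at this vertex in the direction `σ`; `lam` is a switch that interpolates between the
polynomials on the two sides, and its critical value is that at which the
two new roots coincide. -/
structure VertexModel (L : G.Levels) (ε v : ℝ) where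
  σ : ℝ
  l : ℝ
  u : ℝ
  lam : ℝ → ℝ
  sign : σ = 1 ∨ σ = -1
  l_lt_u : l < u
  poly_eq : ∀ y, intervalPoly L.A L.B (G.side v σ) y =
    intervalPoly L.A L.B (G.side v (-σ)) y * ((y - l) * (y - u))
  poly_ne : ∀ y ∈ Icc l u, intervalPoly L.A L.B (G.side v (-σ)) y ≠ 0
  shape : (∃ e, G.IsEnd v σ e ∧ l = L.A e ∧ u = L.B e) ∨
    ∃ e₀ e₁ e₂, G.IsFork v σ e₀ e₁ e₂ ∧ l = L.B e₁ ∧ u = L.A e₂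
  contDiff_lam : ContDiff ℝ (⊤ : ℕ∞) lam
  lam_mem : ∀ x, 0 ≤ lam x ∧ lam x ≤ 1
  lam_eq_zero : ∀ x, σ * (x - v) ≤ -ε → lam x = 0
  lam_eq_one : ∀ x, ε ≤ σ * (x - v) → lam x = 1
  lam_self : lam v = 1 / (1 + ((u - l) / 2) ^ 2)
  lam_lt : ∀ x, σ * (x - v) < 0 → lam x < 1 / (1 + ((u - l) / 2) ^ 2)
  lt_lam : ∀ x, 0 < σ * (x - v) → 1 / (1 + ((u - l) / 2) ^ 2) < lam x
  deriv_lam : deriv lam v ≠ 0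

theorem exists_switch_at {ε v σ a : ℝ} (hε : 0 < ε) (hσ : σ = 1 ∨ σ = -1) (ha0 : 0 < a)
    (ha1 : a < 1) : ∃ lam : ℝ → ℝ, ContDiff ℝ (⊤ : ℕ∞) lam ∧ (∀ x, 0 ≤ lam x ∧ lam x ≤ 1) ∧
      (∀ x, σ * (x - v) ≤ -ε → lam x = 0) ∧ (∀ x, ε ≤ σ * (x - v) → lam x = 1) ∧ lam v = a ∧
      (∀ x, σ * (x - v) < 0 → lam x < a) ∧ (∀ x, 0 < σ * (x - v) → a < lam x) ∧
      deriv lam v ≠ 0 := by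
  obtain ⟨φ, h1, h2, h3, h4, h5, h6, h7, h8⟩ := exists_smooth_switch hε ha0 ha1
  refine ⟨fun x => φ (σ * (x - v)), h1.comp (by fun_prop), fun x => h2 _, fun x => h3 _,
    fun x => h4 _, by simpa using h5, fun x => h6 _, fun x => h7 _, ?_⟩
  have h9 : HasDerivAt (fun x => σ * (x - v)) (σ * 1) v :=
    ((hasDerivAt_id v).sub_const v).const_mul σ
  have h10 : HasDerivAt φ (deriv φ 0) (σ * (v - v)) := by
    rw [sub_self, mul_zero]
    exact (h1.differentiable (by simp) 0).hasDerivAt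
  have h11 : HasDerivAt (fun x => φ (σ * (x - v))) (deriv φ 0 * (σ * 1)) v := h10.comp v h9
  rw [h11.deriv]
  refine mul_ne_zero h8 ?_
  rcases hσ with rfl | rfl <;> norm_num

/-- At an end the factor that appears is the one of the interval of the end arc. At a fork it is the one
of the gap between the intervals of the branches, whose outer ends are those of the stem. -/
theorem exists_vertexModel (L : G.Levels) {ε v : ℝ} (hε : 0 < ε) (hsep : G.Separated ε)
    (hv : v ∈ G.X) : Nonempty (VertexModel L ε v) := by
  classical
  obtain ⟨σ, hσ, hvert⟩ := G.vertex v hv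
  have hσ' : -σ = 1 ∨ -σ = -1 := by rcases hσ with rfl | rfl <;> simp
  suffices h : ∃ l u : ℝ, l < u ∧ (∀ y, intervalPoly L.A L.B (G.side v σ) y =
      intervalPoly L.A L.B (G.side v (-σ)) y * ((y - l) * (y - u))) ∧
      (∀ y ∈ Icc l u, intervalPoly L.A L.B (G.side v (-σ)) y ≠ 0) ∧
      ((∃ e, G.IsEnd v σ e ∧ l = L.A e ∧ u = L.B e) ∨
      ∃ e₀ e₁ e₂, G.IsFork v σ e₀ e₁ e₂ ∧ l = L.B e₁ ∧ u = L.A e₂) by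
    obtain ⟨l, u, hlu, hp, hne, hshape⟩ := h
    have hpos : 0 < ((u - l) / 2) ^ 2 := by
      have := sub_pos.2 hlu
      positivity
    obtain ⟨lam, h1, h2, h3, h4, h5, h6, h7, h8⟩ := exists_switch_at (v := v) hε hσ
      (a := 1 / (1 + ((u - l) / 2) ^ 2)) (by positivity)
      (by rw [div_lt_one (by positivity)]; linarith)
    exact ⟨⟨σ, l, u, lam, hσ, hlu, hp, hne, hshape, h1, h2, h3, h4, h5, h6, h7, h8⟩⟩
  have hthrough : ∀ e σ', G.Emanates v σ' e → ¬ (G.s e < v ∧ v < G.t e) := by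
    rintro e σ' (⟨-, rfl⟩ | ⟨-, rfl⟩) ⟨h1, h2⟩
    · exact h1.false
    · exact h2.false
  rcases hvert with ⟨e, he⟩ | ⟨e₀, e₁, e₂, hf⟩
  · have hem := (he.1 e).2 rfl
    have hside : G.side v σ = insert e (G.side v (-σ)) := by
      ext e'
      rw [Finset.mem_insert, mem_side, mem_side, he.1 e', or_iff_left (he.2 e'), or_comm]
    have hnot : e ∉ G.side v (-σ) := by
      rw [mem_side]
      rintro (h | h)
      · exact hthrough e σ hem h
      · exact he.2 e h
    refine ⟨L.A e, L.B e, L.lt e, fun y => ?_, fun y hy => ?_, Or.inl ⟨e, he, rfl, rfl⟩⟩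
    · rw [hside, intervalPoly, Finset.prod_insert hnot, mul_comm]
      rfl
    · refine (intervalPoly_pos L.lt fun e' he' hy' => ?_).ne'
      have hmem : e' ∈ G.side v σ := by
        rw [hside]
        exact Finset.mem_insert_of_mem he'
      have hmem' : e ∈ G.side v σ := by
        rw [hside]
        exact Finset.mem_insert_self _ _
      have hne : e ≠ e' := fun h => hnot (h ▸ he')
      rcases L.disjoint_side hε hsep hv hσ e hmem' e' hmem hne with h | h
      · linarith [hy.2, hy'.1]
      · linarith [hy.1, hy'.2]
  · have hem0 := (hf.1 e₀).2 rfl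
    have hem1 := (hf.2.1 e₁).2 (Or.inl rfl)
    have hem2 := (hf.2.1 e₂).2 (Or.inr rfl)
    obtain ⟨hA, hB⟩ := L.fork v σ e₀ e₁ e₂ hf
    have hlt := L.lt_of_below e₁ e₂ hf.2.2
    let T : Finset ι := Finset.univ.filter fun e => G.s e < v ∧ v < G.t e
    have hT : ∀ e, e ∈ T ↔ G.s e < v ∧ v < G.t e := fun e => by simp [T]
    have hside : G.side v σ = insert e₁ (insert e₂ T) := by
      ext e'
      rw [Finset.mem_insert, Finset.mem_insert, hT, mem_side, hf.2.1 e', or_comm, or_assoc]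
    have hside' : G.side v (-σ) = insert e₀ T := by
      ext e'
      rw [Finset.mem_insert, hT, mem_side, hf.1 e', or_comm]
    have h0 : e₀ ∉ T := fun h => hthrough e₀ _ hem0 ((hT _).1 h)
    have h2 : e₂ ∉ T := fun h => hthrough e₂ _ hem2 ((hT _).1 h)
    have h1 : e₁ ∉ insert e₂ T := fun h => by
      rcases Finset.mem_insert.1 h with h | h
      · exact hf.2.2.ne h
      · exact hthrough e₁ _ hem1 ((hT _).1 h)
    refine ⟨L.B e₁, L.A e₂, hlt, fun y => ?_, fun y hy => ?_, Or.inr ⟨e₀, e₁, e₂, hf, rfl, rfl⟩⟩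
    · rw [hside, hside', intervalPoly, intervalPoly, Finset.prod_insert h1, Finset.prod_insert h2,
        Finset.prod_insert h0, hA, hB]
      ring
    · refine (intervalPoly_neg L.lt (L.disjoint_side hε hsep hv hσ') (e := e₀) ?_ ?_).ne
      · rw [hside']
        exact Finset.mem_insert_self _ _
      · constructor
        · linarith [hy.1, L.lt e₁]
        · linarith [hy.2, L.lt e₂]

namespace VertexModel

variable {L : G.Levels} {ε v : ℝ} (M : VertexModel L ε v)

/-- The factor that creates the roots `l` and `u`. -/
noncomputable def factor (x y : ℝ) : ℝ := 1 - M.lam x + M.lam x * ((y - M.l) * (y - M.u))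

/-- The ordinate at which the new roots are born. -/
noncomputable def center : ℝ := (M.l + M.u) / 2

/-- The critical value of the switch. -/
noncomputable def crit : ℝ := 1 / (1 + ((M.u - M.l) / 2) ^ 2)

/-- Half the distance between the new roots over the abscissa `x`, and `0` where they do not
exist. -/
noncomputable def radius (x : ℝ) : ℝ :=
  √(max 0 (((M.u - M.l) / 2) ^ 2 - (1 - M.lam x) / max (M.lam x) M.crit))

theorem crit_pos : 0 < M.crit := by
  unfold crit
  positivity

theorem crit_eq : (1 - M.crit) = M.crit * ((M.u - M.l) / 2) ^ 2 := by
  unfold crit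
  field_simp
  ring

theorem continuous_radius : Continuous M.radius := by
  have h1 := M.contDiff_lam.continuous
  have h2 : ∀ x, max (M.lam x) M.crit ≠ 0 := fun x =>
    (M.crit_pos.trans_le (le_max_right _ _)).ne'
  unfold radius
  fun_prop (disch := assumption)

theorem radius_nonneg (x : ℝ) : 0 ≤ M.radius x := Real.sqrt_nonneg _

theorem lam_le_crit {x : ℝ} (hx : M.σ * (x - v) ≤ 0) : M.lam x ≤ M.crit := by
  rcases hx.eq_or_lt with h | h
  · have : x = v := by
      rcases M.sign with h1 | h1 <;> rw [h1] at h <;> linarith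
    rw [this]
    exact M.lam_self.le
  · exact (M.lam_lt x h).le

theorem crit_le_lam {x : ℝ} (hx : 0 ≤ M.σ * (x - v)) : M.crit ≤ M.lam x := by
  rcases hx.eq_or_lt with h | h
  · have : x = v := by
      rcases M.sign with h1 | h1 <;> rw [h1] at h <;> linarith
    rw [this]
    exact M.lam_self.ge
  · exact (M.lt_lam x h).le

theorem radius_eq_zero {x : ℝ} (hx : M.σ * (x - v) ≤ 0) : M.radius x = 0 := by
  have h1 := M.lam_le_crit hx
  have h2 := M.crit_pos
  rw [radius, max_eq_right h1, max_eq_left, Real.sqrt_zero]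
  rw [sub_nonpos, le_div_iff₀ h2]
  linarith [M.crit_eq]

theorem radius_sq {x : ℝ} (hx : 0 ≤ M.σ * (x - v)) :
    M.lam x * M.radius x ^ 2 = M.lam x * ((M.u - M.l) / 2) ^ 2 - (1 - M.lam x) := by
  have h1 := M.crit_le_lam hx
  have h2 := M.crit_pos
  have h3 : 0 < M.lam x := h2.trans_le h1
  have h4 : (1 - M.lam x) / M.lam x ≤ ((M.u - M.l) / 2) ^ 2 := by
    rw [div_le_iff₀ h3]
    nlinarith [M.crit_eq, sq_nonneg ((M.u - M.l) / 2)]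
  rw [radius, max_eq_left h1, Real.sq_sqrt (le_max_left _ _), max_eq_right (by linarith)]
  field_simp

theorem factor_eq {x y : ℝ} (hx : 0 ≤ M.σ * (x - v)) :
    M.factor x y = M.lam x * ((y - M.center) ^ 2 - M.radius x ^ 2) := by
  rw [mul_sub, M.radius_sq hx, factor, center]
  ring

theorem lam_pos {x : ℝ} (hx : 0 ≤ M.σ * (x - v)) : 0 < M.lam x :=
  M.crit_pos.trans_le (M.crit_le_lam hx)

theorem radius_pos {x : ℝ} (hx : 0 < M.σ * (x - v)) : 0 < M.radius x := by
  have h1 : M.crit < M.lam x := M.lt_lam x hx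
  have h2 := M.crit_pos
  have h3 := M.radius_sq hx.le
  refine lt_of_le_of_ne (M.radius_nonneg x) fun h => ?_
  rw [← h] at h3
  nlinarith [M.crit_eq, sq_nonneg ((M.u - M.l) / 2)]

theorem radius_le (x : ℝ) : M.radius x ≤ (M.u - M.l) / 2 := by
  have h0 : 0 ≤ (M.u - M.l) / 2 := by linarith [M.l_lt_u]
  rcases le_or_gt 0 (M.σ * (x - v)) with h | h
  · refine abs_le_of_sq_le_sq' ?_ h0 |>.2
    have h1 := M.radius_sq h
    have h2 := M.lam_pos h
    refine le_of_mul_le_mul_left ?_ h2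
    linarith [(M.lam_mem x).2]
  · rw [M.radius_eq_zero h.le]
    exact h0

theorem factor_pos_of_neg {x y : ℝ} (hx : M.σ * (x - v) < 0) : 0 < M.factor x y := by
  have h1 : M.lam x < M.crit := M.lam_lt x hx
  have h2 := (M.lam_mem x).1
  have h3 : (y - M.l) * (y - M.u) = (y - M.center) ^ 2 - ((M.u - M.l) / 2) ^ 2 := by
    rw [center]
    ring
  rw [factor, h3]
  nlinarith [M.crit_eq, mul_nonneg h2 (sq_nonneg (y - M.center)), sq_nonneg ((M.u - M.l) / 2)]

theorem factor_nonpos_iff {x y : ℝ} :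
    M.factor x y ≤ 0 ↔ 0 ≤ M.σ * (x - v) ∧ |y - M.center| ≤ M.radius x := by
  rcases le_or_gt 0 (M.σ * (x - v)) with h | h
  · rw [M.factor_eq h, and_iff_right h, mul_nonpos_iff_pos_imp_nonpos]
    have h1 := M.lam_pos h
    simp only [h1, forall_const, sub_nonpos, h1.le]
    rw [sq_le_sq, abs_of_nonneg (M.radius_nonneg x)]
    constructor
    · exact fun h => h.1
    · exact fun h => ⟨h, fun _ => trivial⟩
  · exact iff_of_false (M.factor_pos_of_neg h).not_ge fun h' => h.not_ge h'.1

theorem factor_neg_iff {x y : ℝ} :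
    M.factor x y < 0 ↔ |y - M.center| < M.radius x := by
  rcases le_or_gt 0 (M.σ * (x - v)) with h | h
  · have h1 := M.lam_pos h
    rw [M.factor_eq h, ← sq_lt_sq₀ (abs_nonneg _) (M.radius_nonneg x), sq_abs]
    constructor
    · intro h2
      nlinarith
    · intro h2
      nlinarith
  · rw [M.radius_eq_zero h.le]
    exact iff_of_false (M.factor_pos_of_neg h).not_gt (abs_nonneg _).not_gt

theorem mem_Icc_of_factor_nonpos {x y : ℝ} (h : M.factor x y ≤ 0) : y ∈ Icc M.l M.u := by
  have h1 := abs_le.1 ((M.factor_nonpos_iff.1 h).2.trans (M.radius_le x))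
  rw [center] at h1
  constructor <;> linarith [h1.1, h1.2]

end VertexModel

end GraphDiagram

namespace GraphDiagram

open ArcSystem

variable {ι : Type*} [Fintype ι] {G : GraphDiagram ι}

theorem arcsOver_congr {x x' : ℝ} (h : ∀ v ∈ G.X, v ∉ uIcc x x') : G.arcsOver x = G.arcsOver x' := by
  have key : ∀ v ∈ G.X, (v < x ↔ v < x') ∧ (x < v ↔ x' < v) := fun v hv => by
    have h1 := h v hv
    rw [mem_uIcc] at h1
    push Not at h1
    constructor <;> constructor <;> intro h2
    · by_contra h3
      exact absurd (h1.2 (not_lt.1 h3)) h2.le.not_gt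
    · by_contra h3
      exact absurd (h1.1 (not_lt.1 h3)) h2.le.not_gt
    · by_contra h3
      exact absurd (h1.1 h2.le) (not_lt.1 h3).not_gt
    · by_contra h3
      exact absurd (h1.2 h2.le) (not_lt.1 h3).not_gt
  ext e
  rw [mem_arcsOver, mem_arcsOver, (key _ (G.s_mem e)).1, (key _ (G.t_mem e)).2]

theorem eventually_arcsOver_eq {x₀ : ℝ} (h : x₀ ∉ G.X) :
    ∀ᶠ x in 𝓝 x₀, G.arcsOver x = G.arcsOver x₀ := by
  have h1 : ∀ᶠ x in 𝓝 x₀, ∀ v ∈ G.X, v ∉ uIcc x x₀ := by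
    refine (Finset.eventually_all _).2 fun v hv => ?_
    have hne : 0 < |v - x₀| := abs_pos.2 (sub_ne_zero.2 fun h' => h (h' ▸ hv))
    filter_upwards [Metric.ball_mem_nhds x₀ hne] with x hx hv'
    rw [Metric.mem_ball, Real.dist_eq] at hx
    exact (abs_sub_left_of_mem_uIcc (uIcc_comm x x₀ ▸ hv')).not_gt hx
  filter_upwards [h1] with x hx using arcsOver_congr hx

open Classical in
/-- The defining function of the domain: away from the vertices it is the polynomial with root
intervals `[A e, B e]`, for the arcs `e` over the abscissa, and near a vertex the switch
interpolates between the polynomials of the two sides. -/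
noncomputable def defFun (L : G.Levels) (ε : ℝ) (M : ∀ v ∈ G.X, VertexModel L ε v)
    (p : ℝ × ℝ) : ℝ :=
  if h : ∃ v ∈ G.X, |p.1 - v| < 2 * ε then
    intervalPoly L.A L.B (G.side h.choose (-(M h.choose h.choose_spec.1).σ)) p.2 *
      (M h.choose h.choose_spec.1).factor p.1 p.2
  else intervalPoly L.A L.B (G.arcsOver p.1) p.2

variable {L : G.Levels} {ε : ℝ} {M : ∀ v ∈ G.X, VertexModel L ε v}

theorem defFun_of_near (hsep : G.Separated ε) {v x : ℝ} (hv : v ∈ G.X) (hx : |x - v| < 2 * ε)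
    (y : ℝ) : defFun L ε M (x, y) =
      intervalPoly L.A L.B (G.side v (-(M v hv).σ)) y * (M v hv).factor x y := by
  have h : ∃ v ∈ G.X, |x - v| < 2 * ε := ⟨v, hv, hx⟩
  rw [defFun, dif_pos h]
  have huniq : ∀ w (hw : w ∈ G.X), |x - w| < 2 * ε → w = v := fun w hw hxw => by
    by_contra hne
    have h1 := hsep w hw v hv hne
    have h2 := abs_sub_le w x v
    rw [abs_sub_comm w x] at h2
    linarith
  have hcongr : ∀ w (hw : w ∈ G.X), w = v →
      intervalPoly L.A L.B (G.side w (-(M w hw).σ)) y * (M w hw).factor x y =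
        intervalPoly L.A L.B (G.side v (-(M v hv).σ)) y * (M v hv).factor x y := by
    rintro w hw rfl
    rfl
  exact hcongr _ h.choose_spec.1 (huniq _ h.choose_spec.1 h.choose_spec.2)

theorem sign_mul_abs {σ a : ℝ} (hσ : σ = 1 ∨ σ = -1) : |σ * a| = |a| := by
  rcases hσ with rfl | rfl <;> simp

theorem defFun_of_far (hε : 0 < ε) (hsep : G.Separated ε) {x : ℝ}
    (hx : ∀ v ∈ G.X, ε ≤ |x - v|) (y : ℝ) :
    defFun L ε M (x, y) = intervalPoly L.A L.B (G.arcsOver x) y := by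
  by_cases h : ∃ v ∈ G.X, |x - v| < 2 * ε
  · obtain ⟨v, hv, hxv⟩ := h
    rw [defFun_of_near hsep hv hxv]
    have hσ := (M v hv).sign
    have h1 := hx v hv
    rw [← sign_mul_abs hσ] at h1 hxv
    have h2 := abs_lt.1 hxv
    rcases le_abs.1 h1 with h3 | h3
    · rw [hsep.arcsOver_eq_side hv hσ (by linarith) h2.2, (M v hv).poly_eq,
        VertexModel.factor, (M v hv).lam_eq_one x h3]
      ring
    · have hσ' : -(M v hv).σ = 1 ∨ -(M v hv).σ = -1 := by
        rcases hσ with h4 | h4 <;> rw [h4] <;> simp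
      rw [hsep.arcsOver_eq_side hv hσ' (by linarith) (by linarith), VertexModel.factor,
        (M v hv).lam_eq_zero x (by linarith)]
      ring
  · rw [defFun, dif_neg h]

theorem eventually_far (hε : 0 < ε) (hsep : G.Separated ε) {x₀ : ℝ}
    (hx : ∀ v ∈ G.X, ε < |x₀ - v|) : ∀ᶠ x in 𝓝 x₀, x ∉ G.X ∧ G.arcsOver x = G.arcsOver x₀ ∧
      ∀ y, defFun L ε M (x, y) = intervalPoly L.A L.B (G.arcsOver x₀) y := by
  have h0 : x₀ ∉ G.X := fun h => by
    have := hx x₀ h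
    rw [sub_self, abs_zero] at this
    exact this.not_gt hε
  have h1 : ∀ᶠ x in 𝓝 x₀, ∀ v ∈ G.X, ε < |x - v| := by
    refine (Finset.eventually_all _).2 fun v hv => ?_
    have hc : Continuous fun x => |x - v| := by fun_prop
    exact hc.continuousAt.eventually (lt_mem_nhds (hx v hv))
  filter_upwards [h1, eventually_arcsOver_eq h0] with x hx1 hx2
  refine ⟨fun h => ?_, hx2, fun y => ?_⟩
  · have := hx1 x h
    rw [sub_self, abs_zero] at this
    exact this.not_gt hε
  · rw [defFun_of_far hε hsep fun v hv => (hx1 v hv).le, hx2]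

theorem eventually_near (hsep : G.Separated ε) {v x₀ : ℝ} (hv : v ∈ G.X)
    (hx : |x₀ - v| < 2 * ε) : ∀ᶠ x in 𝓝 x₀, ∀ y, defFun L ε M (x, y) =
      intervalPoly L.A L.B (G.side v (-(M v hv).σ)) y * (M v hv).factor x y := by
  have hc : Continuous fun x => |x - v| := by fun_prop
  filter_upwards [hc.continuousAt.eventually (gt_mem_nhds hx)] with x hx'
  exact defFun_of_near hsep hv hx'

/-- The ranges of abscissas near a vertex and far from the vertices overlap, so each of the two formulas
for `defFun` holds on an open set of abscissas. -/
theorem near_or_far {ι : Type*} (G : GraphDiagram ι) (hε : 0 < ε) (x : ℝ) :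
    (∃ v ∈ G.X, |x - v| < 2 * ε) ∨ ∀ v ∈ G.X, ε < |x - v| := by
  rw [or_iff_not_imp_left]
  push Not
  intro h v hv
  linarith [h v hv]

theorem contDiff_defFun (hε : 0 < ε) (hsep : G.Separated ε) :
    ContDiff ℝ (⊤ : ℕ∞) (defFun L ε M) := by
  refine contDiff_iff_contDiffAt.2 fun p => ?_
  rcases near_or_far G hε p.1 with ⟨v, hv, hx⟩ | hx
  · have h1 : ContDiff ℝ (⊤ : ℕ∞) fun q : ℝ × ℝ =>
        intervalPoly L.A L.B (G.side v (-(M v hv).σ)) q.2 * (M v hv).factor q.1 q.2 := by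
      have h2 := contDiff_intervalPoly L.A L.B (G.side v (-(M v hv).σ))
      have h3 := (M v hv).contDiff_lam
      unfold VertexModel.factor
      fun_prop
    refine h1.contDiffAt.congr_of_eventuallyEq ?_
    filter_upwards [continuousAt_fst.eventually (eventually_near (M := M) hsep hv hx)] with q hq
    exact hq q.2
  · have h1 : ContDiff ℝ (⊤ : ℕ∞) fun q : ℝ × ℝ =>
        intervalPoly L.A L.B (G.arcsOver p.1) q.2 :=
      (contDiff_intervalPoly L.A L.B (G.arcsOver p.1)).comp contDiff_snd
    refine h1.contDiffAt.congr_of_eventuallyEq ?_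
    filter_upwards [continuousAt_fst.eventually (eventually_far (M := M) hε hsep hx)] with q hq
    exact hq.2.2 q.2

theorem fderiv_apply_snd {f : ℝ × ℝ → ℝ} (hf : Differentiable ℝ f) (p : ℝ × ℝ) :
    fderiv ℝ f p (0, 1) = deriv (fun y => f (p.1, y)) p.2 := by
  have h1 : HasDerivAt (fun y : ℝ => (p.1, y)) (0, 1) p.2 :=
    (hasDerivAt_const p.2 p.1).prodMk (hasDerivAt_id p.2)
  have h2 : HasFDerivAt f (fderiv ℝ f p) (p.1, p.2) := (hf p).hasFDerivAt
  exact (h2.comp_hasDerivAt p.2 h1).deriv.symm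

theorem fderiv_apply_fst {f : ℝ × ℝ → ℝ} (hf : Differentiable ℝ f) (p : ℝ × ℝ) :
    fderiv ℝ f p (1, 0) = deriv (fun x => f (x, p.2)) p.1 := by
  have h1 : HasDerivAt (fun x : ℝ => (x, p.2)) (1, 0) p.1 :=
    (hasDerivAt_id p.1).prodMk (hasDerivAt_const p.1 p.2)
  have h2 : HasFDerivAt f (fderiv ℝ f p) (p.1, p.2) := (hf p).hasFDerivAt
  exact (h2.comp_hasDerivAt p.1 h1).deriv.symm

theorem VertexModel.factor_tip {v : ℝ} (N : VertexModel L ε v) : N.factor v N.center = 0 := by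
  rw [N.factor_eq (by simp), N.radius_eq_zero (by simp)]
  simp

theorem VertexModel.center_mem {v : ℝ} (N : VertexModel L ε v) : N.center ∈ Icc N.l N.u := by
  have := N.l_lt_u
  rw [center]
  constructor <;> linarith

theorem defFun_tip (hε : 0 < ε) (hsep : G.Separated ε) {v : ℝ} (hv : v ∈ G.X) :
    defFun L ε M (v, (M v hv).center) = 0 := by
  rw [defFun_of_near hsep hv (by simpa using hε), (M v hv).factor_tip, mul_zero]

/-- The horizontal derivative at the tip does not vanish, because that of the switch does not. -/
theorem deriv_defFun_tip (hε : 0 < ε) (hsep : G.Separated ε) {v : ℝ} (hv : v ∈ G.X) :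
    fderiv ℝ (defFun L ε M) (v, (M v hv).center) (1, 0) ≠ 0 := by
  rw [fderiv_apply_fst ((contDiff_defFun hε hsep).differentiable (by simp))]
  set N := M v hv
  have h1 := (N.contDiff_lam.differentiable (by simp) v).hasDerivAt
  have h2 : HasDerivAt (fun x => N.factor x N.center)
      (0 - deriv N.lam v + deriv N.lam v * ((N.center - N.l) * (N.center - N.u))) v :=
    ((hasDerivAt_const v (1 : ℝ)).sub h1).add (h1.mul_const _)
  have h3 := h2.const_mul (intervalPoly L.A L.B (G.side v (-N.σ)) N.center)
  rw [(h3.congr_of_eventuallyEq ?_).deriv]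
  · refine mul_ne_zero (N.poly_ne _ N.center_mem) ?_
    have h4 : (N.center - N.l) * (N.center - N.u) = -((N.u - N.l) / 2) ^ 2 := by
      rw [VertexModel.center]
      ring
    rw [h4, show 0 - deriv N.lam v + deriv N.lam v * -((N.u - N.l) / 2) ^ 2 =
      deriv N.lam v * -(1 + ((N.u - N.l) / 2) ^ 2) by ring]
    have h5 : 0 < 1 + ((N.u - N.l) / 2) ^ 2 := by positivity
    exact mul_ne_zero N.deriv_lam (neg_ne_zero.2 h5.ne')
  · filter_upwards [eventually_near (M := M) hsep hv (x₀ := v) (by simpa using hε)] with x hx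
    exact hx _

/-- The points of the zero set with a vertical tangent are the centres of the vertex models. -/
theorem eq_tip_of_fderiv_eq_zero (hε : 0 < ε) (hsep : G.Separated ε) {p : ℝ × ℝ}
    (hp : defFun L ε M p = 0) (hd : fderiv ℝ (defFun L ε M) p (0, 1) = 0) :
    ∃ v, ∃ hv : v ∈ G.X, p = (v, (M v hv).center) := by
  obtain ⟨x, y⟩ := p
  rw [fderiv_apply_snd ((contDiff_defFun hε hsep).differentiable (by simp))] at hd
  rcases near_or_far G hε x with ⟨v, hv, hx⟩ | hx
  · refine ⟨v, hv, ?_⟩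
    set N := M v hv with hN
    have hσ' : -N.σ = 1 ∨ -N.σ = -1 := by
      rcases N.sign with h4 | h4 <;> rw [h4] <;> simp
    have hfun : (fun z => defFun L ε M (x, z)) =
        fun z => intervalPoly L.A L.B (G.side v (-N.σ)) z * N.factor x z :=
      funext fun z => defFun_of_near hsep hv hx z
    have h1 := ((contDiff_intervalPoly L.A L.B (G.side v (-N.σ))).differentiable
      (by simp) y).hasDerivAt
    have h2 : HasDerivAt (fun z => N.factor x z)
        (N.lam x * (1 * (y - N.u) + (y - N.l) * 1)) y :=
      ((((hasDerivAt_id y).sub_const _).mul ((hasDerivAt_id y).sub_const _)).const_mul _).const_add _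
    rw [defFun_of_near hsep hv hx] at hp
    rw [show (fun y => defFun L ε M ((x, y).1, y)) = fun z => _ from hfun,
      show (x, y).2 = y from rfl, (h1.fun_mul h2).deriv] at hd
    rcases mul_eq_zero.1 hp with h3 | h3
    · have h4 : N.factor x y ≠ 0 := fun h4 =>
        N.poly_ne y (N.mem_Icc_of_factor_nonpos h4.le) h3
      rw [h3, zero_mul, add_zero] at hd
      exact absurd ((mul_eq_zero.1 hd).resolve_right h4)
        (deriv_intervalPoly_ne_zero L.lt (L.disjoint_side hε hsep hv hσ') h3)
    · have h4 := N.poly_ne y (N.mem_Icc_of_factor_nonpos h3.le)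
      have h5 := N.factor_nonpos_iff.1 h3.le
      have h6 := N.lam_pos h5.1
      rw [h3, mul_zero, zero_add] at hd
      have h7 := ((mul_eq_zero.1 hd).resolve_left h4)
      have h8 := (mul_eq_zero.1 h7).resolve_left h6.ne'
      have hy : y = N.center := by
        rw [VertexModel.center]
        linarith
      have h9 : ¬ N.factor x y < 0 := by
        rw [h3]
        exact lt_irrefl _
      rw [N.factor_neg_iff, hy, sub_self, abs_zero, not_lt] at h9
      have h10 : ¬ 0 < N.σ * (x - v) := fun h => (N.radius_pos h).not_ge h9
      have h11 := le_antisymm (not_lt.1 h10) h5.1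
      have hxv : x = v := by
        rcases N.sign with h1 | h1 <;> rw [h1] at h11 <;> linarith
      rw [hxv, hy]
  · have hfun : (fun z => defFun L ε M (x, z)) = intervalPoly L.A L.B (G.arcsOver x) :=
      funext fun z => defFun_of_far hε hsep (fun v hv => (hx v hv).le) z
    rw [show (fun y => defFun L ε M ((x, y).1, y)) = _ from hfun] at hd
    rw [defFun_of_far hε hsep fun v hv => (hx v hv).le] at hp
    exact absurd hd (deriv_intervalPoly_ne_zero L.lt L.disjoint_arcsOver hp)

theorem fderiv_defFun_ne_zero (hε : 0 < ε) (hsep : G.Separated ε) (p : ℝ × ℝ)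
    (hp : defFun L ε M p = 0) : fderiv ℝ (defFun L ε M) p ≠ 0 := fun h => by
  obtain ⟨v, hv, rfl⟩ := eq_tip_of_fderiv_eq_zero hε hsep hp (by rw [h]; rfl)
  exact deriv_defFun_tip hε hsep hv (by rw [h]; rfl)

theorem topCriticalSet_defFun (hε : 0 < ε) (hsep : G.Separated ε) :
    topCriticalSet Prod.fst {p | defFun L ε M p = 0} =
      {p | ∃ v, ∃ hv : v ∈ G.X, p = (v, (M v hv).center)} := by
  ext p
  constructor
  · rintro ⟨hp, hU⟩
    by_contra hne
    refine hU ((contDiff_defFun hε hsep).exists_isEmbedding_zeroSet fun hd => hne ?_)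
    exact eq_tip_of_fderiv_eq_zero hε hsep hp hd
  · rintro ⟨v, hv, rfl⟩
    refine ⟨defFun_tip hε hsep hv, ?_⟩
    rintro ⟨U, hUo, hpU, hU⟩
    set N := M v hv with hN
    -- the two new roots over nearby abscissas belong to `U` and have the same projection
    have hcont : ∀ k : ℝ, Tendsto (fun r : ℝ => (v + N.σ * r, N.center + k * N.radius (v + N.σ * r)))
        (𝓝[>] 0) (𝓝 (v, N.center)) := fun k => by
      have h1 := N.continuous_radius
      have h2 : Continuous fun r : ℝ =>
          (v + N.σ * r, N.center + k * N.radius (v + N.σ * r)) := by fun_prop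
      have h3 := (h2.tendsto 0).mono_left (nhdsWithin_le_nhds (s := Ioi 0))
      simpa [N.radius_eq_zero (x := v) (by simp)] using h3
    obtain ⟨r, h1, h2, h3⟩ := ((hcont 1).eventually (hUo.mem_nhds hpU)).and
      (((hcont (-1)).eventually (hUo.mem_nhds hpU)).and
        (Ioo_mem_nhdsGT (show (0 : ℝ) < 2 * ε by linarith))) |>.exists
    have h4 : N.σ * (v + N.σ * r - v) = r := by
      rcases N.sign with h | h <;> rw [h] <;> ring
    have hpos := N.radius_pos (x := v + N.σ * r) (by rw [h4]; exact h3.1)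
    have hzero : ∀ k : ℝ, k ^ 2 = 1 →
        defFun L ε M (v + N.σ * r, N.center + k * N.radius (v + N.σ * r)) = 0 := fun k hk => by
      rw [defFun_of_near hsep hv (by
        rw [← sign_mul_abs N.sign, h4, abs_of_pos h3.1]; exact h3.2)]
      rw [← hN, N.factor_eq (by rw [h4]; exact h3.1.le), add_sub_cancel_left, mul_pow, hk]
      simp
    have h5 := @hU.injective ⟨_, h1, hzero 1 (by norm_num)⟩ ⟨_, h2, hzero (-1) (by norm_num)⟩ rfl
    have h6 := congrArg (fun q => q.1.2) h5
    simp only at h6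
    linarith

end GraphDiagram

namespace GraphDiagram

open ArcSystem

variable {ι : Type*} [Fintype ι] {G : GraphDiagram ι} {L : G.Levels} {ε : ℝ}
  {M : ∀ v ∈ G.X, VertexModel L ε v}

/-! ### The fibres of the domain -/

theorem VertexModel.neg_sign {v : ℝ} (N : VertexModel L ε v) : -N.σ = 1 ∨ -N.σ = -1 := by
  rcases N.sign with h | h <;> rw [h] <;> simp

/-- Near an end, the fibre of the domain consists of the intervals of the arcs that pass by, and of the
set where the factor of the vertex is not positive. -/
theorem defFun_nonpos_iff_of_isEnd (hε : 0 < ε) (hsep : G.Separated ε) {v : ℝ} (hv : v ∈ G.X)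
    {e : ι} (he : G.IsEnd v (M v hv).σ e) (hl : (M v hv).l = L.A e) (hu : (M v hv).u = L.B e)
    {x : ℝ} (hx : |x - v| < 2 * ε) (y : ℝ) : defFun L ε M (x, y) ≤ 0 ↔
      (∃ e' ∈ G.side v (-(M v hv).σ), y ∈ Icc (L.A e') (L.B e')) ∨ (M v hv).factor x y ≤ 0 := by
  set N := M v hv with hN
  rw [defFun_of_near hsep hv hx, ← hN,
    ← intervalPoly_nonpos_iff L.lt (L.disjoint_side hε hsep hv N.neg_sign)]
  by_cases hf : N.factor x y ≤ 0
  · have hy := N.mem_Icc_of_factor_nonpos hf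
    refine iff_of_true (mul_nonpos_of_nonneg_of_nonpos ?_ hf) (Or.inr hf)
    refine (intervalPoly_pos L.lt fun e' he' hy' => ?_).le
    have hne : e ≠ e' := by
      rintro rfl
      rcases mem_side.1 he' with h | h
      · rcases (he.1 e).2 rfl with ⟨-, h1⟩ | ⟨-, h1⟩
        · exact h.1.ne h1
        · exact h.2.ne' h1
      · exact he.2 e h
    have h1 : e ∈ G.side v N.σ := mem_side.2 (Or.inr ((he.1 e).2 rfl))
    have h2 : e' ∈ G.side v N.σ := by
      rw [mem_side] at he' ⊢
      exact Or.inl (he'.resolve_right (he.2 e'))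
    rw [hl, hu] at hy
    rcases L.disjoint_side hε hsep hv N.sign e h1 e' h2 hne with h | h
    · linarith [hy.2, hy'.1]
    · linarith [hy.1, hy'.2]
  · rw [or_iff_left hf]
    constructor
    · exact fun h => nonpos_of_mul_nonpos_left h (not_le.1 hf)
    · exact fun h => mul_nonpos_of_nonpos_of_nonneg h (not_le.1 hf).le

theorem IsFork.level_lt {ι : Type*} {G : GraphDiagram ι} {v σ : ℝ} {e₀ e₁ e₂ : ι}
    (L : G.Levels) (hf : G.IsFork v σ e₀ e₁ e₂) :
    L.A e₀ < L.B e₁ ∧ L.B e₁ < L.A e₂ ∧ L.A e₂ < L.B e₀ := by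
  obtain ⟨h1, h2⟩ := L.fork v σ e₀ e₁ e₂ hf
  rw [← h1, ← h2]
  exact ⟨L.lt e₁, L.lt_of_below _ _ hf.2.2, L.lt e₂⟩

/-- Near a fork, the fibre of the domain consists of the intervals present on the side of the stem,
without an open gap around the centre. -/
theorem defFun_nonpos_iff_of_isFork (hε : 0 < ε) (hsep : G.Separated ε) {v : ℝ} (hv : v ∈ G.X)
    {e₀ e₁ e₂ : ι} (hf : G.IsFork v (M v hv).σ e₀ e₁ e₂) (hl : (M v hv).l = L.B e₁)
    (hu : (M v hv).u = L.A e₂) {x : ℝ} (hx : |x - v| < 2 * ε) (y : ℝ) :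
    defFun L ε M (x, y) ≤ 0 ↔
      (∃ e' ∈ G.side v (-(M v hv).σ), y ∈ Icc (L.A e') (L.B e')) ∧
        ¬ |y - (M v hv).center| < (M v hv).radius x := by
  set N := M v hv with hN
  have h0 : e₀ ∈ G.side v (-N.σ) := mem_side.2 (Or.inr ((hf.1 e₀).2 rfl))
  obtain ⟨k1, k2, k3⟩ := IsFork.level_lt L hf
  rw [defFun_of_near hsep hv hx, ← hN, ← N.factor_neg_iff,
    ← intervalPoly_nonpos_iff L.lt (L.disjoint_side hε hsep hv N.neg_sign)]
  by_cases hle : N.factor x y ≤ 0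
  · have hy := N.mem_Icc_of_factor_nonpos hle
    rw [hl, hu] at hy
    have hneg := intervalPoly_neg L.lt (L.disjoint_side hε hsep hv N.neg_sign) h0
      (y := y) ⟨by linarith [hy.1], by linarith [hy.2]⟩
    constructor
    · exact fun h => ⟨hneg.le, fun h' => h.not_gt (mul_pos_of_neg_of_neg hneg h')⟩
    · exact fun h => mul_nonpos_of_nonpos_of_nonneg h.1 (not_lt.1 h.2)
  · constructor
    · exact fun h => ⟨nonpos_of_mul_nonpos_left h (not_le.1 hle), fun h' => hle h'.le⟩
    · exact fun h => mul_nonpos_of_nonpos_of_nonneg h.1 (not_le.1 hle).le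

theorem Separated.mem_Icc_of_mem_side (hsep : G.Separated ε) {v σ x : ℝ} (hv : v ∈ G.X)
    (hσ : σ = 1 ∨ σ = -1) {e : ι} (he : e ∈ G.side v σ) (h0 : 0 ≤ σ * (x - v))
    (h1 : σ * (x - v) < 2 * ε) : x ∈ Icc (G.s e) (G.t e) := by
  rcases h0.eq_or_lt with h | h
  · have hxv : x = v := by
      rcases hσ with h2 | h2 <;> rw [h2] at h <;> linarith
    rw [hxv]
    rcases mem_side.1 he with h2 | h2
    · exact ⟨h2.1.le, h2.2.le⟩
    · rcases h2 with ⟨-, rfl⟩ | ⟨-, rfl⟩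
      · exact ⟨le_rfl, (G.s_lt_t e).le⟩
      · exact ⟨(G.s_lt_t e).le, le_rfl⟩
  · rw [← hsep.arcsOver_eq_side hv hσ h h1, mem_arcsOver] at he
    exact ⟨he.1.le, he.2.le⟩

theorem mem_arcsOver_of_mem_Icc {x : ℝ} (hx : x ∉ G.X) {e : ι} (he : x ∈ Icc (G.s e) (G.t e)) :
    e ∈ G.arcsOver x :=
  mem_arcsOver.2 ⟨lt_of_le_of_ne he.1 fun h => hx (h ▸ G.s_mem e),
    lt_of_le_of_ne he.2 fun h => hx (h ▸ G.t_mem e)⟩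

/-- An arc over a point close to `v` is present on the side of this point. -/
theorem Separated.exists_mem_side (hε : 0 < ε) (hsep : G.Separated ε) {v x : ℝ} (hv : v ∈ G.X)
    (hx : |x - v| < 2 * ε) {e : ι} (he : x ∈ Icc (G.s e) (G.t e)) :
    ∃ τ : ℝ, (τ = 1 ∨ τ = -1) ∧ 0 ≤ τ * (x - v) ∧ e ∈ G.side v τ := by
  have hxX : x ≠ v → x ∉ G.X := fun hne hxX => by
    have := hsep x hxX v hv hne
    linarith
  have hx' := abs_lt.1 hx
  rcases lt_trichotomy x v with h | h | h
  · refine ⟨-1, Or.inr rfl, by linarith, ?_⟩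
    rw [← hsep.arcsOver_eq_side hv (Or.inr rfl) (x := x) (by linarith) (by linarith)]
    exact mem_arcsOver_of_mem_Icc (hxX h.ne) he
  · rw [h] at he
    rcases he.1.eq_or_lt with h1 | h1
    · exact ⟨1, Or.inl rfl, by rw [h]; simp, mem_side.2 (Or.inr (Or.inl ⟨rfl, h1⟩))⟩
    · rcases he.2.eq_or_lt with h2 | h2
      · exact ⟨-1, Or.inr rfl, by rw [h]; simp, mem_side.2 (Or.inr (Or.inr ⟨rfl, h2.symm⟩))⟩
      · exact ⟨1, Or.inl rfl, by rw [h]; simp, mem_side.2 (Or.inl ⟨h1, h2⟩)⟩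
  · refine ⟨1, Or.inl rfl, by linarith, ?_⟩
    rw [← hsep.arcsOver_eq_side hv (Or.inl rfl) (x := x) (by linarith) (by linarith)]
    exact mem_arcsOver_of_mem_Icc (hxX h.ne') he

theorem notMem_of_far {ι : Type*} {G : GraphDiagram ι} (hε : 0 < ε) {x : ℝ}
    (hx : ∀ v ∈ G.X, ε < |x - v|) : x ∉ G.X := fun h => by
  have := hx x h
  rw [sub_self, abs_zero] at this
  exact this.not_gt hε

theorem defFun_nonpos_iff_of_far (hε : 0 < ε) (hsep : G.Separated ε) {x : ℝ}
    (hx : ∀ v ∈ G.X, ε < |x - v|) (y : ℝ) :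
    defFun L ε M (x, y) ≤ 0 ↔ ∃ e ∈ G.arcsOver x, y ∈ Icc (L.A e) (L.B e) := by
  rw [defFun_of_far hε hsep fun v hv => (hx v hv).le,
    intervalPoly_nonpos_iff L.lt L.disjoint_arcsOver]

/-- Every point of the domain is joined, inside the fibre of the domain, to a point of the interval of
an arc over its abscissa. -/
theorem exists_arc_of_defFun_nonpos (hε : 0 < ε) (hsep : G.Separated ε) {x y : ℝ}
    (h : defFun L ε M (x, y) ≤ 0) : ∃ e, x ∈ Icc (G.s e) (G.t e) ∧
      ∃ y' ∈ Icc (L.A e) (L.B e), ∀ z ∈ uIcc y y', defFun L ε M (x, z) ≤ 0 := by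
  have hself : ∀ z ∈ uIcc y y, defFun L ε M (x, z) ≤ 0 := by
    simpa using h
  rcases near_or_far G hε x with ⟨v, hv, hx⟩ | hx
  · have hx' := hx
    rw [← sign_mul_abs (M v hv).sign, abs_lt] at hx'
    have hthrough : ∀ e, G.s e < v ∧ v < G.t e → x ∈ Icc (G.s e) (G.t e) := fun e he => by
      rcases le_or_gt 0 ((M v hv).σ * (x - v)) with h0 | h0
      · exact hsep.mem_Icc_of_mem_side hv (M v hv).sign (mem_side.2 (Or.inl he)) h0 hx'.2
      · exact hsep.mem_Icc_of_mem_side hv (M v hv).neg_sign (mem_side.2 (Or.inl he))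
          (by linarith) (by linarith)
    rcases (M v hv).shape with ⟨e, he, hl, hu⟩ | ⟨e₀, e₁, e₂, hf, hl, hu⟩
    · rcases (defFun_nonpos_iff_of_isEnd hε hsep hv he hl hu hx y).1 h with ⟨e', he', hy⟩ | hy
      · exact ⟨e', hthrough e' ((mem_side.1 he').resolve_right (he.2 e')), y, hy, hself⟩
      · refine ⟨e, hsep.mem_Icc_of_mem_side hv (M v hv).sign
          (mem_side.2 (Or.inr ((he.1 e).2 rfl))) ((M v hv).factor_nonpos_iff.1 hy).1 hx'.2, y, ?_,
          hself⟩
        rw [← hl, ← hu]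
        exact (M v hv).mem_Icc_of_factor_nonpos hy
    · have hD := defFun_nonpos_iff_of_isFork hε hsep hv hf hl hu hx
      obtain ⟨⟨e', he', hy⟩, hr⟩ := (hD y).1 h
      obtain ⟨hA, hB⟩ := L.fork _ _ _ _ _ hf
      rcases mem_side.1 he' with he'' | he''
      · exact ⟨e', hthrough e' he'', y, hy, hself⟩
      · obtain rfl := (hf.1 e').1 he''
        rcases le_or_gt ((M v hv).σ * (x - v)) 0 with h0 | h0
        · exact ⟨e', hsep.mem_Icc_of_mem_side hv (M v hv).neg_sign he' (by linarith) (by linarith),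
            y, hy, hself⟩
        · -- a point above the gap is joined to the upper end of the interval of the upper branch, and
          -- a point below the gap to the lower end of that of the lower branch
          rcases le_abs.1 (not_lt.1 hr) with h1 | h1
          · refine ⟨e₂, hsep.mem_Icc_of_mem_side hv (M v hv).sign
              (mem_side.2 (Or.inr ((hf.2.1 e₂).2 (Or.inr rfl)))) h0.le hx'.2, L.B e₂,
              ⟨(L.lt e₂).le, le_rfl⟩, fun z hz => ?_⟩
            rw [hB, uIcc_of_le hy.2] at hz
            refine (hD z).2 ⟨⟨e', he', hy.1.trans hz.1, hz.2⟩, not_lt.2 (le_abs.2 (Or.inl ?_))⟩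
            linarith [hz.1]
          · refine ⟨e₁, hsep.mem_Icc_of_mem_side hv (M v hv).sign
              (mem_side.2 (Or.inr ((hf.2.1 e₁).2 (Or.inl rfl)))) h0.le hx'.2, L.A e₁,
              ⟨le_rfl, (L.lt e₁).le⟩, fun z hz => ?_⟩
            rw [hA, uIcc_of_ge hy.1] at hz
            refine (hD z).2 ⟨⟨e', he', hz.1, hz.2.trans hy.2⟩, not_lt.2 (le_abs.2 (Or.inr ?_))⟩
            linarith [hz.2]
  · obtain ⟨e, he, hy⟩ := (defFun_nonpos_iff_of_far hε hsep hx y).1 h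
    rw [mem_arcsOver] at he
    exact ⟨e, ⟨he.1.le, he.2.le⟩, y, hy, hself⟩

theorem intervalPoly_left {ι : Type*} {G : GraphDiagram ι} {L : G.Levels} {S : Finset ι}
    {e : ι} (he : e ∈ S) :
    intervalPoly L.A L.B S (L.A e) = 0 :=
  Finset.prod_eq_zero he (by simp)

theorem intervalPoly_right {ι : Type*} {G : GraphDiagram ι} {L : G.Levels} {S : Finset ι}
    {e : ι} (he : e ∈ S) :
    intervalPoly L.A L.B S (L.B e) = 0 :=
  Finset.prod_eq_zero he (by simp)

/-- Over every abscissa of an arc, the domain meets the interval of the arc. -/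
theorem exists_defFun_nonpos (hε : 0 < ε) (hsep : G.Separated ε) {x : ℝ} {e : ι}
    (he : x ∈ Icc (G.s e) (G.t e)) :
    ∃ y ∈ Icc (L.A e) (L.B e), defFun L ε M (x, y) ≤ 0 := by
  have hA : L.A e ∈ Icc (L.A e) (L.B e) := ⟨le_rfl, (L.lt e).le⟩
  have hB : L.B e ∈ Icc (L.A e) (L.B e) := ⟨(L.lt e).le, le_rfl⟩
  rcases near_or_far G hε x with ⟨v, hv, hx⟩ | hx
  · obtain ⟨τ, hτ, h0, hτe⟩ := hsep.exists_mem_side hε hv hx he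
    have hmain : e ∈ G.side v (-(M v hv).σ) →
        ∃ y ∈ Icc (L.A e) (L.B e), defFun L ε M (x, y) ≤ 0 := fun h =>
      ⟨L.A e, hA, by rw [defFun_of_near hsep hv hx, intervalPoly_left h, zero_mul]⟩
    rcases eq_or_eq_neg_of_sign (M v hv).sign hτ with rfl | rfl
    · rcases mem_side.1 hτe with h1 | h1
      · exact hmain (mem_side.2 (Or.inl h1))
      · rcases (M v hv).shape with ⟨e', he', hl, hu⟩ | ⟨e₀, e₁, e₂, hf, hl, hu⟩
        · obtain rfl := (he'.1 e).1 h1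
          have h2 := (M v hv).center_mem
          rw [hl, hu] at h2
          refine ⟨_, h2, (defFun_nonpos_iff_of_isEnd hε hsep hv he' hl hu hx _).2 (Or.inr ?_)⟩
          rw [(M v hv).factor_nonpos_iff, sub_self, abs_zero]
          exact ⟨h0, (M v hv).radius_nonneg x⟩
        · have h2 : e₀ ∈ G.side v (-(M v hv).σ) := mem_side.2 (Or.inr ((hf.1 e₀).2 rfl))
          obtain ⟨hA', hB'⟩ := L.fork _ _ _ _ _ hf
          rcases (hf.2.1 e).1 h1 with rfl | rfl
          · exact ⟨L.A e, hA, by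
              rw [defFun_of_near hsep hv hx, hA', intervalPoly_left h2, zero_mul]⟩
          · exact ⟨L.B e, hB, by
              rw [defFun_of_near hsep hv hx, hB', intervalPoly_right h2, zero_mul]⟩
    · exact hmain hτe
  · exact ⟨L.A e, hA, (defFun_nonpos_iff_of_far hε hsep hx _).2
      ⟨e, mem_arcsOver_of_mem_Icc (notMem_of_far hε hx) he, hA⟩⟩

theorem exists_mem_Icc_of_defFun_nonpos (hε : 0 < ε) (hsep : G.Separated ε) {x y : ℝ}
    (h : defFun L ε M (x, y) ≤ 0) : ∃ e, y ∈ Icc (L.A e) (L.B e) := by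
  rcases near_or_far G hε x with ⟨v, hv, hx⟩ | hx
  · rcases (M v hv).shape with ⟨e, he, hl, hu⟩ | ⟨e₀, e₁, e₂, hf, hl, hu⟩
    · rcases (defFun_nonpos_iff_of_isEnd hε hsep hv he hl hu hx y).1 h with ⟨e', -, hy⟩ | hy
      · exact ⟨e', hy⟩
      · refine ⟨e, ?_⟩
        rw [← hl, ← hu]
        exact (M v hv).mem_Icc_of_factor_nonpos hy
    · obtain ⟨⟨e', -, hy⟩, -⟩ := (defFun_nonpos_iff_of_isFork hε hsep hv hf hl hu hx y).1 h
      exact ⟨e', hy⟩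
  · obtain ⟨e, -, hy⟩ := (defFun_nonpos_iff_of_far hε hsep hx y).1 h
    exact ⟨e, hy⟩

theorem isCompact_defFun_nonpos (hε : 0 < ε) (hsep : G.Separated ε) :
    IsCompact {p | defFun L ε M p ≤ 0} := by
  refine IsCompact.of_isClosed_subset
    (isCompact_iUnion (fun e => isCompact_Icc (a := G.s e) (b := G.t e)) |>.prod
      (isCompact_iUnion fun e => isCompact_Icc (a := L.A e) (b := L.B e)))
    (isClosed_le (contDiff_defFun hε hsep).continuous continuous_const) ?_
  rintro ⟨x, y⟩ h
  obtain ⟨e, he, -⟩ := exists_arc_of_defFun_nonpos hε hsep h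
  obtain ⟨e', he'⟩ := exists_mem_Icc_of_defFun_nonpos hε hsep h
  exact ⟨mem_iUnion.2 ⟨e, he⟩, mem_iUnion.2 ⟨e', he'⟩⟩

theorem isDomainOfFiniteType_defFun (hε : 0 < ε) (hsep : G.Separated ε) :
    IsDomainOfFiniteType Prod.fst {p | defFun L ε M p ≤ 0} {p | defFun L ε M p = 0} where
  isClosed := (isCompact_defFun_nonpos hε hsep).isClosed
  surface := (contDiff_defFun hε hsep).isSurfaceWithBoundary (fderiv_defFun_ne_zero hε hsep)
  nonempty_boundary := by
    obtain ⟨v, hv⟩ := G.nonempty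
    exact ⟨_, defFun_tip hε hsep hv⟩
  proper := by
    have := isCompact_iff_compactSpace.1 (isCompact_defFun_nonpos (M := M) hε hsep)
    exact (continuous_fst.comp continuous_subtype_val).isProperMap
  finite_critical := by
    rw [topCriticalSet_defFun hε hsep]
    refine (finite_range fun v : G.X => ((v : ℝ), (M v v.2).center)).subset ?_
    rintro p ⟨v, hv, rfl⟩
    exact ⟨⟨v, hv⟩, rfl⟩

end GraphDiagram

/-! ### Monotone functions with prescribed plateaus -/

/-- The truncation of `u` to `[-r, r]`. -/
noncomputable def clamp (r u : ℝ) : ℝ := max (-r) (min r u)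

theorem clamp_mono (r : ℝ) : Monotone (clamp r) := fun _ _ h =>
  max_le_max le_rfl (min_le_min le_rfl h)

theorem clamp_of_le {r u : ℝ} (h : |u| ≤ r) : clamp r u = u := by
  have := abs_le.1 h
  rw [clamp, min_eq_right this.2, max_eq_right this.1]

theorem clamp_of_ge {r u : ℝ} (hr : 0 ≤ r) (h : r ≤ u) : clamp r u = r := by
  rw [clamp, min_eq_left h, max_eq_right (by linarith)]

theorem clamp_of_le_neg {r u : ℝ} (hr : 0 ≤ r) (h : u ≤ -r) : clamp r u = -r := by
  rw [clamp, min_eq_right (by linarith), max_eq_left h]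

theorem abs_clamp_le {r : ℝ} (hr : 0 ≤ r) (u : ℝ) : |clamp r u| ≤ r :=
  abs_le.2 ⟨le_max_left _ _, max_le (by linarith) (min_le_left _ _)⟩

theorem sub_clamp_mono (r : ℝ) : Monotone fun u => u - clamp r u := by
  intro u u' h
  simp only [clamp]
  rcases le_total r u with h1 | h1 <;> rcases le_total r u' with h2 | h2 <;>
    simp only [h1, h2, min_eq_left, min_eq_right] <;>
    rcases le_total (-r) u with h3 | h3 <;> rcases le_total (-r) u' with h4 | h4 <;>
    rcases le_total (-r) r with h5 | h5 <;>
    simp only [h3, h4, h5, max_eq_left, max_eq_right] <;> linarith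

theorem abs_le_of_sub_clamp_eq {r u u' : ℝ} (hr : 0 ≤ r) (h : u < u')
    (he : u - clamp r u = u' - clamp r u') : |u| ≤ r ∧ |u'| ≤ r := by
  rcases le_or_gt r u with h1 | h1
  · rw [clamp_of_ge hr h1, clamp_of_ge hr (h1.trans h.le)] at he
    linarith
  rcases le_or_gt u' (-r) with h2 | h2
  · rw [clamp_of_le_neg hr h2, clamp_of_le_neg hr (h.le.trans h2)] at he
    linarith
  rcases le_or_gt u (-r) with h3 | h3
  · rw [clamp_of_le_neg hr h3] at he
    rcases le_or_gt r u' with h4 | h4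
    · rw [clamp_of_ge hr h4] at he
      rw [abs_le, abs_le]
      refine ⟨⟨?_, ?_⟩, ?_, ?_⟩ <;> linarith
    · have : |u'| ≤ r := abs_le.2 ⟨h2.le, h4.le⟩
      rw [clamp_of_le this] at he
      exact ⟨abs_le.2 ⟨by linarith, by linarith⟩, this⟩
  · have h5 : |u| ≤ r := abs_le.2 ⟨h3.le, h1.le⟩
    rw [clamp_of_le h5] at he
    rcases le_or_gt r u' with h4 | h4
    · rw [clamp_of_ge hr h4] at he
      exact ⟨h5, abs_le.2 ⟨by linarith, by linarith⟩⟩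
    · exact ⟨h5, abs_le.2 ⟨h2.le, h4.le⟩⟩

theorem le_neg_or_le_of_clamp_eq {r u u' : ℝ} (hr : 0 < r) (h : u < u')
    (he : clamp r u = clamp r u') : u' ≤ -r ∨ r ≤ u := by
  by_contra! hcon
  rcases le_or_gt u (-r) with h1 | h1
  · rw [clamp_of_le_neg hr.le h1] at he
    have : -r < clamp r u' := lt_max_of_lt_right (lt_min (by linarith) hcon.1)
    exact this.ne he
  · rw [clamp_of_le (abs_le.2 ⟨h1.le, hcon.2.le⟩)] at he
    have : u < clamp r u' := lt_max_of_lt_right (lt_min hcon.2 h)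
    exact this.ne he

section Plateau

variable {ι : Type*} {a b z : ι → ℝ}

/-- A monotone function at bounded distance from the identity whose non-trivial fibres are the intervals
`[a e, b e]`, `e ∈ S`, with values `z e`. The values have to be ordered in the same way as the
intervals; the intervals are inserted one by one from left to right. -/
theorem exists_plateau_function (S : Finset ι) (hab : ∀ e ∈ S, a e ≤ b e)
    (hS : ∀ e ∈ S, ∀ e' ∈ S, e ≠ e' → (b e < a e' ∧ z e < z e') ∨ (b e' < a e ∧ z e' < z e)) :
    ∃ g : ℝ → ℝ, Continuous g ∧ Monotone g ∧ (∃ C, ∀ y, |g y - y| ≤ C) ∧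
      (∀ e ∈ S, ∀ y ∈ Icc (a e) (b e), g y = z e) ∧
      ∀ y y', y < y' → g y = g y' → ∃ e ∈ S, y ∈ Icc (a e) (b e) ∧ y' ∈ Icc (a e) (b e) := by
  classical
  induction S using Finset.induction_on_max_value z with
  | empty =>
    refine ⟨id, continuous_id, monotone_id, ⟨0, by simp⟩, by simp, fun y y' h h' => ?_⟩
    exact absurd h' h.ne
  | insert e S heS hmax ih =>
    obtain ⟨g, hgc, hgm, ⟨C, hC⟩, hgz, hgs⟩ := ih
      (fun e' he' => hab e' (Finset.mem_insert_of_mem he'))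
      (fun e' he' e'' he'' => hS e' (Finset.mem_insert_of_mem he') e''
        (Finset.mem_insert_of_mem he''))
    have hlt : ∀ e' ∈ S, b e' < a e ∧ z e' < z e := fun e' he' => by
      have hne : e' ≠ e := fun h => heS (h ▸ he')
      rcases hS e' (Finset.mem_insert_of_mem he') e (Finset.mem_insert_self _ _) hne with h | h
      · exact h
      · exact absurd (hmax e' he') h.2.not_ge
    obtain ⟨β, hβ1, hβ2, hβ3⟩ : ∃ β, (∀ e' ∈ S, b e' ≤ β) ∧ β < a e ∧ g β < z e := by
      rcases S.eq_empty_or_nonempty with rfl | hne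
      · refine ⟨min (a e) (z e - C) - 1, by simp, ?_, ?_⟩
        · linarith [min_le_left (a e) (z e - C)]
        · have := (abs_le.1 (hC (min (a e) (z e - C) - 1))).2
          linarith [min_le_right (a e) (z e - C)]
      · obtain ⟨e', he', hmax'⟩ := S.exists_max_image b hne
        refine ⟨b e', hmax', (hlt e' he').1, ?_⟩
        rw [hgz e' he' _ ⟨hab e' (Finset.mem_insert_of_mem he'), le_rfl⟩]
        exact (hlt e' he').2
    have hae : a e ≤ b e := hab e (Finset.mem_insert_self _ _)
    have hβ : 0 < a e - β := sub_pos.2 hβ2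
    have hz : 0 < z e - g β := sub_pos.2 hβ3
    -- the affine interpolation between `β` and `a e`
    let c : ℝ → ℝ := fun y => max 0 (min 1 ((y - β) / (a e - β)))
    have hc0 : ∀ y ≤ β, c y = 0 := fun y hy =>
      max_eq_left ((min_le_right _ _).trans (div_nonpos_of_nonpos_of_nonneg (by linarith) hβ.le))
    have hc1 : ∀ y, a e ≤ y → c y = 1 := fun y hy => by
      have : 1 ≤ (y - β) / (a e - β) := by
        rw [le_div_iff₀ hβ]
        linarith
      simp [c, min_eq_left this]
    have hcm : ∀ y, β ≤ y → y ≤ a e → c y = (y - β) / (a e - β) := fun y h1 h2 => by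
      have h3 : 0 ≤ (y - β) / (a e - β) := div_nonneg (by linarith) hβ.le
      have h4 : (y - β) / (a e - β) ≤ 1 := by
        rw [div_le_one hβ]
        linarith
      simp only [c]
      rw [min_eq_right h4, max_eq_right h3]
    have hcmono : Monotone c := fun y y' h =>
      max_le_max le_rfl (min_le_min le_rfl (div_le_div_of_nonneg_right (by linarith) hβ.le))
    have hcc : Continuous c := by
      simp only [c]
      fun_prop
    have hcr : ∀ y, 0 ≤ c y ∧ c y ≤ 1 := fun y =>
      ⟨le_max_left _ _, max_le zero_le_one (min_le_left _ _)⟩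
    have hm1 : Monotone fun y => g (min y β) := fun y y' h => hgm (min_le_min h le_rfl)
    have hm2 : Monotone fun y => (z e - g β) * c y := fun y y' h =>
      mul_le_mul_of_nonneg_left (hcmono h) hz.le
    have hm3 : Monotone fun y => max (y - b e) 0 := fun y y' h =>
      max_le_max (by linarith) le_rfl
    refine ⟨fun y => g (min y β) + (z e - g β) * c y + max (y - b e) 0, by fun_prop,
      (hm1.add hm2).add hm3, ⟨C + |g β| + (z e - g β) + |b e| + |β|, fun y => ?_⟩, ?_, ?_⟩
    · have k1 := neg_abs_le (g β)
      have k2 := le_abs_self (g β)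
      have k3 := neg_abs_le (b e)
      have k4 := le_abs_self (b e)
      have k5 := neg_abs_le β
      have k6 := le_abs_self β
      have hC0 : 0 ≤ C := (abs_nonneg _).trans (hC 0)
      rcases le_total y β with h | h
      · beta_reduce
        rw [min_eq_left h, hc0 y h, max_eq_right (by linarith)]
        have := abs_le.1 (hC y)
        exact abs_le.2 ⟨by linarith, by linarith⟩
      · have h1 := mul_nonneg hz.le (hcr y).1
        have h2 := mul_le_of_le_one_right hz.le (hcr y).2
        beta_reduce
        rw [min_eq_right h]
        rcases le_total (y - b e) 0 with h3 | h3
        · rw [max_eq_right h3]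
          exact abs_le.2 ⟨by linarith, by linarith⟩
        · rw [max_eq_left h3]
          exact abs_le.2 ⟨by linarith, by linarith⟩
    · intro e' he' y hy
      rcases Finset.mem_insert.1 he' with rfl | he'
      · beta_reduce
        rw [min_eq_right (by linarith [hy.1]), hc1 y hy.1, max_eq_right (by linarith [hy.2])]
        ring
      · have h1 := hβ1 e' he'
        have h2 : y ≤ β := hy.2.trans h1
        beta_reduce
        rw [min_eq_left h2, hc0 y h2, max_eq_right (by linarith), hgz e' he' y hy]
        ring
    · intro y y' h heq
      beta_reduce at heq
      have h1 := hm1 h.le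
      have h2 := hm2 h.le
      have h3 := hm3 h.le
      beta_reduce at h1 h2 h3
      have e1 : g (min y β) = g (min y' β) := by linarith
      have e2 : c y = c y' := mul_left_cancel₀ hz.ne' (by linarith)
      have e3 : max (y - b e) 0 = max (y' - b e) 0 := by linarith
      rcases lt_or_ge y β with hy | hy
      · rcases le_or_gt y' β with hy' | hy'
        · rw [min_eq_left hy.le, min_eq_left hy'] at e1
          obtain ⟨e', he', h4⟩ := hgs y y' h e1
          exact ⟨e', Finset.mem_insert_of_mem he', h4⟩
        · rw [hc0 y hy.le] at e2
          rcases le_total y' (a e) with h4 | h4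
          · rw [hcm y' hy'.le h4] at e2
            exact absurd e2 (div_pos (by linarith) hβ).ne
          · rw [hc1 y' h4] at e2
            exact absurd e2 zero_ne_one
      · refine ⟨e, Finset.mem_insert_self _ _, ?_⟩
        have hay : a e ≤ y := by
          by_contra hlt'
          rw [not_le] at hlt'
          rw [hcm y hy hlt'.le] at e2
          have h5 : (y - β) / (a e - β) < 1 := by
            rw [div_lt_one hβ]
            linarith
          rcases le_total y' (a e) with h4 | h4
          · rw [hcm y' (hy.trans h.le) h4, div_left_inj' hβ.ne'] at e2
            linarith
          · rw [hc1 y' h4] at e2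
            linarith
        have hyb : y' ≤ b e := by
          by_contra hlt'
          rw [not_le] at hlt'
          rw [max_eq_left (by linarith : 0 ≤ y' - b e)] at e3
          rcases le_total (y - b e) 0 with h4 | h4
          · rw [max_eq_right h4] at e3
            linarith
          · rw [max_eq_left h4] at e3
            linarith
        exact ⟨⟨hay, h.le.trans hyb⟩, hay.trans h.le, hyb⟩

/-- The function of the line that translates by `δ e` near `z e`, for `e ∈ S`. -/
noncomputable def adjust (S : Finset ι) (z : ι → ℝ) (d : ℝ) (δ : ι → ℝ) (w : ℝ) : ℝ :=
  w + ∑ e ∈ S, δ e * max 0 (min 1 (2 - 2 * |(w - z e) / d|))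

theorem adjust_eq {S : Finset ι} {d : ℝ} (hd : 0 < d) {δ : ι → ℝ}
    (hz : ∀ e ∈ S, ∀ e' ∈ S, e ≠ e' → 2 * d ≤ |z e - z e'|) {e : ι} (he : e ∈ S) {w : ℝ}
    (hw : |w - z e| ≤ d / 2) : adjust S z d δ w = w + δ e := by
  rw [adjust, Finset.sum_eq_single_of_mem e he]
  · have : |(w - z e) / d| ≤ 1 / 2 := by
      rw [abs_div, abs_of_pos hd, div_le_iff₀ hd]
      linarith
    rw [min_eq_left (by linarith), max_eq_right zero_le_one, mul_one]
  · intro e' he' hne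
    have h1 := hz e' he' e he hne
    have h2 := abs_sub_le (z e') w (z e)
    rw [abs_sub_comm (z e') w] at h2
    have : 1 ≤ |(w - z e') / d| := by
      rw [abs_div, abs_of_pos hd, le_div_iff₀ hd]
      linarith
    rw [max_eq_left ((min_le_right _ _).trans (by linarith)), mul_zero]

theorem abs_adjust_sub_le {S : Finset ι} {d η : ℝ} {δ : ι → ℝ} (hδ : ∀ e ∈ S, |δ e| ≤ η) (w : ℝ) :
    |adjust S z d δ w - w| ≤ S.card * η := by
  rw [adjust, add_sub_cancel_left, ← nsmul_eq_mul]
  refine (Finset.abs_sum_le_sum_abs _ _).trans (Finset.sum_le_card_nsmul _ _ _ fun e he => ?_)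
  rw [abs_mul]
  have h1 : |max 0 (min 1 (2 - 2 * |(w - z e) / d|))| ≤ 1 := by
    rw [abs_of_nonneg (le_max_left _ _)]
    exact max_le zero_le_one (min_le_left _ _)
  exact (mul_le_of_le_one_right (abs_nonneg _) h1).trans (hδ e he)

theorem adjust_strictMono {S : Finset ι} {d η : ℝ} (hd : 0 < d) {δ : ι → ℝ}
    (hδ : ∀ e ∈ S, |δ e| ≤ η) (hη : S.card * (η * (2 / d)) < 1) : StrictMono (adjust S z d δ) := by
  intro w w' h
  have h0 : 0 < w' - w := sub_pos.2 h
  have key : ∀ e ∈ S, |δ e * max 0 (min 1 (2 - 2 * |(w - z e) / d|)) -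
      δ e * max 0 (min 1 (2 - 2 * |(w' - z e) / d|))| ≤ η * (2 / d) * (w' - w) := fun e he => by
    rw [← mul_sub, abs_mul, mul_assoc]
    refine mul_le_mul (hδ e he) ?_ (abs_nonneg _) ((abs_nonneg _).trans (hδ e he))
    have h1 := abs_max_sub_max_le_abs (min 1 (2 - 2 * |(w - z e) / d|))
      (min 1 (2 - 2 * |(w' - z e) / d|)) 0
    rw [max_comm _ 0, max_comm _ 0] at h1
    have h2 := abs_min_sub_min_le_max 1 (2 - 2 * |(w - z e) / d|) 1 (2 - 2 * |(w' - z e) / d|)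
    rw [sub_self, abs_zero, max_eq_right (abs_nonneg _)] at h2
    refine h1.trans (h2.trans ?_)
    rw [show 2 - 2 * |(w - z e) / d| - (2 - 2 * |(w' - z e) / d|) =
      2 * (|(w' - z e) / d| - |(w - z e) / d|) by ring, abs_mul, abs_two]
    have h3 : |(|(w' - z e) / d| - |(w - z e) / d|)| ≤ (w' - w) / d := by
      have h4 := abs_abs_sub_abs_le ((w' - z e) / d) ((w - z e) / d)
      rwa [← sub_div, sub_sub_sub_cancel_right, abs_of_pos (div_pos h0 hd)] at h4
    calc 2 * _ ≤ 2 * ((w' - w) / d) := by linarith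
      _ = 2 / d * (w' - w) := by ring
  have h1 := (Finset.abs_sum_le_sum_abs (fun e => δ e * max 0 (min 1 (2 - 2 * |(w - z e) / d|)) -
      δ e * max 0 (min 1 (2 - 2 * |(w' - z e) / d|))) S).trans
        (Finset.sum_le_card_nsmul _ _ _ key)
  rw [Finset.sum_sub_distrib, nsmul_eq_mul, ← mul_assoc] at h1
  have h2 : S.card * (η * (2 / d)) * (w' - w) < w' - w := mul_lt_of_lt_one_left h0 hη
  have h3 := (abs_le.1 h1).2
  rw [adjust, adjust]
  linarith

theorem continuous_adjust {X : Type*} [TopologicalSpace X] {S : Finset ι} {z : ι → ℝ} {d : ℝ}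
    {δ : X → ι → ℝ} {w : X → ℝ} (hδ : ∀ e, Continuous fun p => δ p e) (hw : Continuous w) :
    Continuous fun p => adjust S z d (δ p) (w p) := by
  unfold adjust
  refine hw.add (continuous_finsetSum _ fun e _ => (hδ e).mul ?_)
  fun_prop

/-- A plateau function `g` that remains one after small changes: a monotone function `k`
may be added to it, and the values `z e` of the plateaus may be changed by `δ e`. -/
structure CollapseFamily (S : Finset ι) (a b z : ι → ℝ) where
  g : ℝ → ℝ
  d : ℝ
  η : ℝ
  continuous_g : Continuous g
  η_pos : 0 < η
  monotone : ∀ (δ : ι → ℝ) (k : ℝ → ℝ), (∀ e ∈ S, |δ e| ≤ η) → Monotone k →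
    Monotone fun y => adjust S z d δ (g y + k y)
  bounded : ∀ (δ : ι → ℝ) (k : ℝ → ℝ), (∀ e ∈ S, |δ e| ≤ η) → (∀ y, |k y| ≤ η) →
    ∃ C, ∀ y, |adjust S z d δ (g y + k y) - y| ≤ C
  eq_on : ∀ (δ : ι → ℝ) (k : ℝ → ℝ), (∀ y, |k y| ≤ η) → ∀ e ∈ S, ∀ y ∈ Icc (a e) (b e),
    adjust S z d δ (g y + k y) = z e + k y + δ e
  plateau : ∀ (δ : ι → ℝ) (k : ℝ → ℝ), (∀ e ∈ S, |δ e| ≤ η) → Monotone k → ∀ y y', y < y' →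
    adjust S z d δ (g y + k y) = adjust S z d δ (g y' + k y') →
      k y = k y' ∧ ∃ e ∈ S, y ∈ Icc (a e) (b e) ∧ y' ∈ Icc (a e) (b e)

theorem exists_collapseFamily (S : Finset ι) (hab : ∀ e ∈ S, a e ≤ b e)
    (hS : ∀ e ∈ S, ∀ e' ∈ S, e ≠ e' → (b e < a e' ∧ z e < z e') ∨ (b e' < a e ∧ z e' < z e)) :
    Nonempty (CollapseFamily S a b z) := by
  obtain ⟨g, hgc, hgm, ⟨C, hC⟩, hgz, hgs⟩ := exists_plateau_function S hab hS
  obtain ⟨d, hd, hdz⟩ : ∃ d > 0, ∀ e ∈ S, ∀ e' ∈ S, e ≠ e' → 2 * d ≤ |z e - z e'| := by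
    have h1 : ∀ e ∈ S, ∀ e' ∈ S, ∀ᶠ d in 𝓝[>] (0 : ℝ), e ≠ e' → 2 * d ≤ |z e - z e'| := by
      intro e he e' he'
      by_cases hne : e = e'
      · exact Eventually.of_forall fun d h => absurd hne h
      · have hpos : 0 < |z e - z e'| := by
          refine abs_pos.2 (sub_ne_zero.2 ?_)
          rcases hS e he e' he' hne with h | h
          · exact h.2.ne
          · exact h.2.ne'
        filter_upwards [Ioo_mem_nhdsGT (half_pos hpos)] with d hd _
        linarith [hd.2]
    obtain ⟨d, hd1, hd2⟩ := (((Finset.eventually_all S).2 fun e he =>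
      (Finset.eventually_all S).2 fun e' he' => h1 e he e' he').and self_mem_nhdsWithin).exists
    exact ⟨d, hd2, hd1⟩
  have hcard : (0 : ℝ) ≤ S.card := Nat.cast_nonneg _
  have hη2 : d / (4 * (S.card + 1)) ≤ d / 2 :=
    div_le_div_of_nonneg_left hd.le (by norm_num) (by linarith)
  have hmono : ∀ δ : ι → ℝ, (∀ e ∈ S, |δ e| ≤ d / (4 * (S.card + 1))) →
      StrictMono (adjust S z d δ) := fun δ hδ => adjust_strictMono hd hδ (by
    rw [show S.card * (d / (4 * (S.card + 1)) * (2 / d)) = S.card / (2 * ((S.card : ℝ) + 1)) by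
      field_simp; ring, div_lt_one (by positivity)]
    linarith)
  refine ⟨⟨g, d, d / (4 * (S.card + 1)), hgc, by positivity,
    fun δ k hδ hk y y' h => (hmono δ hδ).monotone (add_le_add (hgm h) (hk h)),
    fun δ k hδ hkη => ⟨S.card * (d / (4 * (S.card + 1))) + d / (4 * (S.card + 1)) + C, fun y => ?_⟩,
    fun δ k hkη e he y hy => ?_, fun δ k hδ hk y y' h heq => ?_⟩⟩
  · have h1 := abs_le.1 (abs_adjust_sub_le (z := z) (d := d) hδ (g y + k y))
    have h2 := abs_le.1 (hkη y)
    have h3 := abs_le.1 (hC y)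
    exact abs_le.2 ⟨by linarith, by linarith⟩
  · rw [hgz e he y hy, adjust_eq hd hdz he]
    rw [add_sub_cancel_left]
    exact (hkη y).trans hη2
  · have h1 := (hmono δ hδ).injective heq
    have h2 := hgm h.le
    have h3 := hk h.le
    exact ⟨by linarith, hgs y y' h (by linarith)⟩

end Plateau

namespace GraphDiagram

open ArcSystem

/-! ### Fibrewise collapsing functions -/

variable {ι : Type*} [Fintype ι] {G : GraphDiagram ι} {L : G.Levels} {ε : ℝ}
  {M : ∀ v ∈ G.X, VertexModel L ε v}

variable (L ε M) in
/-- The function `h` collapses the vertical line of abscissa `x`: its non-trivial fibres are the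
components of the fibre of the domain, and each component is sent to the height of the
corresponding arc of the diagram. -/
structure IsCollapseAt (x : ℝ) (h : ℝ → ℝ) : Prop where
  monotone : Monotone h
  bounded : ∃ C, ∀ y, |h y - y| ≤ C
  eq_height : ∀ e, x ∈ Icc (G.s e) (G.t e) → ∀ y ∈ Icc (L.A e) (L.B e),
    defFun L ε M (x, y) ≤ 0 → h y = G.y e x
  eq_iff : ∀ y y', y < y' → (h y = h y' ↔ ∀ z ∈ Icc y y', defFun L ε M (x, z) ≤ 0)

theorem convex_isCollapseAt (x : ℝ) : Convex ℝ {h : C(ℝ, ℝ) | IsCollapseAt L ε M x h} := by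
  rintro h ⟨h1, ⟨C, h2⟩, h3, h4⟩ h' ⟨h1', ⟨C', h2'⟩, h3', h4'⟩ a b ha hb hab
  have happ : ∀ y, (a • h + b • h') y = a * h y + b * h' y := fun y => rfl
  refine ⟨fun y y' hy => ?_, ⟨a * C + b * C', fun y => ?_⟩, fun e he y hy hD => ?_,
    fun y y' hy => ⟨fun heq => ?_, fun hD => ?_⟩⟩
  · rw [happ, happ]
    exact add_le_add (mul_le_mul_of_nonneg_left (h1 hy) ha)
      (mul_le_mul_of_nonneg_left (h1' hy) hb)
  · rw [happ, show a * h y + b * h' y - y = a * (h y - y) + b * (h' y - y) by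
      linear_combination y * hab]
    refine (abs_add_le _ _).trans (add_le_add ?_ ?_)
    · rw [abs_mul, abs_of_nonneg ha]
      exact mul_le_mul_of_nonneg_left (h2 y) ha
    · rw [abs_mul, abs_of_nonneg hb]
      exact mul_le_mul_of_nonneg_left (h2' y) hb
  · rw [happ, h3 e he y hy hD, h3' e he y hy hD, ← add_mul, hab, one_mul]
  · rw [happ, happ] at heq
    have k1 := mul_le_mul_of_nonneg_left (h1 hy.le) ha
    have k2 := mul_le_mul_of_nonneg_left (h1' hy.le) hb
    rcases ha.eq_or_lt with h0 | h0
    · refine (h4' y y' hy).1 (mul_left_cancel₀ (?_ : b ≠ 0) (by linarith))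
      intro hb0
      linarith
    · exact (h4 y y' hy).1 (mul_left_cancel₀ h0.ne' (by linarith))
  · rw [happ, happ, (h4 y y' hy).2 hD, (h4' y y' hy).2 hD]

/-- A segment covered by finitely many disjoint closed intervals is contained in one of them. -/
theorem exists_interval_of_segment {ι : Type*} {S : Finset ι} {a b : ι → ℝ}
    (hS : ∀ e ∈ S, ∀ e' ∈ S, e ≠ e' → b e < a e' ∨ b e' < a e) {y y' : ℝ} (hy : y ≤ y')
    (h : ∀ w ∈ Icc y y', ∃ e ∈ S, w ∈ Icc (a e) (b e)) :
    ∃ e ∈ S, y ∈ Icc (a e) (b e) ∧ y' ∈ Icc (a e) (b e) := by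
  obtain ⟨e, he, hye⟩ := h y ⟨le_rfl, hy⟩
  refine ⟨e, he, hye, hye.1.trans hy, ?_⟩
  by_contra! hlt
  have h1 : ∀ᶠ w in 𝓝[>] b e, ∀ e' ∈ S, w ∉ Icc (a e') (b e') := by
    refine (Finset.eventually_all S).2 fun e' he' => ?_
    by_cases hne : e = e'
    · rw [← hne]
      filter_upwards [self_mem_nhdsWithin] with w hw hw'
      exact hw'.2.not_gt hw
    · rcases hS e he e' he' hne with h2 | h2
      · filter_upwards [Ioo_mem_nhdsGT h2] with w hw hw'
        exact hw'.1.not_gt hw.2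
      · filter_upwards [self_mem_nhdsWithin] with w hw hw'
        have hw2 : b e < w := hw
        linarith [hw'.2, hye.1, hye.2]
  obtain ⟨w, h2, h3⟩ := (h1.and (Ioo_mem_nhdsGT hlt)).exists
  obtain ⟨e', he', hw⟩ := h w ⟨hye.2.trans h3.1.le, h3.2.le⟩
  exact h2 e' he' hw

/-- A criterion for a member of a collapse family to collapse a vertical line. -/
theorem isCollapseAt_of_family {S : Finset ι} {z : ι → ℝ} (F : CollapseFamily S L.A L.B z)
    {x : ℝ} {δ : ι → ℝ} {k : ℝ → ℝ} (hδ : ∀ e ∈ S, |δ e| ≤ F.η) (hk : Monotone k)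
    (hkη : ∀ y, |k y| ≤ F.η)
    (hval : ∀ e, x ∈ Icc (G.s e) (G.t e) → ∀ y ∈ Icc (L.A e) (L.B e), defFun L ε M (x, y) ≤ 0 →
      ∃ e' ∈ S, y ∈ Icc (L.A e') (L.B e') ∧ z e' + k y + δ e' = G.y e x)
    (hS : ∀ e ∈ S, ∀ e' ∈ S, e ≠ e' → L.B e < L.A e' ∨ L.B e' < L.A e)
    (hsub : ∀ y, defFun L ε M (x, y) ≤ 0 → ∃ e ∈ S, y ∈ Icc (L.A e) (L.B e))
    (hfib : ∀ e ∈ S, ∀ y y', y < y' → y ∈ Icc (L.A e) (L.B e) → y' ∈ Icc (L.A e) (L.B e) →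
      (k y = k y' ↔ ∀ w ∈ Icc y y', defFun L ε M (x, w) ≤ 0)) :
    IsCollapseAt L ε M x (fun y => adjust S z F.d δ (F.g y + k y)) where
  monotone := F.monotone δ k hδ hk
  bounded := F.bounded δ k hδ hkη
  eq_height e he y hy hD := by
    obtain ⟨e', he', hy', h⟩ := hval e he y hy hD
    rw [F.eq_on δ k hkη e' he' y hy', h]
  eq_iff y y' hy := by
    constructor
    · intro heq
      obtain ⟨h1, e, he, h2, h3⟩ := F.plateau δ k hδ hk y y' hy heq
      exact (hfib e he y y' hy h2 h3).1 h1
    · intro hD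
      obtain ⟨e, he, h1, h2⟩ := exists_interval_of_segment hS hy.le fun w hw => hsub w (hD w hw)
      rw [F.eq_on δ k hkη e he y h1, F.eq_on δ k hkη e he y' h2, (hfib e he y y' hy h1 h2).2 hD]

/-- Away from the vertices, the vertical lines collapse in a continuous manner. -/
theorem exists_collapse_of_far (hε : 0 < ε) (hsep : G.Separated ε) {x₀ : ℝ}
    (hx₀ : ∀ v ∈ G.X, ε < |x₀ - v|) : ∃ h : ℝ × ℝ → ℝ, Continuous h ∧
      ∀ᶠ x in 𝓝 x₀, IsCollapseAt L ε M x fun y => h (x, y) := by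
  obtain ⟨F⟩ := exists_collapseFamily (a := L.A) (b := L.B) (z := fun e => G.y e x₀)
    (G.arcsOver x₀) (fun e _ => (L.lt e).le) (by
      intro e he e' he' hne
      rw [mem_arcsOver] at he he'
      exact (below_or_below hne he.1 he.2 he'.1 he'.2).imp
        (fun h => ⟨L.lt_of_below e e' h, h.lt he.1 he.2 he'.1 he'.2⟩)
        fun h => ⟨L.lt_of_below e' e h, h.lt he'.1 he'.2 he.1 he.2⟩)
  refine ⟨fun p => adjust (G.arcsOver x₀) (fun e => G.y e x₀) F.d
    (fun e => G.y e p.1 - G.y e x₀) (F.g p.2 + 0), continuous_adjust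
      (fun e => ((G.continuous_y e).comp continuous_fst).sub continuous_const)
      ((F.continuous_g.comp continuous_snd).add continuous_const), ?_⟩
  have h1 : ∀ᶠ x in 𝓝 x₀, ∀ e, |G.y e x - G.y e x₀| ≤ F.η := by
    refine eventually_all.2 fun e => ?_
    have hc : Continuous fun x => |G.y e x - G.y e x₀| :=
      ((G.continuous_y e).sub continuous_const).abs
    refine (hc.continuousAt.eventually_lt continuousAt_const ?_).mono fun x hx => hx.le
    simpa using F.η_pos
  filter_upwards [h1, eventually_far hε hsep hx₀ (L := L) (M := M)] with x hx hfar
  obtain ⟨hxX, hover, hD⟩ := hfar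
  refine isCollapseAt_of_family F (k := fun _ => 0) (fun e _ => hx e) monotone_const
    (fun y => by simpa using F.η_pos.le) (fun e he y hy _ => ⟨e, ?_, hy, by ring⟩)
    L.disjoint_arcsOver (fun y hy => ?_)
    fun e he y y' _ hy hy' => ⟨fun _ w hw => ?_, fun _ => rfl⟩
  · rw [← hover]
    exact mem_arcsOver_of_mem_Icc hxX he
  · rwa [hD, intervalPoly_nonpos_iff L.lt L.disjoint_arcsOver] at hy
  · rw [hD, intervalPoly_nonpos_iff L.lt L.disjoint_arcsOver]
    exact ⟨e, he, hy.1.trans hw.1, hw.2.trans hy'.2⟩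

/-- Over the side of a vertex from which at most one arc starts, the vertical order of the arcs at
the vertex is that of their intervals. -/
theorem order_side (L : G.Levels) (hε : 0 < ε) (hsep : G.Separated ε) {v τ : ℝ} (hv : v ∈ G.X)
    (hτ : τ = 1 ∨ τ = -1) (huniq : ∀ e e', G.Emanates v τ e → G.Emanates v τ e' → e = e')
    {e e' : ι} (he : e ∈ G.side v τ) (he' : e' ∈ G.side v τ) (hne : e ≠ e') :
    (L.B e < L.A e' ∧ G.y e v < G.y e' v) ∨ (L.B e' < L.A e ∧ G.y e' v < G.y e v) := by
  have key : ∀ e e', e ∈ G.side v τ → e' ∈ G.side v τ → G.Below e e' → G.y e v < G.y e' v := by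
    intro e e' he he' hb
    rw [mem_side] at he he'
    rcases he with he | he <;> rcases he' with he' | he'
    · exact hb.lt he.1 he.2 he'.1 he'.2
    · rw [y_eq_of_emanates he']
      exact y_lt_Y_of_below hv he' he hb
    · rw [y_eq_of_emanates he]
      exact Y_lt_y_of_below hv he he' hb
    · exact absurd (huniq e e' he he') hb.ne
  have h1 : τ * (v + τ * ε - v) = ε := by rcases hτ with rfl | rfl <;> ring
  have h2 := hsep.arcsOver_eq_side (x := v + τ * ε) hv hτ (by rw [h1]; exact hε)
    (by rw [h1]; linarith)
  have k1 := he
  have k2 := he'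
  rw [← h2, mem_arcsOver] at k1 k2
  exact (below_or_below hne k1.1 k1.2 k2.1 k2.2).imp
    (fun h => ⟨L.lt_of_below e e' h, key e e' he he' h⟩)
    fun h => ⟨L.lt_of_below e' e h, key e' e he' he h⟩

/-- A collapse family for the arcs beside the abscissa `v`, with a margin large enough for the variation
of the heights of the arcs at distance at most `2ε` from `v`. -/
structure SideFamily (L : G.Levels) (ε v τ : ℝ) extends
    CollapseFamily (G.side v τ) L.A L.B (fun e => G.y e v) where
  steady : ∀ e x, |x - v| < 2 * ε → |G.y e x - G.y e v| ≤ η / 4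

theorem eventually_sideFamily (L : G.Levels) {ε₀ : ℝ} (hε₀ : 0 < ε₀) (hsep : G.Separated ε₀)
    {v τ : ℝ} (hv : v ∈ G.X) (hτ : τ = 1 ∨ τ = -1)
    (huniq : ∀ e e', G.Emanates v τ e → G.Emanates v τ e' → e = e') :
    ∀ᶠ ε in 𝓝[>] (0 : ℝ), Nonempty (SideFamily L ε v τ) := by
  obtain ⟨F⟩ := exists_collapseFamily (a := L.A) (b := L.B) (z := fun e => G.y e v) (G.side v τ)
    (fun e _ => (L.lt e).le) fun e he e' he' hne => order_side L hε₀ hsep hv hτ huniq he he' hne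
  have h1 : ∀ᶠ x in 𝓝 v, ∀ e, |G.y e x - G.y e v| ≤ F.η / 4 := by
    refine eventually_all.2 fun e => ?_
    have hc : Continuous fun x => |G.y e x - G.y e v| :=
      ((G.continuous_y e).sub continuous_const).abs
    refine (hc.continuousAt.eventually_lt continuousAt_const ?_).mono fun x hx => hx.le
    simpa using F.η_pos
  obtain ⟨r, hr, h2⟩ := Metric.eventually_nhds_iff.1 h1
  filter_upwards [Ioo_mem_nhdsGT (half_pos hr)] with ε hε
  exact ⟨⟨F, fun e x hx => h2 (by rw [Real.dist_eq]; linarith [hε.2]) e⟩⟩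

theorem eventually_separated {ι : Type*} (G : GraphDiagram ι) :
    ∀ᶠ ε in 𝓝[>] (0 : ℝ), G.Separated ε := by
  refine (Finset.eventually_all _).2 fun v _ => (Finset.eventually_all _).2 fun w _ => ?_
  by_cases hne : v = w
  · exact Eventually.of_forall fun ε h => absurd hne h
  · have hpos : 0 < |v - w| := abs_pos.2 (sub_ne_zero.2 hne)
    filter_upwards [Ioo_mem_nhdsGT (show 0 < |v - w| / 4 by linarith)] with ε hε _
    linarith [hε.2]

/-- The diagram and the intervals alone determine how small `ε` has to be for the side families of all
vertices. -/
theorem exists_radius (L : G.Levels) : ∃ ε > 0, G.Separated ε ∧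
    ∀ v ∈ G.X, ∀ τ : ℝ, (τ = 1 ∨ τ = -1) →
      (∀ e e', G.Emanates v τ e → G.Emanates v τ e' → e = e') →
        Nonempty (SideFamily L ε v τ) := by
  obtain ⟨ε₀, hsep, hε₀⟩ := (G.eventually_separated.and self_mem_nhdsWithin).exists
  have h1 : ∀ v ∈ G.X, ∀ τ ∈ ({1, -1} : Finset ℝ), ∀ᶠ ε in 𝓝[>] (0 : ℝ),
      (∀ e e', G.Emanates v τ e → G.Emanates v τ e' → e = e') →
        Nonempty (SideFamily L ε v τ) := fun v hv τ hτ => by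
    by_cases huniq : ∀ e e', G.Emanates v τ e → G.Emanates v τ e' → e = e'
    · exact (eventually_sideFamily L hε₀ hsep hv (by simpa using hτ) huniq).mono fun ε h _ => h
    · exact Eventually.of_forall fun ε h => absurd h huniq
  obtain ⟨ε, ⟨h2, h3⟩, h4⟩ := (((Finset.eventually_all _).2 fun v hv =>
    (Finset.eventually_all _).2 fun τ hτ => h1 v hv τ hτ).and
      G.eventually_separated |>.and self_mem_nhdsWithin).exists
  exact ⟨ε, h4, h3, fun v hv τ hτ => h2 v hv τ (by simpa using hτ)⟩

/-- Near an end of the diagram, the interval of the end arc shrinks to a point, and opens up again past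
the vertex. -/
theorem exists_collapse_of_isEnd (hε : 0 < ε) (hsep : G.Separated ε) {v : ℝ} (hv : v ∈ G.X)
    {e₀ : ι} (hend : G.IsEnd v (M v hv).σ e₀) (hl : (M v hv).l = L.A e₀)
    (hu : (M v hv).u = L.B e₀) (F : SideFamily L ε v (M v hv).σ) :
    ∃ h : ℝ × ℝ → ℝ, Continuous h ∧
      ∀ x, |x - v| < 2 * ε → IsCollapseAt L ε M x fun y => h (x, y) := by
  set N := M v hv with hN
  have hη := F.η_pos
  obtain ⟨ρ, hρ⟩ : ∃ ρ, ρ = (N.u - N.l) / 2 := ⟨_, rfl⟩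
  have hρ0 : 0 < ρ := by linarith [N.l_lt_u]
  have hlo : N.l = N.center - ρ := by
    rw [hρ, VertexModel.center]
    ring
  have hhi : N.u = N.center + ρ := by
    rw [hρ, VertexModel.center]
    ring
  have hem : G.Emanates v N.σ e₀ := (hend.1 e₀).2 rfl
  have he₀S : e₀ ∈ G.side v N.σ := mem_side.2 (Or.inr hem)
  -- the graph of `k` is flat exactly on the fibre of the domain and outside the interval of the arc
  obtain ⟨k, hk⟩ : ∃ k : ℝ → ℝ → ℝ, ∀ x y, k x y = F.η / (4 * ρ) *
      (clamp ρ (y - N.center) - clamp (N.radius x) (clamp ρ (y - N.center))) := ⟨_, fun _ _ => rfl⟩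
  have hcoef : 0 < F.η / (4 * ρ) := by positivity
  have hkc : Continuous fun p : ℝ × ℝ => k p.1 p.2 := by
    have h1 := N.continuous_radius
    simp only [hk, clamp]
    fun_prop
  have hkm : ∀ x, Monotone (k x) := fun x y y' h => by
    rw [hk, hk]
    exact mul_le_mul_of_nonneg_left
      (sub_clamp_mono (N.radius x) (clamp_mono ρ (by linarith))) hcoef.le
  have hkb : ∀ x y, |k x y| ≤ F.η / 2 := fun x y => by
    rw [hk, abs_mul, abs_of_pos hcoef]
    have h1 := abs_le.1 (abs_clamp_le hρ0.le (y - N.center))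
    have h2 := abs_le.1 (abs_clamp_le (N.radius_nonneg x) (clamp ρ (y - N.center)))
    have h3 := N.radius_le x
    rw [← hρ] at h3
    calc F.η / (4 * ρ) * _ ≤ F.η / (4 * ρ) * (2 * ρ) :=
          mul_le_mul_of_nonneg_left (abs_le.2 ⟨by linarith, by linarith⟩) hcoef.le
      _ = F.η / 2 := by
          field_simp
          ring
  -- an arc other than `e₀` lies on one side of the interval of `e₀`
  have hside : ∀ e ∈ G.side v N.σ, e ≠ e₀ → ∀ y ∈ Icc (L.A e) (L.B e), ∀ x,
      k x y = k x (L.A e) := fun e he hne y hy x => by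
    have hAB := (L.lt e).le
    rw [hk, hk]
    rcases L.disjoint_side hε hsep hv N.sign e he e₀ he₀S hne with h | h
    · rw [clamp_of_le_neg hρ0.le (show y - N.center ≤ -ρ by linarith [hy.2]),
        clamp_of_le_neg hρ0.le (show L.A e - N.center ≤ -ρ by linarith)]
    · rw [clamp_of_ge hρ0.le (show ρ ≤ y - N.center by linarith [hy.1]),
        clamp_of_ge hρ0.le (show ρ ≤ L.A e - N.center by linarith)]
  have hthrough : ∀ e ∈ G.side v N.σ, e ≠ e₀ → e ∈ G.side v (-N.σ) := fun e he hne => by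
    rw [mem_side] at he ⊢
    exact Or.inl (he.resolve_right fun h => hne ((hend.1 e).1 h))
  have hopp : ∀ e ∈ G.side v (-N.σ), e ∈ G.side v N.σ := fun e he =>
    mem_side.2 (Or.inl ((mem_side.1 he).resolve_right (hend.2 e)))
  have hk₀ : ∀ x, |x - v| < 2 * ε → ∀ y ∈ Icc (L.A e₀) (L.B e₀), defFun L ε M (x, y) ≤ 0 →
      k x y = 0 := fun x hx y hy hD => by
    have h1 : |y - N.center| ≤ N.radius x := by
      rcases (defFun_nonpos_iff_of_isEnd hε hsep hv hend hl hu hx y).1 hD with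
        ⟨e', he', hy'⟩ | h
      · have hne : e' ≠ e₀ := by
          rintro rfl
          rcases mem_side.1 he' with h1 | h1
          · rcases hem with ⟨-, h2⟩ | ⟨-, h2⟩ <;> linarith
          · exact hend.2 _ h1
        rcases L.disjoint_side hε hsep hv N.sign e' (hopp e' he') e₀ he₀S hne with h1 | h1
        · linarith [hy.1, hy'.2]
        · linarith [hy.2, hy'.1]
      · exact (N.factor_nonpos_iff.1 h).2
    have h2 := N.radius_le x
    rw [← hρ] at h2
    rw [hk, clamp_of_le (h1.trans h2), clamp_of_le h1, sub_self, mul_zero]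
  obtain ⟨δ, hδ₀, hδ⟩ : ∃ δ : ℝ → ι → ℝ, (∀ x, δ x e₀ = G.y e₀ x - G.Y v) ∧
      ∀ x e, e ≠ e₀ → δ x e = G.y e x - G.y e v - k x (L.A e) := by
    classical
    exact ⟨fun x e => if e = e₀ then G.y e₀ x - G.Y v else G.y e x - G.y e v - k x (L.A e),
      fun x => if_pos rfl, fun x e h => if_neg h⟩
  refine ⟨fun p => adjust (G.side v N.σ) (fun e => G.y e v) F.d (δ p.1) (F.g p.2 + k p.1 p.2),
    continuous_adjust (fun e => ?_) ((F.continuous_g.comp continuous_snd).add hkc),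
    fun x hx => isCollapseAt_of_family (δ := δ x) (k := k x) F.toCollapseFamily
      (fun e he => ?_) (hkm x) (fun y => (hkb x y).trans ?_) (fun e hex y hy hD => ?_)
      (L.disjoint_side hε hsep hv N.sign) (fun y hD => ?_)
      fun e he y y' hlt hy hy' => ⟨fun heq w hw => ?_, fun hD => ?_⟩⟩
  · by_cases he : e = e₀
    · rw [he]
      simp only [hδ₀]
      exact ((G.continuous_y _).comp continuous_fst).sub continuous_const
    · simp only [hδ _ e he]
      exact (((G.continuous_y _).comp continuous_fst).sub continuous_const).sub
        (hkc.comp (continuous_fst.prodMk continuous_const))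
  · have h1 := abs_le.1 (F.steady e x hx)
    by_cases he : e = e₀
    · rw [he] at h1 ⊢
      rw [y_eq_of_emanates hem] at h1
      rw [hδ₀]
      exact abs_le.2 ⟨by linarith, by linarith⟩
    · have h2 := abs_le.1 (hkb x (L.A e))
      rw [hδ _ e he]
      exact abs_le.2 ⟨by linarith, by linarith⟩
  · linarith
  · obtain ⟨τ, hτ, h0, hτe⟩ := hsep.exists_mem_side hε hv hx hex
    have heS : e ∈ G.side v N.σ := by
      rw [mem_side] at hτe ⊢
      refine hτe.imp_right fun h => ?_
      rcases eq_or_eq_neg_of_sign N.sign hτ with rfl | rfl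
      · exact h
      · exact absurd h (hend.2 e)
    refine ⟨e, heS, hy, ?_⟩
    by_cases he : e = e₀
    · subst he
      rw [hδ₀, hk₀ x hx y hy hD, y_eq_of_emanates hem]
      ring
    · rw [hδ _ e he, hside e heS he y hy]
      ring
  · rcases (defFun_nonpos_iff_of_isEnd hε hsep hv hend hl hu hx y).1 hD with ⟨e', he', hy'⟩ | h
    · exact ⟨e', hopp e' he', hy'⟩
    · refine ⟨e₀, he₀S, ?_⟩
      rw [← hl, ← hu]
      exact N.mem_Icc_of_factor_nonpos h
  · by_cases hee : e = e₀
    · subst hee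
      rw [← hl, ← hu] at hy hy'
      rw [hk, hk] at heq
      have h1 : |y - N.center| ≤ ρ := abs_le.2 ⟨by linarith [hy.1], by linarith [hy.2]⟩
      have h2 : |y' - N.center| ≤ ρ := abs_le.2 ⟨by linarith [hy'.1], by linarith [hy'.2]⟩
      rw [clamp_of_le h1, clamp_of_le h2] at heq
      obtain ⟨h3, h4⟩ := abs_le_of_sub_clamp_eq (N.radius_nonneg x)
        (by linarith : y - N.center < y' - N.center) (mul_left_cancel₀ hcoef.ne' heq)
      refine (defFun_nonpos_iff_of_isEnd hε hsep hv hend hl hu hx w).2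
        (Or.inr (N.factor_nonpos_iff.2 ⟨?_, ?_⟩))
      · by_contra hneg
        rw [N.radius_eq_zero (not_le.1 hneg).le] at h3 h4
        have h5 := abs_le.1 h3
        have h6 := abs_le.1 h4
        linarith
      · have h5 := abs_le.1 h3
        have h6 := abs_le.1 h4
        exact abs_le.2 ⟨by linarith [hw.1], by linarith [hw.2]⟩
    · exact (defFun_nonpos_iff_of_isEnd hε hsep hv hend hl hu hx w).2
        (Or.inl ⟨e, hthrough e he hee, hy.1.trans hw.1, hw.2.trans hy'.2⟩)
  · by_cases hee : e = e₀
    · subst hee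
      rw [hk₀ x hx y hy (hD y ⟨le_rfl, hlt.le⟩), hk₀ x hx y' hy' (hD y' ⟨hlt.le, le_rfl⟩)]
    · rw [hside e he hee y hy, hside e he hee y' hy']

/-- Near a fork of the diagram, the interval of the stem splits into those of the branches. -/
theorem exists_collapse_of_isFork (hε : 0 < ε) (hsep : G.Separated ε) {v : ℝ} (hv : v ∈ G.X)
    {e₀ e₁ e₂ : ι} (hf : G.IsFork v (M v hv).σ e₀ e₁ e₂) (hl : (M v hv).l = L.B e₁)
    (hu : (M v hv).u = L.A e₂) (F : SideFamily L ε v (-(M v hv).σ)) :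
    ∃ h : ℝ × ℝ → ℝ, Continuous h ∧
      ∀ x, |x - v| < 2 * ε → IsCollapseAt L ε M x fun y => h (x, y) := by
  set N := M v hv with hN
  have hη := F.η_pos
  have hlu := N.l_lt_u
  obtain ⟨hA₁, hB₂⟩ := L.fork v N.σ e₀ e₁ e₂ hf
  have hl₁ := L.lt e₁
  have hl₂ := L.lt e₂
  have hc : N.center = (N.l + N.u) / 2 := rfl
  have hem₀ : G.Emanates v (-N.σ) e₀ := (hf.1 e₀).2 rfl
  have hem₁ : G.Emanates v N.σ e₁ := (hf.2.1 e₁).2 (Or.inl rfl)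
  have hem₂ : G.Emanates v N.σ e₂ := (hf.2.1 e₂).2 (Or.inr rfl)
  have he₀S : e₀ ∈ G.side v (-N.σ) := mem_side.2 (Or.inr hem₀)
  -- the heights of the branches and of the stem, extended by constants past the vertex
  obtain ⟨P, hP⟩ : ∃ P : ℝ → ℝ, ∀ x, P x = v + N.σ * max 0 (N.σ * (x - v)) := ⟨_, fun _ => rfl⟩
  obtain ⟨Q, hQ⟩ : ∃ Q : ℝ → ℝ, ∀ x, Q x = v + N.σ * min 0 (N.σ * (x - v)) := ⟨_, fun _ => rfl⟩
  have hPc : Continuous P := by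
    rw [funext hP]
    fun_prop
  have hQc : Continuous Q := by
    rw [funext hQ]
    fun_prop
  have hσσ : ∀ x, v + N.σ * (N.σ * (x - v)) = x := fun x => by
    rcases N.sign with h | h <;> rw [h] <;> ring
  have hPpos : ∀ x, 0 ≤ N.σ * (x - v) → P x = x ∧ Q x = v := fun x hx => by
    rw [hP, hQ, max_eq_right hx, min_eq_left hx, hσσ, mul_zero, add_zero]
    exact ⟨rfl, rfl⟩
  have hPneg : ∀ x, N.σ * (x - v) ≤ 0 → P x = v ∧ Q x = x := fun x hx => by
    rw [hP, hQ, max_eq_left hx, min_eq_right hx, hσσ, mul_zero, add_zero]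
    exact ⟨rfl, rfl⟩
  have hPQ : ∀ x, |x - v| < 2 * ε → |P x - v| < 2 * ε ∧ |Q x - v| < 2 * ε := fun x hx => by
    have h0 : |v - v| < 2 * ε := by simpa using hε
    rcases le_total 0 (N.σ * (x - v)) with h | h
    · rw [(hPpos x h).1, (hPpos x h).2]
      exact ⟨hx, h0⟩
    · rw [(hPneg x h).1, (hPneg x h).2]
      exact ⟨h0, hx⟩
  obtain ⟨κ, hκ⟩ : ∃ κ : ℝ → ℝ, ∀ x, κ x = (G.y e₂ (P x) - G.y e₁ (P x)) / 2 :=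
    ⟨_, fun _ => rfl⟩
  have hκc : Continuous κ := by
    rw [funext hκ]
    exact (((G.continuous_y e₂).comp hPc).sub ((G.continuous_y e₁).comp hPc)).div_const 2
  have hκ0 : ∀ x, N.σ * (x - v) ≤ 0 → κ x = 0 := fun x hx => by
    rw [hκ, (hPneg x hx).1, y_eq_of_emanates hem₁, y_eq_of_emanates hem₂, sub_self, zero_div]
  have hκpos : ∀ x, |x - v| < 2 * ε → 0 < N.σ * (x - v) → 0 < κ x := fun x hx h => by
    have h1 : N.σ * (x - v) < 2 * ε := by
      rw [← sign_mul_abs N.sign] at hx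
      exact (le_abs_self _).trans_lt hx
    have h2 := hsep.arcsOver_eq_side hv N.sign h h1
    have k1 : e₁ ∈ G.arcsOver x := h2 ▸ mem_side.2 (Or.inr hem₁)
    have k2 : e₂ ∈ G.arcsOver x := h2 ▸ mem_side.2 (Or.inr hem₂)
    rw [mem_arcsOver] at k1 k2
    have := hf.2.2.lt k1.1 k1.2 k2.1 k2.2
    rw [hκ, (hPpos x h.le).1]
    linarith
  have hκnn : ∀ x, |x - v| < 2 * ε → 0 ≤ κ x := fun x hx => by
    rcases le_or_gt (N.σ * (x - v)) 0 with h | h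
    · exact (hκ0 x h).ge
    · exact (hκpos x hx h).le
  have hκη : ∀ x, |x - v| < 2 * ε → κ x ≤ F.η / 4 := fun x hx => by
    have h1 := abs_le.1 (F.steady e₁ _ (hPQ x hx).1)
    have h2 := abs_le.1 (F.steady e₂ _ (hPQ x hx).1)
    rw [y_eq_of_emanates hem₁] at h1
    rw [y_eq_of_emanates hem₂] at h2
    rw [hκ]
    linarith
  -- where the radius vanishes, so does `κ`, and the value of the quotient is irrelevant
  obtain ⟨k, hk⟩ : ∃ k : ℝ → ℝ → ℝ, ∀ x y, k x y =
      κ x * clamp 1 ((y - N.center) / N.radius x) := ⟨_, fun _ _ => rfl⟩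
  have hkabs : ∀ x y, |k x y| ≤ |κ x| := fun x y => by
    rw [hk, abs_mul]
    exact mul_le_of_le_one_right (abs_nonneg _) (abs_clamp_le zero_le_one _)
  have hkc : Continuous fun p : ℝ × ℝ => k p.1 p.2 := by
    refine continuous_iff_continuousAt.2 fun p => ?_
    rcases le_or_gt (N.σ * (p.1 - v)) 0 with h | h
    · have h1 : Tendsto (fun q : ℝ × ℝ => |κ q.1|) (𝓝 p) (𝓝 0) := by
        have := (hκc.comp continuous_fst).abs.tendsto p
        simpa [hκ0 p.1 h] using this
      have h2 : k p.1 p.2 = 0 := by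
        rw [hk, hκ0 p.1 h, zero_mul]
      rw [ContinuousAt, h2]
      exact squeeze_zero_norm (fun q => hkabs q.1 q.2) h1
    · have h1 : N.radius p.1 ≠ 0 := (N.radius_pos h).ne'
      have h2 : ContinuousAt (fun q : ℝ × ℝ => N.radius q.1) p :=
        (N.continuous_radius.comp continuous_fst).continuousAt
      have h3 : ContinuousAt (fun q : ℝ × ℝ => κ q.1) p :=
        (hκc.comp continuous_fst).continuousAt
      simp only [hk, clamp]
      fun_prop (disch := assumption)
  have hkm : ∀ x, |x - v| < 2 * ε → Monotone (k x) := fun x hx y y' h => by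
    rw [hk, hk]
    exact mul_le_mul_of_nonneg_left (clamp_mono 1
      (div_le_div_of_nonneg_right (by linarith) (N.radius_nonneg x))) (hκnn x hx)
  have hklo : ∀ x y, y - N.center ≤ -N.radius x → k x y = -κ x := fun x y h => by
    rcases le_or_gt (N.σ * (x - v)) 0 with h1 | h1
    · rw [hk, hκ0 x h1, zero_mul, neg_zero]
    · have h2 := N.radius_pos h1
      rw [hk, clamp_of_le_neg zero_le_one, mul_neg_one]
      rw [div_le_iff₀ h2]
      linarith
  have hkhi : ∀ x y, N.radius x ≤ y - N.center → k x y = κ x := fun x y h => by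
    rcases le_or_gt (N.σ * (x - v)) 0 with h1 | h1
    · rw [hk, hκ0 x h1, zero_mul]
    · have h2 := N.radius_pos h1
      rw [hk, clamp_of_ge zero_le_one, mul_one]
      rw [le_div_iff₀ h2]
      linarith
  -- an arc other than the stem lies on one side of the interval of the stem
  have hside : ∀ e ∈ G.side v (-N.σ), e ≠ e₀ → ∀ y ∈ Icc (L.A e) (L.B e), ∀ x,
      k x y = k x (L.A e) := fun e he hne y hy x => by
    have hAB := (L.lt e).le
    have hr := N.radius_le x
    rcases L.disjoint_side hε hsep hv N.neg_sign e he e₀ he₀S hne with h | h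
    · rw [hklo x y (by linarith [hy.2]), hklo x (L.A e) (by linarith)]
    · rw [hkhi x y (by linarith [hy.1]), hkhi x (L.A e) (by linarith)]
  obtain ⟨δ, hδ₀, hδ⟩ : ∃ δ : ℝ → ι → ℝ,
      (∀ x, δ x e₀ = G.y e₀ (Q x) + (G.y e₁ (P x) + G.y e₂ (P x)) / 2 - 2 * G.Y v) ∧
      ∀ x e, e ≠ e₀ → δ x e = G.y e x - G.y e v - k x (L.A e) := by
    classical
    exact ⟨fun x e => if e = e₀ then
      G.y e₀ (Q x) + (G.y e₁ (P x) + G.y e₂ (P x)) / 2 - 2 * G.Y v else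
        G.y e x - G.y e v - k x (L.A e), fun x => if_pos rfl, fun x e h => if_neg h⟩
  refine ⟨fun p => adjust (G.side v (-N.σ)) (fun e => G.y e v) F.d (δ p.1) (F.g p.2 + k p.1 p.2),
    continuous_adjust (fun e => ?_) ((F.continuous_g.comp continuous_snd).add hkc),
    fun x hx => isCollapseAt_of_family (δ := δ x) (k := k x) F.toCollapseFamily
      (fun e he => ?_) (hkm x hx) (fun y => (hkabs x y).trans ?_) (fun e hex y hy hD => ?_)
      (L.disjoint_side hε hsep hv N.neg_sign)
      (fun y hD => ((defFun_nonpos_iff_of_isFork hε hsep hv hf hl hu hx y).1 hD).1)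
      fun e he y y' hlt hy hy' => ⟨fun heq w hw => ?_, fun hD => ?_⟩⟩
  · by_cases he : e = e₀
    · rw [he]
      simp only [hδ₀]
      exact (((G.continuous_y _).comp (hQc.comp continuous_fst)).add
        ((((G.continuous_y _).comp (hPc.comp continuous_fst)).add
          ((G.continuous_y _).comp (hPc.comp continuous_fst))).div_const 2)).sub continuous_const
    · simp only [hδ _ e he]
      exact (((G.continuous_y _).comp continuous_fst).sub continuous_const).sub
        (hkc.comp (continuous_fst.prodMk continuous_const))
  · by_cases he : e = e₀
    · have h0 := abs_le.1 (F.steady e₀ _ (hPQ x hx).2)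
      have h1 := abs_le.1 (F.steady e₁ _ (hPQ x hx).1)
      have h2 := abs_le.1 (F.steady e₂ _ (hPQ x hx).1)
      rw [y_eq_of_emanates hem₀] at h0
      rw [y_eq_of_emanates hem₁] at h1
      rw [y_eq_of_emanates hem₂] at h2
      rw [he, hδ₀]
      exact abs_le.2 ⟨by linarith, by linarith⟩
    · have h1 := abs_le.1 (F.steady e x hx)
      have h2 := abs_le.1 (hkabs x (L.A e))
      rw [abs_of_nonneg (hκnn x hx)] at h2
      have h3 := hκη x hx
      rw [hδ _ e he]
      exact abs_le.2 ⟨by linarith, by linarith⟩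
  · rw [abs_of_nonneg (hκnn x hx)]
    linarith [hκη x hx]
  · obtain ⟨hS, hnot⟩ := (defFun_nonpos_iff_of_isFork hε hsep hv hf hl hu hx y).1 hD
    rw [← hN, not_lt, le_abs] at hnot
    obtain ⟨τ, hτ, h0, hτe⟩ := hsep.exists_mem_side hε hv hx hex
    rw [mem_side] at hτe
    rcases hτe with hthr | hem
    · have heS : e ∈ G.side v (-N.σ) := mem_side.2 (Or.inl hthr)
      have hne : e ≠ e₀ := by
        rintro rfl
        rcases hem₀ with ⟨-, h2⟩ | ⟨-, h2⟩ <;> linarith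
      exact ⟨e, heS, hy, by rw [hδ _ e hne, hside e heS hne y hy]; ring⟩
    · refine ⟨e₀, he₀S, ?_⟩
      rw [hδ₀, y_eq_of_emanates hem₀]
      rcases eq_or_eq_neg_of_sign N.sign hτ with rfl | rfl
      · obtain ⟨hPx, hQx⟩ := hPpos x h0
        rw [hPx, hQx, y_eq_of_emanates hem₀]
        have hκx := hκ x
        rw [hPx] at hκx
        rcases (hf.2.1 e).1 hem with rfl | rfl
        · refine ⟨⟨by linarith [hy.1], by linarith [hy.2]⟩, ?_⟩
          rw [hklo x y ?_]
          · linarith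
          · rcases hnot with h | h
            · linarith [hy.2, N.radius_nonneg x]
            · linarith
        · refine ⟨⟨by linarith [hy.1], by linarith [hy.2]⟩, ?_⟩
          rw [hkhi x y ?_]
          · linarith
          · rcases hnot with h | h
            · linarith
            · linarith [hy.1, N.radius_nonneg x]
      · have h0' : N.σ * (x - v) ≤ 0 := by linarith
        obtain ⟨hPx, hQx⟩ := hPneg x h0'
        obtain rfl := (hf.1 e).1 hem
        refine ⟨hy, ?_⟩
        rw [hPx, hQx, y_eq_of_emanates hem₁, y_eq_of_emanates hem₂, hk, hκ0 x h0']
        ring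
  · refine (defFun_nonpos_iff_of_isFork hε hsep hv hf hl hu hx w).2
      ⟨⟨e, he, hy.1.trans hw.1, hw.2.trans hy'.2⟩, fun hlt' => ?_⟩
    have hr : 0 < N.radius x := (abs_nonneg _).trans_lt hlt'
    have hpos : 0 < N.σ * (x - v) := by
      by_contra hneg
      exact hr.ne' (N.radius_eq_zero (not_lt.1 hneg))
    have h1 := abs_lt.1 hlt'
    rw [hk, hk] at heq
    rcases le_neg_or_le_of_clamp_eq zero_lt_one
      (div_lt_div_of_pos_right (by linarith : y - N.center < y' - N.center) hr)
      (mul_left_cancel₀ (hκpos x hx hpos).ne' heq) with h | h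
    · rw [div_le_iff₀ hr] at h
      linarith [hw.2]
    · rw [le_div_iff₀ hr] at h
      linarith [hw.1]
  · by_cases hee : e = e₀
    · have hnot : ∀ w ∈ Icc y y', N.radius x ≤ |w - N.center| := fun w hw => not_lt.1
        ((defFun_nonpos_iff_of_isFork hε hsep hv hf hl hu hx w).1 (hD w hw)).2
      rcases le_or_gt (N.σ * (x - v)) 0 with h | h
      · rw [hk, hk, hκ0 x h, zero_mul, zero_mul]
      · have hr := N.radius_pos h
        have h1 := hnot y ⟨le_rfl, hlt.le⟩
        have h2 := hnot y' ⟨hlt.le, le_rfl⟩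
        rw [le_abs] at h1 h2
        rcases h1 with h1 | h1
        · rw [hkhi x y h1, hkhi x y' (by linarith)]
        · rcases h2 with h2 | h2
          · -- the segment would contain the centre of the gap between the branches
            have h3 := hnot N.center ⟨by linarith, by linarith⟩
            rw [sub_self, abs_zero] at h3
            exact absurd hr h3.not_gt
          · rw [hklo x y (by linarith), hklo x y' (by linarith)]
    · rw [hside e he hee y hy, hside e he hee y' hy']

/-- A continuous function that collapses every vertical line exists, since it exists locally and the
conditions on it are convex. -/
theorem exists_collapse (hε : 0 < ε) (hsep : G.Separated ε)
    (hF : ∀ v ∈ G.X, ∀ τ : ℝ, (τ = 1 ∨ τ = -1) →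
      (∀ e e', G.Emanates v τ e → G.Emanates v τ e' → e = e') → Nonempty (SideFamily L ε v τ)) :
    ∃ h : ℝ × ℝ → ℝ, Continuous h ∧ ∀ x, IsCollapseAt L ε M x fun y => h (x, y) := by
  have hloc : ∀ x₀, ∃ h : ℝ × ℝ → ℝ, Continuous h ∧
      ∀ᶠ x in 𝓝 x₀, IsCollapseAt L ε M x fun y => h (x, y) := fun x₀ => by
    rcases near_or_far G hε x₀ with ⟨v, hv, hx⟩ | hx
    · have hU : ∀ᶠ x in 𝓝 x₀, |x - v| < 2 * ε := by
        have hc : Continuous fun x => |x - v| := by fun_prop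
        exact hc.continuousAt.eventually (gt_mem_nhds hx)
      rcases (M v hv).shape with ⟨e, he, hl, hu⟩ | ⟨e₀, e₁, e₂, hf, hl, hu⟩
      · obtain ⟨F⟩ := hF v hv _ (M v hv).sign fun e' e'' h' h'' =>
          ((he.1 e').1 h').trans ((he.1 e'').1 h'').symm
        obtain ⟨h, hc, hh⟩ := exists_collapse_of_isEnd hε hsep hv he hl hu F
        exact ⟨h, hc, hU.mono hh⟩
      · obtain ⟨F⟩ := hF v hv _ (M v hv).neg_sign fun e' e'' h' h'' =>
          ((hf.1 e').1 h').trans ((hf.1 e'').1 h'').symm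
        obtain ⟨h, hc, hh⟩ := exists_collapse_of_isFork hε hsep hv hf hl hu F
        exact ⟨h, hc, hU.mono hh⟩
    · exact exists_collapse_of_far hε hsep hx
  obtain ⟨g, hg⟩ := exists_continuous_forall_mem_convex_of_local (X := ℝ) (E := C(ℝ, ℝ))
    (convex_isCollapseAt (L := L) (ε := ε) (M := M)) fun x₀ => by
      obtain ⟨h, hc, hh⟩ := hloc x₀
      exact ⟨_, hh, fun x => (ContinuousMap.mk h hc).curry x,
        (ContinuousMap.mk h hc).curry.continuous.continuousOn, fun x hx => hx⟩
  exact ⟨fun p => g p.1 p.2, ContinuousMap.continuous_uncurry_of_continuous g, hg⟩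

end GraphDiagram

/-! ### The collapse as a plane -/

section Collapse

variable {D : Set (ℝ × ℝ)} {g : ℝ × ℝ → ℝ}

theorem eq_of_uIcc_subset
    (hD : ∀ x y y', y < y' → (g (x, y) = g (x, y') ↔ ∀ z ∈ Icc y y', (x, z) ∈ D)) {x y y' : ℝ}
    (h : ∀ z ∈ uIcc y y', (x, z) ∈ D) : g (x, y) = g (x, y') := by
  rcases lt_trichotomy y y' with hlt | rfl | hlt
  · rw [uIcc_of_le hlt.le] at h
    exact (hD x y y' hlt).2 h
  · rfl
  · rw [uIcc_of_ge hlt.le] at h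
    exact ((hD x y' y hlt).2 h).symm

theorem verticalSetoid_iff
    (hD : ∀ x y y', y < y' → (g (x, y) = g (x, y') ↔ ∀ z ∈ Icc y y', (x, z) ∈ D))
    (p q : ℝ × ℝ) : verticalSetoid Prod.fst D p q ↔ p.1 = q.1 ∧ g p = g q := by
  have key : ∀ x y y', y < y' → g (x, y) = g (x, y') →
      verticalSetoid Prod.fst D (x, y) (x, y') := fun x y y' hlt h => by
    have h1 := (hD x y y' hlt).1 h
    refine ⟨rfl, Or.inl ⟨h1 y ⟨le_rfl, hlt.le⟩, ?_⟩⟩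
    have h2 : IsPreconnected ((fun z => (x, z)) '' Icc y y') :=
      isPreconnected_Icc.image _ (by fun_prop)
    refine h2.subset_connectedComponentIn ⟨y, ⟨le_rfl, hlt.le⟩, rfl⟩ ?_
      ⟨y', ⟨hlt.le, le_rfl⟩, rfl⟩
    rintro _ ⟨z, hz, rfl⟩
    exact ⟨rfl, h1 z hz⟩
  obtain ⟨x, y⟩ := p
  obtain ⟨x', y'⟩ := q
  constructor
  · rintro ⟨h, ⟨hp, hq⟩ | ⟨heq, -⟩⟩
    · obtain rfl : x = x' := h
      refine ⟨rfl, eq_of_uIcc_subset hD fun z hz => ?_⟩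
      have h1 := (isPreconnected_connectedComponentIn (F := Prod.fst ⁻¹' {x} ∩ D)
        (x := (x, y))).image Prod.snd continuous_snd.continuousOn
      obtain ⟨⟨x'', z'⟩, h2, rfl⟩ := h1.ordConnected.uIcc_subset
        ⟨_, mem_connectedComponentIn ⟨rfl, hp⟩, rfl⟩ ⟨_, hq, rfl⟩ hz
      have h3 := connectedComponentIn_subset _ _ h2
      obtain rfl : x'' = x := h3.1
      exact h3.2
    · rw [heq]
      exact ⟨rfl, rfl⟩
  · rintro ⟨h, hg⟩
    obtain rfl : x = x' := h
    rcases lt_trichotomy y y' with hlt | rfl | hlt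
    · exact key x y y' hlt hg
    · exact (verticalSetoid Prod.fst D).refl _
    · exact (verticalSetoid Prod.fst D).symm (key x y' y hlt hg.symm)

/-- A map of the plane that preserves the vertical lines, on which it is monotone and at bounded distance
from the identity, is a quotient map. -/
theorem isQuotientMap_of_fiberwise_monotone (hg : Continuous g)
    (hm : ∀ x, Monotone fun y => g (x, y)) (hb : ∀ x, ∃ C, ∀ y, |g (x, y) - y| ≤ C) :
    IsQuotientMap fun p : ℝ × ℝ => (p.1, g p) := by
  have hc : Continuous fun p : ℝ × ℝ => (p.1, g p) := continuous_fst.prodMk hg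
  have hsurj : Function.Surjective fun p : ℝ × ℝ => (p.1, g p) := fun ⟨x, w⟩ => by
    obtain ⟨C, hC⟩ := hb x
    have h1 := (abs_le.1 (hC (w - C))).2
    have h2 := (abs_le.1 (hC (w + C))).1
    have h3 : Continuous fun y => g (x, y) := hg.comp (by fun_prop)
    have h4 := (abs_nonneg _).trans (hC 0)
    obtain ⟨y, -, hy⟩ := intermediate_value_Icc (show w - C ≤ w + C by linarith)
      h3.continuousOn (show w ∈ Icc (g (x, w - C)) (g (x, w + C)) from ⟨by linarith, by linarith⟩)
    exact ⟨(x, y), by rw [← hy]⟩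
  have hproper : IsProperMap fun p : ℝ × ℝ => (p.1, g p) := by
    refine isProperMap_iff_ultrafilter.2 ⟨hc, fun U q hq => ?_⟩
    obtain ⟨x, w⟩ := q
    obtain ⟨C, hC⟩ := hb x
    have h1 := (abs_le.1 (hC (w - C - 1))).2
    have h2 := (abs_le.1 (hC (w + C + 1))).1
    have hx : Tendsto (fun p : ℝ × ℝ => p.1) U (𝓝 x) := (continuous_fst.tendsto _).comp hq
    have hw : Tendsto (fun p : ℝ × ℝ => g p) U (𝓝 w) := (continuous_snd.tendsto _).comp hq
    have hlo : ∀ᶠ p : ℝ × ℝ in U, w - C - 1 ≤ p.2 := by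
      have h3 : Tendsto (fun p : ℝ × ℝ => g (p.1, w - C - 1)) U (𝓝 (g (x, w - C - 1))) :=
        ((hg.comp (by fun_prop : Continuous fun x : ℝ => (x, w - C - 1))).tendsto x).comp hx
      filter_upwards [h3.eventually_lt hw (by linarith)] with p hp
      by_contra hlt
      exact hp.not_ge (hm p.1 (not_le.1 hlt).le)
    have hhi : ∀ᶠ p : ℝ × ℝ in U, p.2 ≤ w + C + 1 := by
      have h3 : Tendsto (fun p : ℝ × ℝ => g (p.1, w + C + 1)) U (𝓝 (g (x, w + C + 1))) :=
        ((hg.comp (by fun_prop : Continuous fun x : ℝ => (x, w + C + 1))).tendsto x).comp hx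
      filter_upwards [hw.eventually_lt h3 (by linarith)] with p hp
      by_contra hlt
      exact hp.not_ge (hm p.1 (not_le.1 hlt).le)
    have hxI : ∀ᶠ p : ℝ × ℝ in U, p.1 ∈ Icc (x - 1) (x + 1) :=
      hx.eventually (Icc_mem_nhds (by linarith) (by linarith))
    have hK : IsCompact (Icc (x - 1) (x + 1) ×ˢ Icc (w - C - 1) (w + C + 1)) :=
      isCompact_Icc.prod isCompact_Icc
    obtain ⟨p, -, hp⟩ := hK.ultrafilter_le_nhds U (le_principal_iff.2 (by
      filter_upwards [hlo, hhi, hxI] with p h3 h4 h5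
      exact ⟨h5, h3, h4⟩))
    exact ⟨p, tendsto_nhds_unique ((hc.tendsto p).mono_left hp) hq, hp⟩
  exact hproper.isClosedMap.isQuotientMap hc hsurj

/-- If the non-trivial fibres of `g` on the vertical lines are the components of the fibres of `D`,
then `g` is the second coordinate of a positive chart of the collapse. -/
theorem exists_collapse_homeomorph (hg : Continuous g)
    (hm : ∀ x, Monotone fun y => g (x, y)) (hb : ∀ x, ∃ C, ∀ y, |g (x, y) - y| ≤ C)
    (hD : ∀ x y y', y < y' → (g (x, y) = g (x, y') ↔ ∀ z ∈ Icc y y', (x, z) ∈ D)) :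
    ∃ c' : Collapse (Prod.fst : ℝ × ℝ → ℝ) D ≃ₜ ℝ × ℝ,
      (∀ p, c' (collapseMap Prod.fst D p) = (p.1, g p)) ∧
      c' ∈ collapseOrientation Prod.fst canonicalOrientation D := by
  have hR := isQuotientMap_of_fiberwise_monotone hg hm hb
  let φ : Collapse (Prod.fst : ℝ × ℝ → ℝ) D → ℝ × ℝ :=
    Quotient.lift (fun p : ℝ × ℝ => (p.1, g p)) fun p q h => by
      have := (verticalSetoid_iff hD p q).1 h
      rw [this.1, this.2]
  have hφc : Continuous φ := hR.continuous.quotient_lift _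
  have hφq : IsQuotientMap φ := IsQuotientMap.of_comp continuous_quotient_mk' hφc hR
  have hφi : Function.Injective φ := by
    rintro ⟨p⟩ ⟨q⟩ h
    have h' : (p.1, g p) = (q.1, g q) := h
    rw [Prod.mk.injEq] at h'
    exact Quotient.sound ((verticalSetoid_iff hD p q).2 h')
  let c' : Collapse (Prod.fst : ℝ × ℝ → ℝ) D ≃ₜ ℝ × ℝ :=
    { toEquiv := Equiv.ofBijective φ ⟨hφi, hφq.surjective⟩
      continuous_toFun := hφc
      continuous_invFun := by
        rw [hφq.continuous_iff]
        convert continuous_id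
        ext1 q
        exact (Equiv.ofBijective φ ⟨hφi, hφq.surjective⟩).symm_apply_apply q }
  have hc' : ∀ p, c' (collapseMap Prod.fst D p) = (p.1, g p) := fun p => rfl
  refine ⟨c', hc', fun p hp c hc => ?_⟩
  simp only [hc']
  obtain ⟨x, y⟩ := p
  have hlt : ∀ y', y' < y → g (x, y') < g (x, y) := fun y' h =>
    lt_of_le_of_ne (hm x h.le) fun heq => hp ((hD x y' y h).1 heq y ⟨h.le, le_rfl⟩)
  have hgt : ∀ y', y < y' → g (x, y) < g (x, y') := fun y' h =>
    lt_of_le_of_ne (hm x h.le) fun heq => hp ((hD x y y' h).1 heq y ⟨le_rfl, h.le⟩)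
  refine OrientationPreservingAt.fiberwise (c := c.symm) (orientationPreservingAt_symm (q := 0) (hc 0) _)
    hg ?_ ?_ <;> rw [c.symm_apply_apply]
  · exact hlt
  · exact hgt

end Collapse

namespace GraphDiagram

open ArcSystem

variable {ι : Type*} [Fintype ι] {G : GraphDiagram ι} {L : G.Levels} {ε : ℝ}
  {M : ∀ v ∈ G.X, VertexModel L ε v}

theorem IsCollapseAt.apply_center {x : ℝ} {h : ℝ → ℝ} (hε : 0 < ε) (hsep : G.Separated ε) (hv : x ∈ G.X)
    (hh : IsCollapseAt L ε M x h) : h (M x hv).center = G.Y x := by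
  have htip := (defFun_tip (L := L) (M := M) hε hsep hv).le
  have hmem := (M x hv).center_mem
  have hclosed : ∀ {σ e}, G.Emanates x σ e → x ∈ Icc (G.s e) (G.t e) := by
    rintro σ e (⟨-, rfl⟩ | ⟨-, rfl⟩)
    · exact ⟨le_rfl, (G.s_lt_t e).le⟩
    · exact ⟨(G.s_lt_t e).le, le_rfl⟩
  rcases (M x hv).shape with ⟨e, he, hl, hu⟩ | ⟨e₀, e₁, e₂, hf, hl, hu⟩
  · have hem := (he.1 e).2 rfl
    rw [hl, hu] at hmem
    rw [hh.eq_height e (hclosed hem) _ hmem htip, y_eq_of_emanates hem]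
  · have hem := (hf.1 e₀).2 rfl
    rw [hl, hu] at hmem
    obtain ⟨h1, h2, h3⟩ := IsFork.level_lt L hf
    rw [hh.eq_height e₀ (hclosed hem) _ ⟨h1.le.trans hmem.1, hmem.2.trans h3.le⟩ htip,
      y_eq_of_emanates hem]

/-- Every diagram is the Poincaré–Reeb graph of a smooth domain, in a suitable positive chart of the
collapse. -/
theorem exists_realization (G : GraphDiagram ι) : ∃ f : ℝ × ℝ → ℝ, ContDiff ℝ (⊤ : ℕ∞) f ∧
    (∀ p, f p = 0 → fderiv ℝ f p ≠ 0) ∧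
    IsDomainOfFiniteType Prod.fst {p | f p ≤ 0} {p | f p = 0} ∧
    ∃ c' : Collapse (Prod.fst : ℝ × ℝ → ℝ) {p | f p ≤ 0} ≃ₜ ℝ × ℝ,
      c' ∈ collapseOrientation Prod.fst canonicalOrientation {p | f p ≤ 0} ∧
      (∀ q, (c' q).1 = collapseProj Prod.fst {p | f p ≤ 0} q) ∧
      c' '' poincareReebSet Prod.fst {p | f p ≤ 0} =
        {q | ∃ e, q.1 ∈ Icc (G.s e) (G.t e) ∧ q.2 = G.y e q.1} ∧
      c' '' poincareReebVertices Prod.fst {p | f p ≤ 0} {p | f p = 0} =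
        {q | q.1 ∈ G.X ∧ q.2 = G.Y q.1} := by
  obtain ⟨A, B, h1, h2, h3⟩ := G.exists_levels
  let L : G.Levels := ⟨A, B, h1, h2, h3⟩
  obtain ⟨ε, hε, hsep, hF⟩ := exists_radius L
  let M : ∀ v ∈ G.X, VertexModel L ε v := fun v hv => (exists_vertexModel L hε hsep hv).some
  obtain ⟨g, hgc, hg⟩ := exists_collapse (M := M) hε hsep hF
  obtain ⟨c', hc', hc'o⟩ := exists_collapse_homeomorph (D := {p | defFun L ε M p ≤ 0}) hgc
    (fun x => (hg x).monotone) (fun x => (hg x).bounded) fun x => (hg x).eq_iff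
  refine ⟨defFun L ε M, contDiff_defFun hε hsep, fderiv_defFun_ne_zero hε hsep,
    isDomainOfFiniteType_defFun hε hsep, c', hc'o, ?_, ?_, ?_⟩
  · rintro ⟨p⟩
    exact (Prod.ext_iff.1 (hc' p)).1
  · rw [poincareReebSet, image_image]
    simp only [hc']
    ext ⟨x, w⟩
    constructor
    · rintro ⟨⟨x', y⟩, hD, heq⟩
      rw [Prod.mk.injEq] at heq
      obtain ⟨rfl, rfl⟩ := heq
      obtain ⟨e, he, y', hy', hseg⟩ := exists_arc_of_defFun_nonpos hε hsep hD
      refine ⟨e, he, ?_⟩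
      have h4 : g (x', y) = g (x', y') := eq_of_uIcc_subset (D := {p | defFun L ε M p ≤ 0})
        (fun x => (hg x).eq_iff) hseg
      rw [h4]
      exact (hg x').eq_height e he y' hy' (hseg y' right_mem_uIcc)
    · rintro ⟨e, he, hw⟩
      obtain ⟨y, hy, hD⟩ := exists_defFun_nonpos (M := M) hε hsep he
      refine ⟨(x, y), hD, ?_⟩
      rw [Prod.mk.injEq]
      exact ⟨rfl, ((hg x).eq_height e he y hy hD).trans hw.symm⟩
  · rw [poincareReebVertices, image_image, topCriticalSet_defFun hε hsep]
    simp only [hc']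
    ext ⟨x, w⟩
    constructor
    · rintro ⟨_, ⟨v, hv, rfl⟩, heq⟩
      rw [Prod.mk.injEq] at heq
      obtain ⟨rfl, rfl⟩ := heq
      exact ⟨hv, (hg v).apply_center hε hsep hv⟩
    · rintro ⟨hx, hw⟩
      refine ⟨_, ⟨x, hx, rfl⟩, ?_⟩
      rw [Prod.mk.injEq]
      exact ⟨rfl, ((hg x).apply_center hε hsep hx).trans hw.symm⟩

end GraphDiagram

/-! ### The diagram of a transversal graph -/

/-- A continuous injective function on an open segment has no minimum. -/
theorem exists_lt_of_homeomorph_Ioo {P : Type*} [TopologicalSpace P] {E : Set P}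
    (h : E ≃ₜ Ioo (0 : ℝ) 1) {f : P → ℝ} (hf : ContinuousOn f E) (hinj : InjOn f E) {p : P}
    (hp : p ∈ E) : ∃ q ∈ E, f q < f p := by
  by_contra! hmin
  have hpre : ∀ s : Set (Ioo (0 : ℝ) 1), s.OrdConnected → IsPreconnected s := fun s hs => by
    rw [← IsInducing.subtypeVal.isPreconnected_image]
    refine OrdConnected.isPreconnected ⟨?_⟩
    rintro _ ⟨a, ha, rfl⟩ _ ⟨b, hb, rfl⟩ c hc
    exact ⟨⟨c, a.2.1.trans_le hc.1, hc.2.trans_lt b.2.2⟩, hs.out ha hb hc, rfl⟩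
  have hc : Continuous fun a : Ioo (0 : ℝ) 1 => f (h.symm a) :=
    (continuousOn_iff_continuous_domRestrict.1 hf).comp h.symm.continuous
  obtain ⟨a, ha⟩ : ∃ a : Ioo (0 : ℝ) 1, h.symm a = ⟨p, hp⟩ := ⟨h ⟨p, hp⟩, h.symm_apply_apply _⟩
  have hai : ∀ b : Ioo (0 : ℝ) 1, b ≠ a → f p < f (h.symm b) := fun b hb => by
    refine lt_of_le_of_ne (hmin _ (h.symm b).2) fun heq => hb ?_
    have h1 : h.symm b = ⟨p, hp⟩ := Subtype.ext (hinj (h.symm b).2 hp heq.symm)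
    exact h.symm.injective (h1.trans ha.symm)
  have ha0 := a.2.1
  have ha1 := a.2.2
  let b : Ioo (0 : ℝ) 1 := ⟨a / 2, by constructor <;> linarith⟩
  let c : Ioo (0 : ℝ) 1 := ⟨(a + 1) / 2, by constructor <;> linarith⟩
  have hba : b < a := Subtype.mk_lt_mk.2 (by linarith)
  have hac : a < c := Subtype.mk_lt_mk.2 (by linarith)
  have hfa : f (h.symm a) = f p := by rw [ha]
  obtain ⟨w, hw1, hw2⟩ := exists_between (lt_min (hai b hba.ne) (hai c hac.ne'))
  obtain ⟨x, hx, hxw⟩ := (hpre _ ordConnected_Iic).intermediate_value (s := Iic a) (a := a) (b := b)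
    self_mem_Iic hba.le hc.continuousOn (show w ∈ Icc _ _ from
      ⟨hfa.le.trans hw1.le, hw2.le.trans (min_le_left _ _)⟩)
  obtain ⟨x', hx', hxw'⟩ := (hpre _ ordConnected_Ici).intermediate_value (s := Ici a) (a := a) (b := c)
    self_mem_Ici hac.le hc.continuousOn (show w ∈ Icc _ _ from
      ⟨hfa.le.trans hw1.le, hw2.le.trans (min_le_right _ _)⟩)
  have h1 : h.symm x = h.symm x' :=
    Subtype.ext (hinj (h.symm x).2 (h.symm x').2 (hxw.trans hxw'.symm))
  have h2 : x = a := le_antisymm hx ((h.symm.injective h1).symm ▸ hx')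
  beta_reduce at hxw
  rw [h2, hfa] at hxw
  exact hw1.ne hxw

namespace TransversalGraph

variable {P : Type*} [TopologicalSpace P] {π : P → ℝ} (G : TransversalGraph π)

theorem closure_subset_carrier {E : Set P} (hE : E ∈ G.openEdges) : closure E ⊆ G.carrier := by
  refine closure_minimal ?_ G.isClosed_carrier
  rw [G.carrier_eq]
  exact (subset_sUnion_of_mem hE).trans subset_union_right

/-- In coordinates that rectify the projection, an edge is the graph of a continuous function over a
compact interval, and the open edge is the part over the open interval. -/
theorem exists_arc_of_edge (T : P ≃ₜ ℝ × ℝ) (hT : ∀ p, (T p).1 = π p)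
    (hcompact : IsCompact G.carrier) {E : Set P} (hE : E ∈ G.openEdges) :
    ∃ (s t : ℝ) (y : ℝ → ℝ), s < t ∧ Continuous y ∧
      (∀ p, p ∈ closure E ↔ π p ∈ Icc s t ∧ (T p).2 = y (π p)) ∧
      ∀ p, p ∈ E ↔ π p ∈ Ioo s t ∧ (T p).2 = y (π p) := by
  have hπ : Continuous π := by
    rw [← funext hT]
    exact continuous_fst.comp T.continuous
  have hK : IsCompact (closure E) :=
    hcompact.of_isClosed_subset isClosed_closure (G.closure_subset_carrier hE)
  have hemb := G.transversal E hE
  have hinj : InjOn π (closure E) := injOn_iff_injective.2 hemb.injective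
  obtain ⟨φ⟩ := G.openEdge_homeo E hE
  have hpre : IsPreconnected E := by
    have h1 : PreconnectedSpace (Ioo (0 : ℝ) 1) :=
      isPreconnected_iff_preconnectedSpace.1 isPreconnected_Ioo
    have h2 : E = range fun x => (φ.symm x : P) := by
      rw [← Function.comp_def, φ.symm.surjective.range_comp, Subtype.range_coe]
    rw [h2]
    exact isPreconnected_range (by fun_prop)
  have hne : E.Nonempty := ⟨_, (φ.symm ⟨1 / 2, by norm_num⟩).2⟩
  have himg : π '' closure E = Icc (sInf (π '' closure E)) (sSup (π '' closure E)) :=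
    eq_Icc_of_connected_compact ⟨(hne.mono subset_closure).image π,
      hpre.closure.image π hπ.continuousOn⟩ (hK.image hπ)
  obtain ⟨s, hs⟩ : ∃ s, s = sInf (π '' closure E) := ⟨_, rfl⟩
  obtain ⟨t, ht⟩ : ∃ t, t = sSup (π '' closure E) := ⟨_, rfl⟩
  rw [← hs, ← ht] at himg
  have hcl : ∀ p ∈ closure E, π p ∈ Icc s t := fun p hp => himg ▸ mem_image_of_mem π hp
  have hinjE : InjOn π E := hinj.mono subset_closure
  have hopen : ∀ p ∈ E, π p ∈ Ioo s t := fun p hp => by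
    obtain ⟨q, hq, hqp⟩ := exists_lt_of_homeomorph_Ioo φ hπ.continuousOn hinjE hp
    obtain ⟨r, hr, hrp⟩ := exists_lt_of_homeomorph_Ioo φ hπ.neg.continuousOn
      (fun a ha b hb hab => hinjE ha hb (neg_injective hab)) hp
    exact ⟨(hcl q (subset_closure hq)).1.trans_lt hqp,
      (neg_lt_neg_iff.1 hrp).trans_le (hcl r (subset_closure hr)).2⟩
  have hst : s < t := by
    obtain ⟨p, hp⟩ := hne
    exact (hopen p hp).1.trans (hopen p hp).2
  have hsub : Ioo s t ⊆ π '' E := fun x hx => by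
    have hd : Icc s t ⊆ closure (π '' E) := himg ▸ image_closure_subset_closure_image hπ
    obtain ⟨a, ha, haE⟩ := mem_closure_iff.1 (hd ⟨le_rfl, hst.le⟩) (Iio x) isOpen_Iio hx.1
    obtain ⟨b, hb, hbE⟩ := mem_closure_iff.1 (hd ⟨hst.le, le_rfl⟩) (Ioi x) isOpen_Ioi hx.2
    exact (hpre.image π hπ.continuousOn).ordConnected.out haE hbE
      ⟨(mem_Iio.1 ha).le, (mem_Ioi.1 hb).le⟩
  have hrange : range ((closure E).domRestrict π) = Icc s t := by
    rw [range_domRestrict, himg]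
  let γ : Icc s t → closure E := fun x => hemb.toHomeomorph.symm ⟨x, hrange.symm ▸ x.2⟩
  have hγc : Continuous γ := by
    exact hemb.toHomeomorph.symm.continuous.comp (by fun_prop)
  have hγ : ∀ x, π (γ x) = x := fun x =>
    congrArg Subtype.val (hemb.toHomeomorph.apply_symm_apply ⟨x, hrange.symm ▸ x.2⟩)
  have hy : ∀ x (hx : x ∈ Icc s t), IccExtend hst.le (fun x => (T (γ x)).2) x =
      (T (γ ⟨x, hx⟩)).2 := fun x hx => IccExtend_of_mem _ _ hx
  have hmem : ∀ p, p ∈ closure E ↔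
      π p ∈ Icc s t ∧ (T p).2 = IccExtend hst.le (fun x => (T (γ x)).2) (π p) := fun p => by
    constructor
    · intro hp
      refine ⟨hcl p hp, ?_⟩
      rw [hy _ (hcl p hp)]
      have : (γ ⟨π p, hcl p hp⟩ : P) = p := hinj (γ _).2 hp (hγ _)
      rw [this]
    · rintro ⟨hp, h⟩
      rw [hy _ hp] at h
      have : p = γ ⟨π p, hp⟩ := T.injective (Prod.ext (by rw [hT, hT, hγ]) h)
      rw [this]
      exact (γ _).2
  refine ⟨s, t, IccExtend hst.le fun x => (T (γ x)).2, hst, ?_, hmem, fun p => ?_⟩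
  · exact (continuous_snd.comp (T.continuous.comp (continuous_subtype_val.comp hγc))).Icc_extend'
  · constructor
    · exact fun hp => ⟨hopen p hp, ((hmem p).1 (subset_closure hp)).2⟩
    · rintro ⟨hp, h⟩
      obtain ⟨q, hq, hqp⟩ := hsub hp
      rwa [← hinj (subset_closure hq) ((hmem p).2 ⟨Ioo_subset_Icc_self hp, h⟩) hqp]

end TransversalGraph

namespace ArcSystem

variable {ι : Type*} {G : ArcSystem ι}

theorem Emanates.not_neg {v σ : ℝ} {e : ι} (h : G.Emanates v σ e) : ¬ G.Emanates v (-σ) e := by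
  have := G.s_lt_t e
  rcases h with ⟨rfl, h⟩ | ⟨rfl, h⟩ <;> rintro (⟨h1, h2⟩ | ⟨h1, h2⟩) <;> linarith

/-- Two arcs on one side of a vertex and one on the other form a fork: over a nearby abscissa one of the
two is below the other. -/
theorem exists_isFork {v σ : ℝ} {e₀ a b : ι} (h₀ : G.Emanates v (-σ) e₀) (ha : G.Emanates v σ a)
    (hb : G.Emanates v σ b) (hab : a ≠ b)
    (hall : ∀ e τ, G.Emanates v τ e → e = e₀ ∨ e = a ∨ e = b) :
    ∃ e₀ e₁ e₂, G.IsFork v σ e₀ e₁ e₂ := by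
  have h1 : ∀ e, G.Emanates v (-σ) e ↔ e = e₀ := fun e => by
    refine ⟨fun h => ?_, fun h => h ▸ h₀⟩
    rcases hall e _ h with rfl | rfl | rfl
    · rfl
    · exact absurd h ha.not_neg
    · exact absurd h hb.not_neg
  have h2 : ∀ e, G.Emanates v σ e ↔ e = a ∨ e = b := fun e => by
    refine ⟨fun h => (hall e _ h).resolve_left ?_, ?_⟩
    · rintro rfl
      exact h.not_neg h₀
    · rintro (rfl | rfl)
      · exact ha
      · exact hb
  obtain ⟨r, k1, k2⟩ := (ha.eventually.and hb.eventually).exists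
  rcases below_or_below hab k1.1 k1.2 k2.1 k2.2 with h | h
  · exact ⟨e₀, a, b, h1, h2, h⟩
  · exact ⟨e₀, b, a, h1, fun e => (h2 e).trans or_comm, h⟩

end ArcSystem

namespace TransversalGraph

open ArcSystem

variable {P : Type*} [TopologicalSpace P] {π : P → ℝ} (G : TransversalGraph π)

/-- A compact generic graph with two-sided vertices is described by a diagram. -/
theorem exists_graphDiagram (T : P ≃ₜ ℝ × ℝ) (hT : ∀ p, (T p).1 = π p)
    (hcompact : IsCompact G.carrier) (hne : G.carrier.Nonempty)
    (hgen : G.IsGeneric) (htwo : G.IsTwoSided) :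
    ∃ D : GraphDiagram G.openEdges,
      (∀ p, p ∈ G.carrier ↔ ∃ e, π p ∈ Icc (D.s e) (D.t e) ∧ (T p).2 = D.y e (π p)) ∧
      ∀ p, p ∈ G.vertices ↔ π p ∈ D.X ∧ (T p).2 = D.Y (π p) := by
  have harc := fun E : G.openEdges => G.exists_arc_of_edge T hT hcompact E.2
  choose s t y hst hyc hcl hop using harc
  have hTs : ∀ x w, π (T.symm (x, w)) = x ∧ (T (T.symm (x, w))).2 = w := fun x w => by
    rw [← hT, T.apply_symm_apply]
    exact ⟨rfl, rfl⟩
  let S : ArcSystem G.openEdges :=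
    { s := s
      t := t
      y := y
      s_lt_t := hst
      continuous_y := hyc
      y_ne := fun E E' hne x h1 h2 h3 h4 heq => by
        obtain ⟨k1, k2⟩ := hTs x (y E x)
        refine disjoint_left.1 (G.disjoint_openEdges E E.2 E' E'.2 fun h => hne (Subtype.ext h))
          ((hop E (T.symm (x, y E x))).2 ?_) ((hop E' (T.symm (x, y E x))).2 ?_)
        · rw [k1, k2]
          exact ⟨⟨h1, h2⟩, rfl⟩
        · rw [k1, k2]
          exact ⟨⟨h3, h4⟩, heq⟩ }
  obtain ⟨p₀, -⟩ := id hne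
  have : Nonempty P := ⟨p₀⟩
  obtain ⟨Y, hY⟩ : ∃ Y : ℝ → ℝ, ∀ p ∈ G.vertices, Y (π p) = (T p).2 :=
    ⟨fun v => (T (Function.invFunOn π G.vertices v)).2, fun p hp => by
      beta_reduce
      rw [hgen.injOn.leftInvOn_invFunOn hp]⟩
  -- the ends of the arcs are vertices
  have hend : ∀ (E : G.openEdges) (x : ℝ), x = s E ∨ x = t E →
      T.symm (x, y E x) ∈ G.vertices := fun E x hx => by
    obtain ⟨k1, k2⟩ := hTs x (y E x)
    have h := hst E
    refine (G.edge_ends E E.2).1 ⟨(hcl E _).2 ?_, fun hE => ?_⟩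
    · rw [k1, k2]
      rcases hx with rfl | rfl
      · exact ⟨⟨le_rfl, h.le⟩, rfl⟩
      · exact ⟨⟨h.le, le_rfl⟩, rfl⟩
    · have h1 := ((hop E _).1 hE).1
      rw [k1] at h1
      rcases hx with rfl | rfl
      · exact h1.1.false
      · exact h1.2.false
  have hendX : ∀ (E : G.openEdges) (x : ℝ), x = s E ∨ x = t E →
      x ∈ π '' G.vertices ∧ y E x = Y x := fun E x hx => by
    obtain ⟨k1, k2⟩ := hTs x (y E x)
    have h1 := hY _ (hend E x hx)
    rw [k1, k2] at h1
    exact ⟨⟨_, hend E x hx, k1⟩, h1.symm⟩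
  have hmem : ∀ p ∈ G.vertices, ∀ E : G.openEdges,
      p ∈ closure (E : Set P) ↔ S.Emanates (π p) 1 E ∨ S.Emanates (π p) (-1) E := by
    intro p hp E
    rw [emanates_one, emanates_neg_one, hcl]
    constructor
    · rintro ⟨h1, h2⟩
      have h3 : p ∉ (E : Set P) := disjoint_left.1 (G.disjoint_vertices E E.2) hp
      rw [hop] at h3
      by_contra! hcon
      exact h3 ⟨⟨lt_of_le_of_ne h1.1 hcon.1, lt_of_le_of_ne h1.2 hcon.2.symm⟩, h2⟩
    · have h := hst E
      rintro (h1 | h1)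
      · have h2 := (hendX E _ (Or.inl h1.symm)).2
        rw [hY p hp] at h2
        exact ⟨⟨h1.le, h1.symm.trans_lt h |>.le⟩, h2.symm⟩
      · have h2 := (hendX E _ (Or.inr h1.symm)).2
        rw [hY p hp] at h2
        exact ⟨⟨h.le.trans h1.le, h1.ge⟩, h2.symm⟩
  have hvertex : ∀ p ∈ G.vertices, ∃ σ : ℝ, (σ = 1 ∨ σ = -1) ∧
      ((∃ e, S.IsEnd (π p) σ e) ∨ ∃ e₀ e₁ e₂, S.IsFork (π p) σ e₀ e₁ e₂) := by
    intro p hp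
    have hstar : ∀ (E : G.openEdges) τ, S.Emanates (π p) τ E → p ∈ closure (E : Set P) :=
      fun E τ h => (hmem p hp E).2 (by rcases h.sign with rfl | rfl <;> simp [h])
    rcases hgen.valency_eq p hp with hval | hval
    · obtain ⟨E, hE⟩ := ncard_eq_one.1 hval
      have hEm : E ∈ G.openEdges ∧ p ∈ closure E := by
        have : E ∈ ({E} : Set (Set P)) := rfl
        rwa [← hE] at this
      have huniq : ∀ (E' : G.openEdges) τ, S.Emanates (π p) τ E' → E' = ⟨E, hEm.1⟩ :=
        fun E' τ h => Subtype.ext (by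
          have : (E' : Set P) ∈ ({E} : Set (Set P)) := hE ▸ ⟨E'.2, hstar E' τ h⟩
          exact this)
      obtain ⟨σ, hσ, hem⟩ : ∃ σ : ℝ, (σ = 1 ∨ σ = -1) ∧ S.Emanates (π p) σ ⟨E, hEm.1⟩ := by
        rcases (hmem p hp ⟨E, hEm.1⟩).1 hEm.2 with h | h
        · exact ⟨1, Or.inl rfl, h⟩
        · exact ⟨-1, Or.inr rfl, h⟩
      refine ⟨σ, hσ, Or.inl ⟨⟨E, hEm.1⟩, fun E' => ⟨huniq E' σ, fun h => h ▸ hem⟩,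
        fun E' h => ?_⟩⟩
      have h1 := huniq E' _ h
      rw [h1] at h
      exact hem.not_neg h
    · obtain ⟨A, B, C, hAB, hAC, hBC, hE⟩ := ncard_eq_three.1 hval
      have hmemABC : ∀ E ∈ ({A, B, C} : Set (Set P)), E ∈ G.openEdges ∧ p ∈ closure E :=
        fun E h => by rwa [← hE] at h
      obtain ⟨hA, hpA⟩ := hmemABC A (by simp)
      obtain ⟨hB, hpB⟩ := hmemABC B (by simp)
      obtain ⟨hC, hpC⟩ := hmemABC C (by simp)
      obtain ⟨a, ha⟩ : ∃ a : G.openEdges, a = ⟨A, hA⟩ := ⟨_, rfl⟩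
      obtain ⟨b, hb⟩ : ∃ b : G.openEdges, b = ⟨B, hB⟩ := ⟨_, rfl⟩
      obtain ⟨c, hc⟩ : ∃ c : G.openEdges, c = ⟨C, hC⟩ := ⟨_, rfl⟩
      have hall : ∀ (E : G.openEdges) τ, S.Emanates (π p) τ E → E = a ∨ E = b ∨ E = c := by
        intro E τ h
        have h1 : (E : Set P) ∈ ({A, B, C} : Set (Set P)) := hE ▸ ⟨E.2, hstar E τ h⟩
        rw [ha, hb, hc, Subtype.ext_iff, Subtype.ext_iff, Subtype.ext_iff]
        exact h1
      have hab : a ≠ b := fun h => hAB (by rw [ha, hb] at h; exact congrArg Subtype.val h)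
      have hac : a ≠ c := fun h => hAC (by rw [ha, hc] at h; exact congrArg Subtype.val h)
      have hbc : b ≠ c := fun h => hBC (by rw [hb, hc] at h; exact congrArg Subtype.val h)
      have hleft : ∃ E, S.Emanates (π p) (-1) E := by
        obtain ⟨E, hE', hpE, q, hq, hlt⟩ := (htwo p hp hval).1
        refine ⟨⟨E, hE'⟩, ((hmem p hp ⟨E, hE'⟩).1 hpE).resolve_left fun h => ?_⟩
        have h1 : s ⟨E, hE'⟩ = π p := emanates_one.1 h
        have h2 := ((hop ⟨E, hE'⟩ q).1 hq).1.1
        linarith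
      have hright : ∃ E, S.Emanates (π p) 1 E := by
        obtain ⟨E, hE', hpE, q, hq, hlt⟩ := (htwo p hp hval).2
        refine ⟨⟨E, hE'⟩, ((hmem p hp ⟨E, hE'⟩).1 hpE).resolve_right fun h => ?_⟩
        have h1 : t ⟨E, hE'⟩ = π p := emanates_neg_one.1 h
        have h2 := ((hop ⟨E, hE'⟩ q).1 hq).1.2
        linarith
      have hga := (hmem p hp a).1 (by rw [ha]; exact hpA)
      have hgb := (hmem p hp b).1 (by rw [hb]; exact hpB)
      have hgc := (hmem p hp c).1 (by rw [hc]; exact hpC)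
      have hone : (1 : ℝ) = 1 ∨ (1 : ℝ) = -1 := Or.inl rfl
      have hneg : (-1 : ℝ) = 1 ∨ (-1 : ℝ) = -1 := Or.inr rfl
      have hnn : ∀ {E}, S.Emanates (π p) 1 E → S.Emanates (π p) (- -1) E := fun h => by
        rwa [neg_neg]
      rcases hga with ka | ka <;> rcases hgb with kb | kb <;> rcases hgc with kc | kc
      · obtain ⟨E, h⟩ := hleft
        rcases hall E _ h with rfl | rfl | rfl
        · exact absurd h ka.not_neg
        · exact absurd h kb.not_neg
        · exact absurd h kc.not_neg
      · exact ⟨1, hone, Or.inr (exists_isFork kc ka kb hab fun E τ h => by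
          have := hall E τ h; tauto)⟩
      · exact ⟨1, hone, Or.inr (exists_isFork kb ka kc hac fun E τ h => by
          have := hall E τ h; tauto)⟩
      · exact ⟨-1, hneg, Or.inr (exists_isFork (hnn ka) kb kc hbc hall)⟩
      · exact ⟨1, hone, Or.inr (exists_isFork ka kb kc hbc hall)⟩
      · exact ⟨-1, hneg, Or.inr (exists_isFork (hnn kb) ka kc hac fun E τ h => by
          have := hall E τ h; tauto)⟩
      · exact ⟨-1, hneg, Or.inr (exists_isFork (hnn kc) ka kb hab fun E τ h => by
          have := hall E τ h; tauto)⟩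
      · obtain ⟨E, h⟩ := hright
        rcases hall E _ h with rfl | rfl | rfl
        · exact absurd (hnn h) ka.not_neg
        · exact absurd (hnn h) kb.not_neg
        · exact absurd (hnn h) kc.not_neg
  have hX : ∀ v, v ∈ (G.finite_vertices.image π).toFinset ↔ v ∈ π '' G.vertices := fun v =>
    Finite.mem_toFinset _
  let D : GraphDiagram G.openEdges :=
    { S with
      X := (G.finite_vertices.image π).toFinset
      Y := Y
      s_mem := fun E => (hX _).2 (hendX E _ (Or.inl rfl)).1
      t_mem := fun E => (hX _).2 (hendX E _ (Or.inr rfl)).1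
      y_s := fun E => (hendX E _ (Or.inl rfl)).2
      y_t := fun E => (hendX E _ (Or.inr rfl)).2
      y_ne_Y := fun E v hv h1 h2 heq => by
        obtain ⟨p, hp, rfl⟩ := (hX v).1 hv
        exact disjoint_left.1 (G.disjoint_vertices E E.2) hp
          ((hop E p).2 ⟨⟨h1, h2⟩, (hY p hp).symm.trans heq.symm⟩)
      nonempty := by
        obtain ⟨p, hp⟩ := hne
        rw [G.carrier_eq] at hp
        rcases hp with hp | ⟨E, hE, -⟩
        · exact ⟨_, (hX _).2 ⟨p, hp, rfl⟩⟩
        · exact ⟨_, (hX _).2 (hendX ⟨E, hE⟩ _ (Or.inl rfl)).1⟩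
      vertex := fun v hv => by
        obtain ⟨p, hp, rfl⟩ := (hX v).1 hv
        exact hvertex p hp }
  refine ⟨D, fun p => ⟨fun hp => ?_, ?_⟩, fun p => ⟨fun hp => ?_, ?_⟩⟩
  · rw [G.carrier_eq] at hp
    rcases hp with hp | ⟨E, hE, hpE⟩
    · -- a vertex has positive valency
      have hpos : G.valency p ≠ 0 := by
        rcases hgen.valency_eq p hp with h | h <;> rw [h] <;> norm_num
      obtain ⟨E, hE, hpE⟩ := nonempty_of_ncard_ne_zero hpos
      exact ⟨⟨E, hE⟩, (hcl ⟨E, hE⟩ p).1 hpE⟩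
    · exact ⟨⟨E, hE⟩, (hcl ⟨E, hE⟩ p).1 (subset_closure hpE)⟩
  · rintro ⟨E, h⟩
    exact G.closure_subset_carrier E.2 ((hcl E p).2 h)
  · exact ⟨(hX _).2 ⟨p, hp, rfl⟩, (hY p hp).symm⟩
  · rintro ⟨h1, h2⟩
    obtain ⟨q, hq, hqp⟩ := (hX _).1 h1
    have h3 : p = q := T.injective (Prod.ext (by rw [hT, hT, hqp])
      (h2.trans (by rw [← hqp]; exact hY q hq)))
    rwa [h3]

end TransversalGraph

theorem mainTheorem4 {P : Type*} [TopologicalSpace P] (π : P → ℝ) (o : Set (P ≃ₜ ℝ × ℝ))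
    (hP : IsVerticalPlane π o) (G : TransversalGraph π)
    (hcompact : IsCompact G.carrier) (hconn : IsConnected G.carrier)
    (hgen : G.IsGeneric) (htwo : G.IsTwoSided) :
    ∃ f : ℝ × ℝ → ℝ, ContDiff ℝ (⊤ : ℕ∞) f ∧
      (∀ p, f p = 0 → fderiv ℝ f p ≠ 0) ∧
      ∃ D : Set (ℝ × ℝ),
        IsDomainOfFiniteType Prod.fst D {p | f p = 0} ∧
        ∃ (Φ : P ≃ₜ Collapse (Prod.fst : ℝ × ℝ → ℝ) D) (ψ : ℝ ≃ₜ ℝ),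
          IsVerticalEquivalence π o (collapseProj Prod.fst D)
            (collapseOrientation Prod.fst canonicalOrientation D) Φ ψ ∧
          Φ '' G.carrier = poincareReebSet Prod.fst D ∧
          Φ '' G.vertices = poincareReebVertices Prod.fst D {p | f p = 0} := by
  obtain ⟨T, hT, c, hc, hcT⟩ := hP.exists_homeomorph
  obtain ⟨A, hA, hV⟩ := G.exists_graphDiagram T hT hcompact hconn.nonempty hgen htwo
  have : Finite G.openEdges := G.finite_openEdges
  have : Fintype G.openEdges := Fintype.ofFinite _
  obtain ⟨f, hf, hdf, hD, c', hc', hproj, himg, hvert⟩ := A.exists_realization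
  have hfix : ∀ (X : Set P) (Z : Set (Collapse (Prod.fst : ℝ × ℝ → ℝ) {p | f p ≤ 0})),
      (∀ p, p ∈ X ↔ T p ∈ c' '' Z) → T.trans c'.symm '' X = Z := fun X Z h => by
    have h1 : X = T ⁻¹' (c' '' Z) := Set.ext h
    change (c'.symm ∘ T) '' X = Z
    rw [h1, image_comp, image_preimage_eq _ T.surjective, ← image_comp]
    simp
  refine ⟨f, hf, hdf, {p | f p ≤ 0}, hD, T.trans c'.symm, Homeomorph.refl ℝ,
    ⟨⟨c, hc, c', hc', fun q => ?_⟩, strictMono_id, fun p => ?_⟩, hfix _ _ fun p => ?_,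
    hfix _ _ fun p => ?_⟩
  · simpa using hcT q
  · rw [← hproj]
    simpa using hT p
  · rw [himg, hA]
    simp only [mem_ofPred_eq, hT]
  · rw [hvert, hV]
    simp only [mem_ofPred_eq, hT]
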